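/- Let $R$ be a principal ideal domain and let $M_\bullet$, $M'_\bullet$ be simplicial objects in the category of coassociative, counital $R$-coalgebras such that $M_n$ and $M'_n$ are free $R$-modules for all $n\ge 0$ and such that both are reduced, i.e. $M_0\cong R$ and $M'_0\cong R$ as coalgebras. For a simplicial $R$-module $X_\bullet$ let $\mathcal A_N(X_\bullet)$ be its normalized chain complex ($X_n$ modulo degenerate elements, with the alternating sum of the faces as differential), let $\boxtimes$ be the levelwise tensor product, and let $$f\colon \mathcal A_N(X_\bullet\boxtimes X'_\bullet)\to \mathcal A_N(X_\bullet)\otimes\mathcal A_N(X'_\bullet),\qquad f(x\boxtimes x')=\sum_{\ell=0}^{n} x_{0\ldots \ell}\otimes x'_{\ell\ldots n}\quad (x\in X_n,\ x'\in X'_n)$$ be the Alexander–Whitney map. If $\delta$ is the levelwise comultiplication of a simplicial coalgebra $N_\bullet$, then $f\circ\mathcal A_N(\delta)$ makes $\mathcal A_N(N_\bullet)$ into a chain coalgebra; thus $\mathcal A_N(M_\bullet\boxtimes M'_\bullet)$ and $\mathcal A_N(M_\bullet)\otimes\mathcal A_N(M'_\bullet)$ (with the tensor product coalgebra structure) are connected,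 coaugmented chain coalgebras. Then the Alexander–Whitney map $$f\colon \mathcal A_N(M_\bullet\boxtimes M'_\bullet)\to\mathcal A_N(M_\bullet)\otimes\mathcal A_N(M'_\bullet)$$ is a DCSH map (a morphism of chain coalgebras up to strong homotopy). That is, $f$ is a chain map and there is a morphism of chain algebras $$\omega\colon\Omega\,\mathcal A_N(M_\bullet\boxtimes M'_\bullet)\to\Omega\big(\mathcal A_N(M_\bullet)\otimes\mathcal A_N(M'_\bullet)\big)$$ such that $\omega(s^{-1}c)-s^{-1}f(c)\in\bigoplus_{k\ge2}(s^{-1}\overline{D})^{\otimes k}$ for all $c$, where $D=\mathcal A_N(M_\bullet)\otimes\mathcal A_N(M'_\bullet)$. Here the cobar construction $\Omega C$ of a connected, coaugmented chain coalgebra $C$ is the tensor algebra on the desuspension $s^{-1}\overline C$ of its coaugmentation coideal, with the derivation differential determined by $d_\Omega(s^{-1}c)=-s^{-1}(dc)+\sum(-1)^{|c_1|}s^{-1}c_1\,|\,s^{-1}c_2$, where $\Delta c=\sum c_1\otimes c_2$ and $s^{-1}$ of an element of degree $0$ is $0$. -/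

import Mathlib

open CategoryTheory Simplicial
open scoped TensorProduct DirectSum

universe u v

noncomputable section


namespace DCSH

/-- An `ℕ`-graded `R`-module: a module which is the internal direct sum of its homogeneous parts. -/
structure GrMod (R : Type u) [CommRing R] where
  carrier : Type v
  [addCommGroup : AddCommGroup carrier]
  [module : Module R carrier]
  deg : ℕ → Submodule R carrier
  isInternal : DirectSum.IsInternal deg

attribute [instance] GrMod.addCommGroup GrMod.module

namespace GrMod

variable {R : Type u} [CommRing R]

/-- The linear map on `V` which agrees with `φ n` on the homogeneous part of degree `n`. -/
def glue (V : GrMod.{u, v} R) {P : Type*} [AddCommMonoid P] [Module R P]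
    (φ : ℕ → V.carrier →ₗ[R] P) : V.carrier →ₗ[R] P :=
  DirectSum.toModule R ℕ P (fun n => (φ n).domRestrict (V.deg n)) ∘ₗ
    ((LinearEquiv.ofBijective (DirectSum.coeLinearMap V.deg) V.isInternal).symm :
      V.carrier →ₗ[R] ⨁ n, V.deg n)

theorem glue_apply (V : GrMod.{u, v} R) {P : Type*} [AddCommMonoid P] [Module R P]
    (φ : ℕ → V.carrier →ₗ[R] P) {n : ℕ} {x : V.carrier} (hx : x ∈ V.deg n) :
    V.glue φ x = φ n x := by
  have h : (LinearEquiv.ofBijective (DirectSum.coeLinearMap V.deg) V.isInternal).symm x =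
      DirectSum.lof R ℕ (fun n => V.deg n) n ⟨x, hx⟩ := by
    rw [LinearEquiv.symm_apply_eq]
    exact (DirectSum.coeLinearMap_lof V.deg n ⟨x, hx⟩).symm
  rw [glue, LinearMap.comp_apply, LinearEquiv.coe_coe, h, DirectSum.toModule_lof]
  rfl

theorem iSup_deg (V : GrMod.{u, v} R) : ⨆ n, V.deg n = ⊤ :=
  V.isInternal.submodule_iSup_eq_top

theorem hom_induction (V : GrMod.{u, v} R) {p : V.carrier → Prop} (x : V.carrier)
    (h : ∀ n, ∀ x ∈ V.deg n, p x) (h0 : p 0) (hadd : ∀ x y, p x → p y → p (x + y)) : p x := by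
  have hx : x ∈ ⨆ n, V.deg n := by rw [V.iSup_deg]; trivial
  exact Submodule.iSup_induction V.deg (motive := p) hx h h0 hadd

theorem hom_ext (V : GrMod.{u, v} R) {P : Type*} [AddCommMonoid P] [Module R P]
    {f g : V.carrier →ₗ[R] P} (h : ∀ n, ∀ x ∈ V.deg n, f x = g x) : f = g := by
  ext x
  refine V.hom_induction x h (by simp) ?_
  intro x y hx hy
  simp [hx, hy]

/-- The sign operator `x ↦ (-1) ^ |x| • x`. -/
def sgn (V : GrMod.{u, v} R) : V.carrier →ₗ[R] V.carrier :=
  V.glue fun n => (-1 : R) ^ n • LinearMap.id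

theorem sgn_apply (V : GrMod.{u, v} R) {n : ℕ} {x : V.carrier} (hx : x ∈ V.deg n) :
    V.sgn x = (-1 : R) ^ n • x := by
  simp [sgn, V.glue_apply _ hx]

/-- A family of submodules which spans and is separated by projections is an internal grading. -/
theorem isInternal_of_proj {C : Type*} [AddCommGroup C] [Module R C] (deg : ℕ → Submodule R C)
    (htop : ⨆ n, deg n = ⊤) (π : ℕ → C →ₗ[R] C)
    (hπ : ∀ m n, ∀ x ∈ deg n, π m x = if n = m then x else 0) : DirectSum.IsInternal deg := by
  have key : ∀ (m : ℕ) (v : ⨁ n, deg n), π m (DirectSum.coeLinearMap deg v) = v m := by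
    intro m v
    induction v using DirectSum.induction_on with
    | zero => simp
    | of i x =>
      rw [DirectSum.coeLinearMap_of, hπ m i x x.2]
      by_cases h : i = m
      · subst h; simp
      · rw [DirectSum.of_eq_of_ne _ _ _ (Ne.symm h)]; simp [h]
    | add x y hx hy => simp [hx, hy]
  constructor
  · intro v w hvw
    have hvw' : DirectSum.coeLinearMap deg v = DirectSum.coeLinearMap deg w := hvw
    ext m
    rw [← key, ← key, hvw']
  · have : LinearMap.range (DirectSum.coeLinearMap deg) = ⊤ := by
      rw [DirectSum.range_coeLinearMap, htop]
    exact LinearMap.range_eq_top.mp this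

/-- The projection onto the part of degree `m`. -/
def proj (V : GrMod.{u, v} R) (m : ℕ) : V.carrier →ₗ[R] V.carrier :=
  V.glue fun n => if n = m then LinearMap.id else 0

theorem proj_apply (V : GrMod.{u, v} R) (m : ℕ) {n : ℕ} {x : V.carrier} (hx : x ∈ V.deg n) :
    V.proj m x = if n = m then x else 0 := by
  rw [proj, V.glue_apply _ hx]
  split_ifs <;> rfl

/-- The homogeneous part of degree `n` of `V ⊗ W`: the span of the `x ⊗ y` with
`|x| + |y| = n`. -/
def tensorDeg (V W : GrMod.{u, v} R) (n : ℕ) : Submodule R (V.carrier ⊗[R] W.carrier) :=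
  Submodule.span R {z | ∃ i j, i + j = n ∧ ∃ x ∈ V.deg i, ∃ y ∈ W.deg j, z = x ⊗ₜ[R] y}

theorem tmul_mem (V W : GrMod.{u, v} R) {i j n : ℕ} (h : i + j = n) {x : V.carrier}
    (hx : x ∈ V.deg i) {y : W.carrier} (hy : y ∈ W.deg j) : x ⊗ₜ[R] y ∈ V.tensorDeg W n :=
  Submodule.subset_span ⟨i, j, h, x, hx, y, hy, rfl⟩

theorem tensor_hom_ext (V W : GrMod.{u, v} R) {P : Type*} [AddCommMonoid P] [Module R P]
    {f g : V.carrier ⊗[R] W.carrier →ₗ[R] P}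
    (h : ∀ i j, ∀ x ∈ V.deg i, ∀ y ∈ W.deg j, f (x ⊗ₜ y) = g (x ⊗ₜ y)) : f = g := by
  refine TensorProduct.ext (V.hom_ext fun i x hx => W.hom_ext fun j y hy => ?_)
  exact h i j x hx y hy

theorem tensorDeg_isInternal (V W : GrMod.{u, v} R) :
    DirectSum.IsInternal (V.tensorDeg W) := by
  refine isInternal_of_proj _ ?_
    (fun n => ∑ p ∈ Finset.HasAntidiagonal.antidiagonal n, TensorProduct.map (V.proj p.1) (W.proj p.2)) ?_
  · rw [eq_top_iff]
    rintro z -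
    induction z using TensorProduct.induction_on with
    | zero => exact zero_mem _
    | add x y hx hy => exact add_mem hx hy
    | tmul x y =>
      refine V.hom_induction (p := fun x => x ⊗ₜ[R] y ∈ ⨆ n, V.tensorDeg W n) x
        (fun i x hx => ?_) (by simp)
        (fun a b ha hb => by rw [TensorProduct.add_tmul]; exact add_mem ha hb)
      refine W.hom_induction (p := fun y => x ⊗ₜ[R] y ∈ ⨆ n, V.tensorDeg W n) y
        (fun j y hy => ?_) (by simp)
        (fun a b ha hb => by rw [TensorProduct.tmul_add]; exact add_mem ha hb)
      exact (le_iSup (V.tensorDeg W) (i + j)) (V.tmul_mem W rfl hx hy)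
  · intro m n z hz
    induction hz using Submodule.span_induction with
    | zero => simp
    | add x y _ _ hx hy => rw [map_add, hx, hy]; split_ifs <;> simp
    | smul a x _ hx => rw [map_smul, hx]; split_ifs <;> simp
    | mem z hz =>
      obtain ⟨i, j, hij, x, hx, y, hy, rfl⟩ := hz
      simp only [LinearMap.sum_apply, TensorProduct.map_tmul, V.proj_apply _ hx,
        W.proj_apply _ hy]
      by_cases h : n = m
      · rw [if_pos h, Finset.sum_eq_single (i, j)]
        · simp
        · rintro ⟨a, b⟩ _ hab
          by_cases hia : i = a
          · have : j ≠ b := fun hjb => hab (by rw [hia, hjb])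
            simp [this]
          · simp [hia]
        · intro hn
          exact absurd (Finset.HasAntidiagonal.mem_antidiagonal.mpr (hij.trans h)) hn
      · rw [if_neg h]
        refine Finset.sum_eq_zero ?_
        rintro ⟨a, b⟩ hab
        rw [Finset.HasAntidiagonal.mem_antidiagonal] at hab
        by_cases hia : i = a
        · have : j ≠ b := by rintro rfl; subst hia; exact h (hij.symm.trans hab)
          simp [this]
        · simp [hia]

/-- The tensor product of graded modules. -/
abbrev tensor (V W : GrMod.{u, v} R) : GrMod.{u, v} R where
  carrier := V.carrier ⊗[R] W.carrier
  deg := V.tensorDeg W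
  isInternal := V.tensorDeg_isInternal W

theorem tensor_induction (V W : GrMod.{u, v} R) {n : ℕ} {p : V.carrier ⊗[R] W.carrier → Prop}
    {z : V.carrier ⊗[R] W.carrier} (hz : z ∈ V.tensorDeg W n)
    (h : ∀ i j, i + j = n → ∀ x ∈ V.deg i, ∀ y ∈ W.deg j, p (x ⊗ₜ y)) (h0 : p 0)
    (hadd : ∀ x y, p x → p y → p (x + y)) : p z := by
  have hsm : ∀ (a : R) z, z ∈ V.tensorDeg W n → p z ∧ p (a • z) := by
    intro a z hz
    induction hz using Submodule.span_induction generalizing a with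
    | mem z hz =>
      obtain ⟨i, j, hij, x, hx, y, hy, rfl⟩ := hz
      exact ⟨h i j hij x hx y hy, by
        rw [TensorProduct.smul_tmul']; exact h i j hij _ (Submodule.smul_mem _ _ hx) y hy⟩
    | zero => simpa using h0
    | add x y _ _ hx hy =>
      rw [smul_add]
      exact ⟨hadd _ _ (hx a).1 (hy a).1, hadd _ _ (hx a).2 (hy a).2⟩
    | smul b x _ hx => rw [smul_smul]; exact ⟨(hx b).2, (hx _).2⟩
  exact (hsm 1 z hz).1

/-- The Koszul symmetry `x ⊗ y ↦ (-1) ^ (|x| |y|) y ⊗ x`. -/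
def braid (V W : GrMod.{u, v} R) :
    V.carrier ⊗[R] W.carrier →ₗ[R] W.carrier ⊗[R] V.carrier :=
  TensorProduct.lift (V.glue fun i =>
    ((TensorProduct.mk R W.carrier V.carrier).flip).compl₂ (W.sgn ^ i))

theorem sgn_pow_apply (W : GrMod.{u, v} R) (i : ℕ) {j : ℕ} {y : W.carrier} (hy : y ∈ W.deg j) :
    (W.sgn ^ i) y = (-1 : R) ^ (i * j) • y := by
  induction i with
  | zero => simp
  | succ i ih =>
    rw [pow_succ', Module.End.mul_apply, ih, map_smul, W.sgn_apply hy, smul_smul, ← pow_add]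
    congr 2; ring

theorem braid_tmul (V W : GrMod.{u, v} R) {i j : ℕ} {x : V.carrier} (hx : x ∈ V.deg i)
    {y : W.carrier} (hy : y ∈ W.deg j) :
    V.braid W (x ⊗ₜ y) = (-1 : R) ^ (i * j) • (y ⊗ₜ[R] x) := by
  rw [braid, TensorProduct.lift.tmul, V.glue_apply _ hx]
  simp [W.sgn_pow_apply i hy, TensorProduct.smul_tmul']

/-- `(x ⊗ x') ⊗ (y ⊗ y') ↦ (-1) ^ (|x'| |y|) (x ⊗ y) ⊗ (x' ⊗ y')`. -/
def midSwap (V W : GrMod.{u, v} R) (A B : Type v) [AddCommGroup A] [Module R A]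
    [AddCommGroup B] [Module R B] :
    (A ⊗[R] V.carrier) ⊗[R] (W.carrier ⊗[R] B) →ₗ[R]
      (A ⊗[R] W.carrier) ⊗[R] (V.carrier ⊗[R] B) :=
  (TensorProduct.assoc R A W.carrier (V.carrier ⊗[R] B)).symm.toLinearMap ∘ₗ
    (((TensorProduct.assoc R W.carrier V.carrier B).toLinearMap ∘ₗ
      (V.braid W).rTensor B ∘ₗ
      (TensorProduct.assoc R V.carrier W.carrier B).symm.toLinearMap).lTensor A) ∘ₗ
    (TensorProduct.assoc R A V.carrier (W.carrier ⊗[R] B)).toLinearMap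

theorem midSwap_tmul (V W : GrMod.{u, v} R) {A B : Type v} [AddCommGroup A] [Module R A]
    [AddCommGroup B] [Module R B] {i j : ℕ} (a : A) {x : V.carrier}
    (hx : x ∈ V.deg i) {y : W.carrier} (hy : y ∈ W.deg j) (b : B) :
    V.midSwap W A B ((a ⊗ₜ x) ⊗ₜ (y ⊗ₜ b)) =
      (-1 : R) ^ (i * j) • ((a ⊗ₜ[R] y) ⊗ₜ[R] (x ⊗ₜ[R] b)) := by
  simp [midSwap, V.braid_tmul W hx hy, ← TensorProduct.smul_tmul']

theorem four_ext (V W : GrMod.{u, v} R) {A B P : Type*} [AddCommGroup A] [Module R A]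
    [AddCommGroup B] [Module R B] [AddCommMonoid P] [Module R P]
    {f g : (A ⊗[R] V.carrier) ⊗[R] (W.carrier ⊗[R] B) →ₗ[R] P}
    (h : ∀ a i, ∀ x ∈ V.deg i, ∀ j, ∀ y ∈ W.deg j, ∀ b,
      f ((a ⊗ₜ x) ⊗ₜ (y ⊗ₜ b)) = g ((a ⊗ₜ x) ⊗ₜ (y ⊗ₜ b))) : f = g := by
  refine TensorProduct.ext (TensorProduct.ext ?_)
  refine LinearMap.ext fun a => V.hom_ext fun i x hx => ?_
  refine TensorProduct.ext (W.hom_ext fun j y hy => LinearMap.ext fun b => ?_)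
  exact h a i x hx j y hy b

theorem midSwap_natural (V W V' W' : GrMod.{u, v} R) {A B A' B' : Type v}
    [AddCommGroup A] [Module R A] [AddCommGroup B] [Module R B]
    [AddCommGroup A'] [Module R A'] [AddCommGroup B'] [Module R B']
    (α : A →ₗ[R] A') (β : B →ₗ[R] B') (φ : V.carrier →ₗ[R] V'.carrier)
    (ψ : W.carrier →ₗ[R] W'.carrier) (hφ : ∀ n, ∀ x ∈ V.deg n, φ x ∈ V'.deg n)
    (hψ : ∀ n, ∀ x ∈ W.deg n, ψ x ∈ W'.deg n) (z) :
    TensorProduct.map (TensorProduct.map α ψ) (TensorProduct.map φ β) (V.midSwap W A B z) =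
      V'.midSwap W' A' B' (TensorProduct.map (TensorProduct.map α φ)
        (TensorProduct.map ψ β) z) := by
  have : TensorProduct.map (TensorProduct.map α ψ) (TensorProduct.map φ β) ∘ₗ V.midSwap W A B =
      V'.midSwap W' A' B' ∘ₗ (TensorProduct.map (TensorProduct.map α φ)
        (TensorProduct.map ψ β)) := by
    refine V.four_ext W fun a i x hx j y hy b => ?_
    simp [V.midSwap_tmul W a hx hy b, V'.midSwap_tmul W' _ (hφ i x hx) (hψ j y hy)]
  exact LinearMap.congr_fun this z

theorem tensor_sgn (V W : GrMod.{u, v} R) :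
    (V.tensor W).sgn = TensorProduct.map V.sgn W.sgn := by
  refine V.tensor_hom_ext W fun i j x hx y hy => ?_
  refine ((V.tensor W).sgn_apply (V.tmul_mem W rfl hx hy)).trans ?_
  rw [TensorProduct.map_tmul, V.sgn_apply hx, W.sgn_apply hy, TensorProduct.smul_tmul_smul,
    pow_add]

/-- The compatibility of the two ways of shuffling `V ⊗ V ⊗ V ⊗ W ⊗ W ⊗ W`. -/
theorem midSwap_assoc (V W : GrMod.{u, v} R)
    (u : (V.carrier ⊗[R] V.carrier) ⊗[R] V.carrier)
    (w : (W.carrier ⊗[R] W.carrier) ⊗[R] W.carrier) :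
    TensorProduct.assoc R _ _ _ ((V.midSwap W V.carrier W.carrier).rTensor _
      (V.midSwap (W.tensor W) (V.carrier ⊗[R] V.carrier) W.carrier (u ⊗ₜ w))) =
    (V.midSwap W V.carrier W.carrier).lTensor _
      ((V.tensor V).midSwap W V.carrier (W.carrier ⊗[R] W.carrier)
        (TensorProduct.assoc R _ _ _ u ⊗ₜ TensorProduct.assoc R _ _ _ w)) := by
  have : ((TensorProduct.assoc R _ _ _).toLinearMap ∘ₗ
      (V.midSwap W V.carrier W.carrier).rTensor _ ∘ₗ
      V.midSwap (W.tensor W) (V.carrier ⊗[R] V.carrier) W.carrier :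
      ((V.carrier ⊗[R] V.carrier) ⊗[R] V.carrier) ⊗[R]
        ((W.carrier ⊗[R] W.carrier) ⊗[R] W.carrier) →ₗ[R] _) =
    (V.midSwap W V.carrier W.carrier).lTensor _ ∘ₗ
      (V.tensor V).midSwap W V.carrier (W.carrier ⊗[R] W.carrier) ∘ₗ
        (TensorProduct.map (TensorProduct.assoc R _ _ _).toLinearMap
          (TensorProduct.assoc R _ _ _).toLinearMap) := by
    refine TensorProduct.ext (TensorProduct.ext ?_)
    apply V.tensor_hom_ext V
    intro i₁ i₂ x₁ hx₁ x₂ hx₂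
    apply V.hom_ext
    intro i₃ x₃ hx₃
    apply TensorProduct.ext
    apply W.tensor_hom_ext W
    intro j₁ j₂ y₁ hy₁ y₂ hy₂
    ext y₃
    have h1 : V.midSwap (W.tensor W) (V.carrier ⊗[R] V.carrier) W.carrier
        (((x₁ ⊗ₜ[R] x₂) ⊗ₜ[R] x₃) ⊗ₜ[R] ((y₁ ⊗ₜ[R] y₂) ⊗ₜ[R] y₃)) =
        (-1 : R) ^ (i₃ * (j₁ + j₂)) •
          (((x₁ ⊗ₜ[R] x₂) ⊗ₜ[R] (y₁ ⊗ₜ[R] y₂)) ⊗ₜ[R] (x₃ ⊗ₜ[R] y₃)) :=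
      V.midSwap_tmul (W.tensor W) (x₁ ⊗ₜ[R] x₂) hx₃ (W.tmul_mem W rfl hy₁ hy₂) y₃
    have h2 : (V.tensor V).midSwap W V.carrier (W.carrier ⊗[R] W.carrier)
        ((x₁ ⊗ₜ[R] (x₂ ⊗ₜ[R] x₃)) ⊗ₜ[R] (y₁ ⊗ₜ[R] (y₂ ⊗ₜ[R] y₃))) =
        (-1 : R) ^ ((i₂ + i₃) * j₁) •
          ((x₁ ⊗ₜ[R] y₁) ⊗ₜ[R] ((x₂ ⊗ₜ[R] x₃) ⊗ₜ[R] (y₂ ⊗ₜ[R] y₃))) :=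
      (V.tensor V).midSwap_tmul W x₁ (V.tmul_mem V rfl hx₂ hx₃) hy₁ (y₂ ⊗ₜ[R] y₃)
    have h3 := V.midSwap_tmul W x₁ hx₂ hy₁ y₂
    have h4 := V.midSwap_tmul W x₂ hx₃ hy₂ y₃
    have e1 : TensorProduct.assoc R _ _ _ ((V.midSwap W V.carrier W.carrier).rTensor
        (V.carrier ⊗[R] W.carrier) ((-1 : R) ^ (i₃ * (j₁ + j₂)) •
          (((x₁ ⊗ₜ[R] x₂) ⊗ₜ[R] (y₁ ⊗ₜ[R] y₂)) ⊗ₜ[R] (x₃ ⊗ₜ[R] y₃)))) =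
        ((-1 : R) ^ (i₃ * (j₁ + j₂)) * (-1 : R) ^ (i₂ * j₁)) •
          ((x₁ ⊗ₜ[R] y₁) ⊗ₜ[R] ((x₂ ⊗ₜ[R] y₂) ⊗ₜ[R] (x₃ ⊗ₜ[R] y₃))) := by
      rw [map_smul, map_smul, LinearMap.rTensor_tmul, h3, ← TensorProduct.smul_tmul', map_smul,
        TensorProduct.assoc_tmul, smul_smul]
    have e2 : (V.midSwap W V.carrier W.carrier).lTensor
        (V.carrier ⊗[R] W.carrier) ((-1 : R) ^ ((i₂ + i₃) * j₁) •
          ((x₁ ⊗ₜ[R] y₁) ⊗ₜ[R] ((x₂ ⊗ₜ[R] x₃) ⊗ₜ[R] (y₂ ⊗ₜ[R] y₃)))) =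
        ((-1 : R) ^ ((i₂ + i₃) * j₁) * (-1 : R) ^ (i₃ * j₂)) •
          ((x₁ ⊗ₜ[R] y₁) ⊗ₜ[R] ((x₂ ⊗ₜ[R] y₂) ⊗ₜ[R] (x₃ ⊗ₜ[R] y₃))) := by
      rw [map_smul, LinearMap.lTensor_tmul, h4, TensorProduct.tmul_smul, smul_smul]
    refine ((congrArg _ (congrArg _ h1)).trans e1).trans
      (Eq.trans ?_ ((congrArg _ h2).trans e2).symm)
    rw [← pow_add, ← pow_add]
    congr 2
    ring
  exact LinearMap.congr_fun this (u ⊗ₜ w)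

end GrMod

/-- The differential `d ⊗ 1 + 1 ⊗ d'` of a tensor product, with the Koszul sign:
`x ⊗ y ↦ d x ⊗ y + (-1) ^ |x| x ⊗ d' y`. -/
def tensorD {R : Type u} [CommRing R] (V W : GrMod.{u, v} R) (d : V.carrier →ₗ[R] V.carrier)
    (d' : W.carrier →ₗ[R] W.carrier) :
    V.carrier ⊗[R] W.carrier →ₗ[R] V.carrier ⊗[R] W.carrier :=
  TensorProduct.map d LinearMap.id + TensorProduct.map V.sgn d'

/-- A connected (hence canonically coaugmented) coassociative, counital chain coalgebra: a
non-negatively graded chain complex with a comultiplication and a counit that are chain maps,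
such that the counit is an isomorphism in degree `0`. The coaugmentation is the inverse of that
isomorphism, so that the image of the coaugmentation is the part of degree `0`. -/
structure ChainCoalg (R : Type u) [CommRing R] extends GrMod.{u, v} R where
  d : carrier →ₗ[R] carrier
  d_mem : ∀ n, ∀ x ∈ deg (n + 1), d x ∈ deg n
  d_zero : ∀ x ∈ deg 0, d x = 0
  d_d : ∀ x, d (d x) = 0
  comul : carrier →ₗ[R] carrier ⊗[R] carrier
  comul_mem : ∀ n, ∀ x ∈ deg n, comul x ∈ toGrMod.tensorDeg toGrMod n
  comul_d : ∀ x, comul (d x) = tensorD toGrMod toGrMod d d (comul x)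
  coassoc : ∀ x, TensorProduct.assoc R carrier carrier carrier
    (TensorProduct.map comul LinearMap.id (comul x)) =
      TensorProduct.map LinearMap.id comul (comul x)
  counit : carrier →ₗ[R] R
  counit_pos : ∀ n, ∀ x ∈ deg (n + 1), counit x = 0
  counit_d : ∀ x, counit (d x) = 0
  counit_left : ∀ x, TensorProduct.lid R carrier
    (TensorProduct.map counit LinearMap.id (comul x)) = x
  counit_right : ∀ x, TensorProduct.rid R carrier
    (TensorProduct.map LinearMap.id counit (comul x)) = x
  connected : Function.Bijective (counit.domRestrict (deg 0))

namespace ChainCoalg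

variable {R : Type u} [CommRing R]

theorem sgn_d (V : GrMod.{u, v} R) (d : V.carrier →ₗ[R] V.carrier)
    (d_mem : ∀ n, ∀ x ∈ V.deg (n + 1), d x ∈ V.deg n) (d_zero : ∀ x ∈ V.deg 0, d x = 0)
    (x : V.carrier) : V.sgn (d x) = - d (V.sgn x) := by
  have : V.sgn ∘ₗ d = - (d ∘ₗ V.sgn) := by
    refine V.hom_ext fun n x hx => ?_
    cases n with
    | zero => simp [d_zero x hx, V.sgn_apply hx]
    | succ n => simp [V.sgn_apply hx, V.sgn_apply (d_mem n x hx), pow_succ]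
  exact LinearMap.congr_fun this x

theorem sgn_mem (V : GrMod.{u, v} R) (n : ℕ) (x : V.carrier) (hx : x ∈ V.deg n) :
    V.sgn x ∈ V.deg n := by
  rw [V.sgn_apply hx]
  exact Submodule.smul_mem _ _ hx

theorem sgn_sgn (V : GrMod.{u, v} R) (x : V.carrier) : V.sgn (V.sgn x) = x := by
  have : V.sgn ∘ₗ V.sgn = LinearMap.id := by
    refine V.hom_ext fun n x hx => ?_
    simp [V.sgn_apply hx, smul_smul, ← mul_pow]
  exact LinearMap.congr_fun this x

theorem comul_sgn (C : ChainCoalg.{u, v} R) (x : C.carrier) :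
    C.comul (C.sgn x) = TensorProduct.map C.sgn C.sgn (C.comul x) := by
  have : C.comul ∘ₗ C.sgn = TensorProduct.map C.sgn C.sgn ∘ₗ C.comul := by
    refine C.hom_ext fun n x hx => ?_
    rw [LinearMap.comp_apply, LinearMap.comp_apply, C.sgn_apply hx, map_smul, ← GrMod.tensor_sgn]
    exact ((C.toGrMod.tensor C.toGrMod).sgn_apply (C.comul_mem n x hx)).symm
  exact LinearMap.congr_fun this x

theorem counit_sgn (C : ChainCoalg.{u, v} R) (x : C.carrier) :
    C.counit (C.sgn x) = C.counit x := by
  have : C.counit ∘ₗ C.sgn = C.counit := by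
    refine C.hom_ext fun n x hx => ?_
    rw [LinearMap.comp_apply, C.sgn_apply hx, map_smul]
    cases n with
    | zero => simp
    | succ n => simp [C.counit_pos n x hx]
  exact LinearMap.congr_fun this x

theorem exists_unit (C : ChainCoalg.{u, v} R) :
    ∃ g ∈ C.deg 0, C.counit g = 1 ∧ ∀ x ∈ C.deg 0, x = C.counit x • g := by
  obtain ⟨⟨g, hg⟩, hg1⟩ := C.connected.2 1
  refine ⟨g, hg, hg1, fun x hx => ?_⟩
  have hg1' : C.counit g = 1 := hg1
  have : (⟨x, hx⟩ : C.deg 0) = C.counit x • ⟨g, hg⟩ := by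
    apply C.connected.1
    simp [hg1']
  exact congrArg Subtype.val this

theorem bijective_of_unit {V : Type*} [AddCommMonoid V] [Module R V] (S : Submodule R V)
    (ε : V →ₗ[R] R) (g : V) (hg : g ∈ S) (h1 : ε g = 1) (h : ∀ x ∈ S, x = ε x • g) :
    Function.Bijective (ε.domRestrict S) := by
  constructor
  · rintro ⟨x, hx⟩ ⟨y, hy⟩ hxy
    have hxy' : ε x = ε y := hxy
    exact Subtype.ext ((h x hx).trans (by rw [hxy']; exact (h y hy).symm))
  · intro r
    exact ⟨⟨r • g, S.smul_mem r hg⟩, by simp [h1]⟩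

section tensor

variable (C D : ChainCoalg.{u, v} R)

/-- The comultiplication `(1 ⊗ τ ⊗ 1) ∘ (Δ ⊗ Δ')` of a tensor product of coalgebras, where `τ` is
the Koszul symmetry. -/
def tensorComul : C.carrier ⊗[R] D.carrier →ₗ[R]
    (C.carrier ⊗[R] D.carrier) ⊗[R] (C.carrier ⊗[R] D.carrier) :=
  C.midSwap D.toGrMod C.carrier D.carrier ∘ₗ TensorProduct.map C.comul D.comul

/-- The counit `ε ⊗ ε'` of a tensor product of coalgebras. -/
def tensorCounit : C.carrier ⊗[R] D.carrier →ₗ[R] R :=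
  LinearMap.mul' R R ∘ₗ TensorProduct.map C.counit D.counit

theorem tensorD_tmul (x : C.carrier) (y : D.carrier) :
    tensorD C.toGrMod D.toGrMod C.d D.d (x ⊗ₜ y) = C.d x ⊗ₜ y + C.sgn x ⊗ₜ D.d y := by
  simp [tensorD]

theorem tensorD_mem (n : ℕ) (z) (hz : z ∈ C.tensorDeg D.toGrMod (n + 1)) :
    tensorD C.toGrMod D.toGrMod C.d D.d z ∈ C.tensorDeg D.toGrMod n := by
  refine C.tensor_induction D.toGrMod (p := fun z => tensorD C.toGrMod D.toGrMod C.d D.d z ∈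
    C.tensorDeg D.toGrMod n) hz (fun i j hij x hx y hy => ?_) (by simp)
    (fun x y hx hy => by rw [map_add]; exact add_mem hx hy)
  rw [tensorD_tmul]
  refine add_mem ?_ ?_
  · cases i with
    | zero => simp [C.d_zero x hx]
    | succ i => exact C.tmul_mem _ (by omega) (C.d_mem i x hx) hy
  · cases j with
    | zero => simp [D.d_zero y hy]
    | succ j => exact C.tmul_mem _ (by omega) (sgn_mem _ i x hx) (D.d_mem j y hy)

theorem tensorD_zero (z) (hz : z ∈ C.tensorDeg D.toGrMod 0) :
    tensorD C.toGrMod D.toGrMod C.d D.d z = 0 := by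
  refine C.tensor_induction D.toGrMod (p := fun z => tensorD C.toGrMod D.toGrMod C.d D.d z = 0)
    hz (fun i j hij x hx y hy => ?_) (by simp) (fun x y hx hy => by rw [map_add, hx, hy, add_zero])
  obtain ⟨rfl, rfl⟩ : i = 0 ∧ j = 0 := by omega
  simp [tensorD_tmul, C.d_zero x hx, D.d_zero y hy]

theorem tensorD_tensorD (z) : tensorD C.toGrMod D.toGrMod C.d D.d
    (tensorD C.toGrMod D.toGrMod C.d D.d z) = 0 := by
  induction z using TensorProduct.induction_on with
  | zero => simp
  | add x y hx hy => simp [hx, hy]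
  | tmul x y =>
    simp [tensorD_tmul, C.d_d, D.d_d, sgn_d C.toGrMod C.d C.d_mem C.d_zero,
      TensorProduct.neg_tmul]

theorem tensorComul_mem (n : ℕ) (z) (hz : z ∈ C.tensorDeg D.toGrMod n) :
    tensorComul C D z ∈
      (C.toGrMod.tensor D.toGrMod).tensorDeg (C.toGrMod.tensor D.toGrMod) n := by
  refine C.tensor_induction D.toGrMod (p := fun z => tensorComul C D z ∈
      (C.toGrMod.tensor D.toGrMod).tensorDeg (C.toGrMod.tensor D.toGrMod) n)
    hz (fun i j hij x hx y hy => ?_) (by simp)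
    (fun x y hx hy => by rw [map_add]; exact add_mem hx hy)
  rw [tensorComul, LinearMap.comp_apply, TensorProduct.map_tmul]
  refine C.tensor_induction C.toGrMod (p := fun u => C.midSwap D.toGrMod C.carrier D.carrier
      (u ⊗ₜ D.comul y) ∈
      (C.toGrMod.tensor D.toGrMod).tensorDeg (C.toGrMod.tensor D.toGrMod) n)
    (C.comul_mem i x hx) (fun i1 i2 hi x1 hx1 x2 hx2 => ?_) (by simp)
    (fun x y hx hy => by rw [TensorProduct.add_tmul, map_add]; exact add_mem hx hy)
  refine D.tensor_induction D.toGrMod (p := fun w => C.midSwap D.toGrMod C.carrier D.carrier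
      ((x1 ⊗ₜ x2) ⊗ₜ w) ∈
      (C.toGrMod.tensor D.toGrMod).tensorDeg (C.toGrMod.tensor D.toGrMod) n)
    (D.comul_mem j y hy) (fun j1 j2 hj y1 hy1 y2 hy2 => ?_) (by simp)
    (fun x y hx hy => by rw [TensorProduct.tmul_add, map_add]; exact add_mem hx hy)
  rw [C.midSwap_tmul D.toGrMod x1 hx2 hy1 y2]
  refine Submodule.smul_mem _ _ ?_
  exact (C.toGrMod.tensor D.toGrMod).tmul_mem (C.toGrMod.tensor D.toGrMod) (by omega)
    (C.tmul_mem D.toGrMod rfl hx1 hy1) (C.tmul_mem D.toGrMod rfl hx2 hy2)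

theorem tensor_coassoc (z) : TensorProduct.assoc R _ _ _
    (TensorProduct.map (tensorComul C D) LinearMap.id (tensorComul C D z)) =
      TensorProduct.map LinearMap.id (tensorComul C D) (tensorComul C D z) := by
  induction z using TensorProduct.induction_on with
  | zero => simp
  | add x y hx hy => simp only [map_add, hx, hy]
  | tmul x y =>
    have hl := C.midSwap_natural D.toGrMod C.toGrMod (D.toGrMod.tensor D.toGrMod) C.comul
      (LinearMap.id : D.carrier →ₗ[R] D.carrier) LinearMap.id D.comul (fun n x hx => hx)
      D.comul_mem (C.comul x ⊗ₜ D.comul y)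
    have hr := C.midSwap_natural D.toGrMod (C.toGrMod.tensor C.toGrMod) D.toGrMod
      (LinearMap.id : C.carrier →ₗ[R] C.carrier) D.comul C.comul LinearMap.id
      C.comul_mem (fun n x hx => hx) (C.comul x ⊗ₜ D.comul y)
    have hm := C.midSwap_assoc D.toGrMod
      (TensorProduct.map C.comul LinearMap.id (C.comul x))
      (TensorProduct.map D.comul LinearMap.id (D.comul y))
    rw [C.coassoc, D.coassoc] at hm
    have h1 : TensorProduct.map (tensorComul C D) LinearMap.id (tensorComul C D (x ⊗ₜ y)) =
        (C.midSwap D.toGrMod C.carrier D.carrier).rTensor _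
          (TensorProduct.map (TensorProduct.map C.comul D.comul)
            (TensorProduct.map LinearMap.id LinearMap.id)
            (C.midSwap D.toGrMod C.carrier D.carrier (C.comul x ⊗ₜ D.comul y))) := by
      rw [LinearMap.rTensor, ← LinearMap.comp_apply (TensorProduct.map _ _) (TensorProduct.map _ _),
        ← TensorProduct.map_comp, TensorProduct.map_id]
      rfl
    have h2 : TensorProduct.map LinearMap.id (tensorComul C D) (tensorComul C D (x ⊗ₜ y)) =
        (C.midSwap D.toGrMod C.carrier D.carrier).lTensor _
          (TensorProduct.map (TensorProduct.map LinearMap.id LinearMap.id)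
            (TensorProduct.map C.comul D.comul)
            (C.midSwap D.toGrMod C.carrier D.carrier (C.comul x ⊗ₜ D.comul y))) := by
      rw [LinearMap.lTensor, ← LinearMap.comp_apply (TensorProduct.map _ _) (TensorProduct.map _ _),
        ← TensorProduct.map_comp, TensorProduct.map_id]
      rfl
    rw [h1, h2]
    exact ((congrArg _ (congrArg _ hl)).trans hm).trans (congrArg _ hr).symm

theorem tensor_comul_d (z) : tensorComul C D (tensorD C.toGrMod D.toGrMod C.d D.d z) =
    tensorD (C.toGrMod.tensor D.toGrMod) (C.toGrMod.tensor D.toGrMod)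
      (tensorD C.toGrMod D.toGrMod C.d D.d) (tensorD C.toGrMod D.toGrMod C.d D.d)
      (tensorComul C D z) := by
  set T := tensorD C.toGrMod D.toGrMod C.d D.d with hT
  set S := C.midSwap D.toGrMod C.carrier D.carrier with hS
  have key : S ∘ₗ (TensorProduct.map (tensorD C.toGrMod C.toGrMod C.d C.d) LinearMap.id +
      TensorProduct.map (TensorProduct.map C.sgn C.sgn)
        (tensorD D.toGrMod D.toGrMod D.d D.d)) =
      (TensorProduct.map T LinearMap.id +
        TensorProduct.map (TensorProduct.map C.sgn D.sgn) T) ∘ₗ S := by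
    refine C.four_ext D.toGrMod fun a i x hx j y hy b => ?_
    have e0 : ∀ a b, S ((a ⊗ₜ x) ⊗ₜ (y ⊗ₜ b)) = (-1 : R) ^ (i * j) •
        ((a ⊗ₜ y) ⊗ₜ (x ⊗ₜ b)) := fun a b => C.midSwap_tmul D.toGrMod a hx hy b
    have sq : ∀ k : ℕ, ((-1 : R) ^ k) * (-1 : R) ^ k = 1 := fun k => by
      rw [← mul_pow]; simp
    have e1' : S ((C.sgn a ⊗ₜ C.d x) ⊗ₜ (y ⊗ₜ b)) = (-1 : R) ^ (i * j) •
        (-1 : R) ^ j • ((C.sgn a ⊗ₜ y) ⊗ₜ (C.d x ⊗ₜ b)) := by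
      cases i with
      | zero => simp [C.d_zero x hx]
      | succ i =>
        rw [hS, C.midSwap_tmul D.toGrMod _ (C.d_mem i x hx) hy b, smul_smul, ← pow_add]
        congr 1
        rw [show (i + 1) * j + j = i * j + (j + j) by ring, pow_add, ← two_mul, pow_mul]
        simp
    have e2' : S ((C.sgn a ⊗ₜ x) ⊗ₜ (D.d y ⊗ₜ b)) = (-1 : R) ^ (i * j) •
        (-1 : R) ^ i • ((C.sgn a ⊗ₜ D.d y) ⊗ₜ (x ⊗ₜ b)) := by
      cases j with
      | zero => simp [D.d_zero y hy]
      | succ j =>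
        rw [hS, C.midSwap_tmul D.toGrMod _ hx (D.d_mem j y hy) b, smul_smul, ← pow_add]
        congr 1
        rw [show i * (j + 1) + i = i * j + (i + i) by ring, pow_add, ← two_mul, pow_mul]
        simp
    simp only [LinearMap.comp_apply, LinearMap.add_apply, TensorProduct.map_tmul,
      LinearMap.id_apply, tensorD_tmul, TensorProduct.add_tmul, TensorProduct.tmul_add, map_add,
      C.sgn_apply hx, D.sgn_apply hy, e0, hT, map_smul, e1', e2',
      TensorProduct.tmul_smul, ← TensorProduct.smul_tmul', smul_smul]
    simp only [smul_add, smul_smul]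
    have s1 : (-1 : R) ^ i * ((-1 : R) ^ (i * j) * (-1 : R) ^ i) = (-1 : R) ^ (i * j) := by
      rw [mul_left_comm, sq, mul_one]
    rw [s1]
    simp only [mul_comm, mul_assoc]
    abel
  have h := LinearMap.congr_fun key (TensorProduct.map C.comul D.comul z)
  rw [tensorD, GrMod.tensor_sgn]
  refine Eq.trans ?_ h
  rw [tensorComul, LinearMap.comp_apply, LinearMap.comp_apply]
  have h' : TensorProduct.map C.comul D.comul ∘ₗ T =
      (TensorProduct.map (tensorD C.toGrMod C.toGrMod C.d C.d) LinearMap.id +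
        TensorProduct.map (TensorProduct.map C.sgn C.sgn)
          (tensorD D.toGrMod D.toGrMod D.d D.d)) ∘ₗ TensorProduct.map C.comul D.comul := by
    refine TensorProduct.ext' fun x y => ?_
    simp [hT, tensorD_tmul, C.comul_d, D.comul_d, comul_sgn]
  exact congrArg S (LinearMap.congr_fun h' z)

theorem tensor_counit_left (z) : TensorProduct.lid R _
    (TensorProduct.map (tensorCounit C D) LinearMap.id (tensorComul C D z)) = z := by
  have key : (TensorProduct.lid R _).toLinearMap ∘ₗ
      TensorProduct.map (tensorCounit C D) LinearMap.id ∘ₗ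
        C.midSwap D.toGrMod C.carrier D.carrier =
      TensorProduct.map
        ((TensorProduct.lid R _).toLinearMap ∘ₗ TensorProduct.map C.counit LinearMap.id)
        ((TensorProduct.lid R _).toLinearMap ∘ₗ TensorProduct.map D.counit LinearMap.id) := by
    refine C.four_ext D.toGrMod fun a i x hx j y hy b => ?_
    rw [LinearMap.comp_apply, LinearMap.comp_apply, C.midSwap_tmul D.toGrMod a hx hy b]
    cases j with
    | zero => simp [tensorCounit, ← TensorProduct.smul_tmul', smul_smul, mul_comm]
    | succ j => simp [tensorCounit, D.counit_pos j y hy]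
  have h := LinearMap.congr_fun key (TensorProduct.map C.comul D.comul z)
  refine h.trans ?_
  have h' : TensorProduct.map
        ((TensorProduct.lid R _).toLinearMap ∘ₗ TensorProduct.map C.counit LinearMap.id)
        ((TensorProduct.lid R _).toLinearMap ∘ₗ TensorProduct.map D.counit LinearMap.id) ∘ₗ
      TensorProduct.map C.comul D.comul = LinearMap.id := by
    refine TensorProduct.ext' fun x y => ?_
    simp [C.counit_left, D.counit_left]
  exact LinearMap.congr_fun h' z

theorem tensor_counit_right (z) : TensorProduct.rid R _
    (TensorProduct.map LinearMap.id (tensorCounit C D) (tensorComul C D z)) = z := by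
  have key : (TensorProduct.rid R _).toLinearMap ∘ₗ
      TensorProduct.map LinearMap.id (tensorCounit C D) ∘ₗ
        C.midSwap D.toGrMod C.carrier D.carrier =
      TensorProduct.map
        ((TensorProduct.rid R _).toLinearMap ∘ₗ TensorProduct.map LinearMap.id C.counit)
        ((TensorProduct.rid R _).toLinearMap ∘ₗ TensorProduct.map LinearMap.id D.counit) := by
    refine C.four_ext D.toGrMod fun a i x hx j y hy b => ?_
    rw [LinearMap.comp_apply, LinearMap.comp_apply, C.midSwap_tmul D.toGrMod a hx hy b]
    cases i with
    | zero => simp [tensorCounit, ← TensorProduct.smul_tmul', smul_smul, mul_comm]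
    | succ i => simp [tensorCounit, C.counit_pos i x hx]
  have h := LinearMap.congr_fun key (TensorProduct.map C.comul D.comul z)
  refine h.trans ?_
  have h' : TensorProduct.map
        ((TensorProduct.rid R _).toLinearMap ∘ₗ TensorProduct.map LinearMap.id C.counit)
        ((TensorProduct.rid R _).toLinearMap ∘ₗ TensorProduct.map LinearMap.id D.counit) ∘ₗ
      TensorProduct.map C.comul D.comul = LinearMap.id := by
    refine TensorProduct.ext' fun x y => ?_
    simp [C.counit_right, D.counit_right]
  exact LinearMap.congr_fun h' z

theorem tensor_connected :
    Function.Bijective ((tensorCounit C D).domRestrict (C.tensorDeg D.toGrMod 0)) := by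
  obtain ⟨g, hg, hg1, hgx⟩ := C.exists_unit
  obtain ⟨k, hk, hk1, hkx⟩ := D.exists_unit
  have hc : ∀ (x : C.carrier) (y : D.carrier),
      tensorCounit C D (x ⊗ₜ y) = C.counit x * D.counit y := fun x y => by simp [tensorCounit]
  have hz : ∀ z ∈ C.tensorDeg D.toGrMod 0, z = tensorCounit C D z • (g ⊗ₜ[R] k) := by
    intro z hz
    have hbase : ∀ i j, i + j = 0 → ∀ x ∈ C.deg i, ∀ y ∈ D.deg j,
        x ⊗ₜ[R] y = tensorCounit C D (x ⊗ₜ[R] y) • (g ⊗ₜ[R] k) := by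
      intro i j hij x hx y hy
      obtain ⟨rfl, rfl⟩ : i = 0 ∧ j = 0 := by omega
      rw [hc, ← TensorProduct.smul_tmul_smul, ← hgx x hx, ← hkx y hy]
    have hadd : ∀ x y : C.carrier ⊗[R] D.carrier, x = tensorCounit C D x • (g ⊗ₜ[R] k) →
        y = tensorCounit C D y • (g ⊗ₜ[R] k) →
        x + y = tensorCounit C D (x + y) • (g ⊗ₜ[R] k) := by
      intro x y hx hy
      rw [map_add, add_smul, ← hx, ← hy]
    exact C.tensor_induction D.toGrMod (p := fun z => z = tensorCounit C D z • (g ⊗ₜ[R] k)) hz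
      hbase (by simp) hadd
  have hgk : g ⊗ₜ[R] k ∈ C.tensorDeg D.toGrMod 0 := C.tmul_mem D.toGrMod (add_zero 0) hg hk
  have h1 : tensorCounit C D (g ⊗ₜ[R] k) = 1 := by rw [hc, hg1, hk1, one_mul]
  have := bijective_of_unit (C.tensorDeg D.toGrMod 0) (tensorCounit C D) (g ⊗ₜ[R] k) hgk h1 hz
  exact this

/-- The tensor product of connected chain coalgebras. -/
def tensor : ChainCoalg.{u, v} R where
  toGrMod := C.toGrMod.tensor D.toGrMod
  d := tensorD C.toGrMod D.toGrMod C.d D.d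
  d_mem := tensorD_mem C D
  d_zero := tensorD_zero C D
  d_d := tensorD_tensorD C D
  comul := tensorComul C D
  comul_mem := tensorComul_mem C D
  comul_d := tensor_comul_d C D
  coassoc := tensor_coassoc C D
  counit := tensorCounit C D
  counit_pos n z hz := by
    refine C.tensor_induction D.toGrMod (p := fun z => tensorCounit C D z = 0) hz
      (fun i j hij x hx y hy => ?_) (by simp) (fun x y hx hy => by rw [map_add, hx, hy, add_zero])
    cases i with
    | succ i => simp [tensorCounit, C.counit_pos i x hx]
    | zero =>
      obtain rfl : j = n + 1 := by omega
      simp [tensorCounit, D.counit_pos n y hy]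
  counit_d z := by
    induction z using TensorProduct.induction_on with
    | zero => simp
    | add x y hx hy => simp [hx, hy]
    | tmul x y => simp [tensorD_tmul, tensorCounit, C.counit_d, D.counit_d]
  counit_left := tensor_counit_left C D
  counit_right := tensor_counit_right C D
  connected := tensor_connected C D

end tensor

end ChainCoalg

section Normalized

variable {R : Type u} [CommRing R]

/-- The action of a simplicial operator on a simplicial module. -/
def act (X : SimplicialObject (ModuleCat.{v} R)) {m n : ℕ} (θ : ⦋m⦌ ⟶ ⦋n⦌) :
    X _⦋n⦌ →ₗ[R] X _⦋m⦌ :=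
  (X.map θ.op).hom

theorem act_act (X : SimplicialObject (ModuleCat.{v} R)) {l m n : ℕ} (θ : ⦋l⦌ ⟶ ⦋m⦌)
    (ψ : ⦋m⦌ ⟶ ⦋n⦌) (x : X _⦋n⦌) : act X θ (act X ψ x) = act X (θ ≫ ψ) x := by
  simp [act]

theorem act_id (X : SimplicialObject (ModuleCat.{v} R)) {n : ℕ} (x : X _⦋n⦌) :
    act X (𝟙 ⦋n⦌) x = x := by
  simp [act]

theorem act_naturality {X Y : SimplicialObject (ModuleCat.{v} R)} (φ : X ⟶ Y) {m n : ℕ}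
    (θ : ⦋m⦌ ⟶ ⦋n⦌) (x : X _⦋n⦌) :
    (φ.app (Opposite.op ⦋m⦌)).hom (act X θ x) = act Y θ ((φ.app (Opposite.op ⦋n⦌)).hom x) :=
  congrArg (fun f => f.hom x) (φ.naturality θ.op)

/-- The submodule of degenerate elements of `X_n`: the one generated by the images of the
degeneracies `s_i : X_{n-1} → X_n`. -/
def degen (X : SimplicialObject (ModuleCat.{v} R)) (n : ℕ) : Submodule R (X _⦋n⦌) :=
  match n with
  | 0 => ⊥
  | n + 1 => ⨆ i : Fin (n + 1), LinearMap.range (act X (SimplexCategory.σ i))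

/-- The graded module underlying the normalized chain complex of `X`, which is
`X_n / degenerates` in degree `n`. -/
def normGr (X : SimplicialObject (ModuleCat.{v} R)) : GrMod.{u, v} R where
  carrier := ⨁ n : ℕ, (X _⦋n⦌ ⧸ degen X n)
  deg n := LinearMap.range (DirectSum.lof R ℕ (fun n => X _⦋n⦌ ⧸ degen X n) n)
  isInternal := by
    refine GrMod.isInternal_of_proj _ ?_ (fun m =>
      DirectSum.lof R ℕ (fun n => X _⦋n⦌ ⧸ degen X n) m ∘ₗ
        DirectSum.component R ℕ (fun n => X _⦋n⦌ ⧸ degen X n) m) ?_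
    · rw [eq_top_iff]
      rintro z -
      induction z using DirectSum.induction_on with
      | zero => exact zero_mem _
      | of i x => exact Submodule.mem_iSup_of_mem i ⟨x, rfl⟩
      | add x y hx hy => exact add_mem hx hy
    · rintro m n _ ⟨x, rfl⟩
      rw [LinearMap.comp_apply]
      by_cases h : n = m
      · subst h
        rw [if_pos rfl, DirectSum.component.lof_self]
      · rw [if_neg h, DirectSum.component.of, dif_neg h, map_zero]

/-- The class in the normalized chain complex of an element of `X_n`. -/
def cls (X : SimplicialObject (ModuleCat.{v} R)) (n : ℕ) : X _⦋n⦌ →ₗ[R] (normGr X).carrier :=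
  DirectSum.lof R ℕ (fun n => X _⦋n⦌ ⧸ degen X n) n ∘ₗ (degen X n).mkQ

theorem cls_mem (X : SimplicialObject (ModuleCat.{v} R)) (n : ℕ) (x : X _⦋n⦌) :
    cls X n x ∈ (normGr X).deg n :=
  ⟨(degen X n).mkQ x, rfl⟩

theorem exists_cls (X : SimplicialObject (ModuleCat.{v} R)) {n : ℕ} {z : (normGr X).carrier}
    (hz : z ∈ (normGr X).deg n) : ∃ x, z = cls X n x := by
  obtain ⟨y, rfl⟩ := hz
  obtain ⟨x, rfl⟩ := (degen X n).mkQ_surjective y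
  exact ⟨x, rfl⟩

theorem cls_degen (X : SimplicialObject (ModuleCat.{v} R)) {n : ℕ} {x : X _⦋n⦌}
    (hx : x ∈ degen X n) : cls X n x = 0 := by
  have : (degen X n).mkQ x = 0 := by simpa using hx
  exact (congrArg (DirectSum.lof R ℕ (fun n => X _⦋n⦌ ⧸ degen X n) n) this).trans (map_zero _)

/-- A family of linear maps on the `X_n` which vanish on degenerate elements defines a linear map
on the normalized chain complex. -/
def normLift (X : SimplicialObject (ModuleCat.{v} R)) {P : Type*} [AddCommGroup P] [Module R P]
    (φ : ∀ n : ℕ, X _⦋n⦌ →ₗ[R] P) (h : ∀ n, degen X n ≤ LinearMap.ker (φ n)) :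
    (normGr X).carrier →ₗ[R] P :=
  DirectSum.toModule R ℕ P fun n => (degen X n).liftQ (φ n) (h n)

theorem normLift_cls (X : SimplicialObject (ModuleCat.{v} R)) {P : Type*} [AddCommGroup P]
    [Module R P] (φ : ∀ n : ℕ, X _⦋n⦌ →ₗ[R] P) (h : ∀ n, degen X n ≤ LinearMap.ker (φ n))
    (n : ℕ) (x : X _⦋n⦌) : normLift X φ h (cls X n x) = φ n x := by
  exact (DirectSum.toModule_lof R (φ := fun n => (degen X n).liftQ (φ n) (h n)) n
    ((degen X n).mkQ x)).trans ((degen X n).liftQ_apply (φ n) x)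

theorem norm_ext (X : SimplicialObject (ModuleCat.{v} R)) {P : Type*} [AddCommMonoid P]
    [Module R P] {f g : (normGr X).carrier →ₗ[R] P}
    (h : ∀ n x, f (cls X n x) = g (cls X n x)) : f = g := by
  refine (normGr X).hom_ext fun n z hz => ?_
  obtain ⟨x, rfl⟩ := exists_cls X hz
  exact h n x

/-- An operator that identifies two consecutive vertices takes degenerate values. -/
theorem act_mem_degen (X : SimplicialObject (ModuleCat.{v} R)) {m n : ℕ} (θ : ⦋m + 1⦌ ⟶ ⦋n⦌)
    (i : Fin (m + 1)) (h : θ.toOrderHom i.castSucc = θ.toOrderHom i.succ) (x : X _⦋n⦌) :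
    act X θ x ∈ degen X (m + 1) := by
  obtain ⟨θ', rfl⟩ := SimplexCategory.eq_σ_comp_of_not_injective' θ i h
  obtain ⟨k, rfl⟩ : ∃ k, n = k := ⟨n, rfl⟩
  rw [← act_act]
  exact Submodule.mem_iSup_of_mem i ⟨_, rfl⟩

/-- The operator `[b] → [n]`, `i ↦ a + i`, which is the inclusion of the interval
`{a, …, a + b}`. (It is only used for `a + b ≤ n`, and truncated at `n` otherwise.) -/
def seg (n a b : ℕ) : ⦋b⦌ ⟶ ⦋n⦌ :=
  SimplexCategory.Hom.mk
    { toFun := fun i => ⟨min (a + i) n, by have := min_le_right (a + (i : ℕ)) n; simp⟩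
      monotone' := fun i j hij => by
        have : (i : ℕ) ≤ j := hij
        rw [Fin.le_def]
        simp only
        omega }

theorem seg_val (n a b : ℕ) (i : Fin (b + 1)) :
    (((seg n a b).toOrderHom i : Fin (n + 1)) : ℕ) = min (a + i) n := rfl

theorem hom_ext_val {m n : ℕ} {θ ψ : ⦋m⦌ ⟶ ⦋n⦌}
    (h : ∀ i : Fin (m + 1), ((θ.toOrderHom i : Fin (n + 1)) : ℕ) = (ψ.toOrderHom i : Fin (n + 1))) :
    θ = ψ := by
  apply SimplexCategory.Hom.ext
  ext i
  exact h i

theorem comp_val {l m n : ℕ} (θ : ⦋l⦌ ⟶ ⦋m⦌) (ψ : ⦋m⦌ ⟶ ⦋n⦌) (i : Fin (l + 1)) :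
    (θ ≫ ψ).toOrderHom i = ψ.toOrderHom (θ.toOrderHom i) := rfl

theorem σ_val {n : ℕ} (i : Fin (n + 1)) (j : Fin (n + 2)) :
    (((SimplexCategory.σ i).toOrderHom j : Fin (n + 1)) : ℕ) =
      if (j : ℕ) ≤ i then (j : ℕ) else (j : ℕ) - 1 := by
  change ((i.predAbove j : Fin (n + 1)) : ℕ) = _
  by_cases h : i.castSucc < j
  · have h' : (i : ℕ) < j := h
    rw [Fin.predAbove_of_castSucc_lt _ _ h, Fin.val_pred, if_neg (by omega)]
  · have h' : (j : ℕ) ≤ i := not_lt.mp h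
    rw [Fin.predAbove_of_le_castSucc _ _ (not_lt.mp h), Fin.coe_castPred, if_pos h']

theorem δ_val {n : ℕ} (i : Fin (n + 2)) (j : Fin (n + 1)) :
    (((SimplexCategory.δ i).toOrderHom j : Fin (n + 2)) : ℕ) =
      if (j : ℕ) < i then (j : ℕ) else (j : ℕ) + 1 := by
  change ((i.succAbove j : Fin (n + 2)) : ℕ) = _
  by_cases h : j.castSucc < i
  · have h' : (j : ℕ) < i := h
    rw [Fin.succAbove_of_castSucc_lt _ _ h, Fin.val_castSucc, if_pos h']
  · have h' : ¬ (j : ℕ) < i := h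
    rw [Fin.succAbove_of_le_castSucc _ _ (not_lt.mp h), Fin.val_succ, if_neg h']

theorem seg_comp {m n a b c : ℕ} (h1 : c + b ≤ m) (h2 : a + m ≤ n) :
    seg m c b ≫ seg n a m = seg n (a + c) b := by
  apply hom_ext_val
  intro i
  have := i.2
  rw [comp_val, seg_val, seg_val, seg_val]
  omega

theorem seg_id (n : ℕ) : seg n 0 n = 𝟙 ⦋n⦌ := by
  apply hom_ext_val
  intro i
  have := i.2
  rw [seg_val]
  change _ = (i : ℕ)
  omega

/-- The levelwise tensor product of simplicial modules. -/
def boxMod (X Y : SimplicialObject (ModuleCat.{v} R)) : SimplicialObject (ModuleCat.{v} R) where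
  obj k := ModuleCat.of R (X.obj k ⊗[R] Y.obj k)
  map f := ModuleCat.ofHom (TensorProduct.map (X.map f).hom (Y.map f).hom)
  map_id k := by
    ext : 1
    simp
  map_comp f g := by
    ext : 1
    simp [TensorProduct.map_comp]

/-- The alternating sum of the faces. -/
def altSum (X : SimplicialObject (ModuleCat.{v} R)) (n : ℕ) : X _⦋n + 1⦌ →ₗ[R] X _⦋n⦌ :=
  ∑ i : Fin (n + 2), (-1 : R) ^ (i : ℕ) • act X (SimplexCategory.δ i)

theorem altSum_altSum (X : SimplicialObject (ModuleCat.{v} R)) (n : ℕ) (x : X _⦋n + 2⦌) :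
    altSum X n (altSum X (n + 1) x) = 0 := by
  have h := AlgebraicTopology.AlternatingFaceMapComplex.d_squared X n
  have h' : ∀ n, (AlgebraicTopology.AlternatingFaceMapComplex.objD X n).hom = altSum X n := by
    intro n
    ext x
    simp only [AlgebraicTopology.AlternatingFaceMapComplex.objD, altSum, act,
      ModuleCat.hom_sum, LinearMap.sum_apply, LinearMap.smul_apply]
    refine Finset.sum_congr rfl fun i _ => ?_
    rcases neg_one_pow_eq_or ℤ (i : ℕ) with hi | hi <;>
    rcases Nat.even_or_odd (i : ℕ) with he | he <;>
    simp [he.neg_one_pow, SimplicialObject.δ]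
  rw [← h', ← h', ← LinearMap.comp_apply, ← ModuleCat.hom_comp, h]
  rfl

theorem altSum_degen (X : SimplicialObject (ModuleCat.{v} R)) (n : ℕ) (x : X _⦋n + 1⦌)
    (hx : x ∈ degen X (n + 1)) : cls X n (altSum X n x) = 0 := by
  suffices h : degen X (n + 1) ≤ LinearMap.ker (cls X n ∘ₗ altSum X n) from h hx
  refine iSup_le fun i => ?_
  rintro _ ⟨y, rfl⟩
  rw [LinearMap.mem_ker, LinearMap.comp_apply, altSum, LinearMap.sum_apply, map_sum]
  have hne : i.castSucc ≠ i.succ := by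
    intro h
    have := congrArg Fin.val h
    simp at this
  rw [← Finset.sum_subset (Finset.subset_univ {i.castSucc, i.succ})]
  · rw [Finset.sum_pair hne]
    simp only [LinearMap.smul_apply, act_act, SimplexCategory.δ_comp_σ_self,
      SimplexCategory.δ_comp_σ_succ, map_smul, act_id, Fin.val_castSucc, Fin.val_succ, pow_succ]
    simp
  · intro j _ hj
    rw [LinearMap.smul_apply, map_smul, act_act]
    convert smul_zero _
    apply cls_degen
    simp only [Finset.mem_insert, Finset.mem_singleton, not_or, Fin.ext_iff, Fin.val_castSucc,
      Fin.val_succ] at hj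
    have hi := i.2
    have hj2 := j.2
    obtain ⟨m, rfl⟩ : ∃ m, n = m + 1 := by
      cases n with
      | zero => omega
      | succ m => exact ⟨m, rfl⟩
    by_cases hlt : (j : ℕ) < i
    · refine act_mem_degen X _ ⟨i - 1, by omega⟩ ?_ y
      apply Fin.ext
      rw [comp_val, comp_val, σ_val, σ_val, δ_val, δ_val]
      simp only [Fin.val_castSucc, Fin.val_succ]
      split_ifs <;> omega
    · refine act_mem_degen X _ ⟨i, by omega⟩ ?_ y
      apply Fin.ext
      rw [comp_val, comp_val, σ_val, σ_val, δ_val, δ_val]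
      simp only [Fin.val_castSucc, Fin.val_succ]
      split_ifs <;> omega

/-- The differential of the normalized chain complex: the alternating sum of the faces. -/
def normD (X : SimplicialObject (ModuleCat.{v} R)) :
    (normGr X).carrier →ₗ[R] (normGr X).carrier :=
  normLift X
    (fun n => match n with
      | 0 => 0
      | n + 1 => cls X n ∘ₗ altSum X n)
    (fun n => match n with
      | 0 => by simp
      | n + 1 => fun x hx => altSum_degen X n x hx)

theorem normD_zero (X : SimplicialObject (ModuleCat.{v} R)) (x : X _⦋0⦌) :
    normD X (cls X 0 x) = 0 := normLift_cls X _ _ 0 x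

theorem normD_succ (X : SimplicialObject (ModuleCat.{v} R)) (n : ℕ) (x : X _⦋n + 1⦌) :
    normD X (cls X (n + 1) x) = cls X n (altSum X n x) := normLift_cls X _ _ (n + 1) x

/-- The Alexander–Whitney formula in level `n`:
`x ⊗ y ↦ ∑_{p + q = n} x_{0…p} ⊗ y_{p…n}`. -/
def awLevel (X Y : SimplicialObject (ModuleCat.{v} R)) (n : ℕ) :
    X _⦋n⦌ ⊗[R] Y _⦋n⦌ →ₗ[R] (normGr X).carrier ⊗[R] (normGr Y).carrier :=
  ∑ p ∈ Finset.HasAntidiagonal.antidiagonal n,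
    TensorProduct.map (cls X p.1 ∘ₗ act X (seg n 0 p.1)) (cls Y p.2 ∘ₗ act Y (seg n p.1 p.2))

theorem awLevel_degen (X Y : SimplicialObject (ModuleCat.{v} R)) (n : ℕ) :
    degen (boxMod X Y) n ≤ LinearMap.ker (awLevel X Y n) := by
  cases n with
  | zero => exact bot_le
  | succ n =>
    refine iSup_le fun i => ?_
    rintro _ ⟨z, rfl⟩
    suffices h : awLevel X Y (n + 1) ∘ₗ TensorProduct.map (act X (SimplexCategory.σ i))
        (act Y (SimplexCategory.σ i)) = 0 from LinearMap.congr_fun h z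
    refine TensorProduct.ext' fun x y => ?_
    rw [LinearMap.comp_apply, TensorProduct.map_tmul, awLevel, LinearMap.sum_apply]
    refine Finset.sum_eq_zero ?_
    rintro ⟨p, q⟩ hpq
    rw [Finset.HasAntidiagonal.mem_antidiagonal] at hpq
    simp only at hpq
    rw [TensorProduct.map_tmul, LinearMap.comp_apply, LinearMap.comp_apply, act_act, act_act]
    have hi := i.2
    simp only
    by_cases hp : (i : ℕ) < p
    · obtain ⟨p, rfl⟩ : ∃ p', p = p' + 1 := ⟨p - 1, by omega⟩
      rw [cls_degen X, TensorProduct.zero_tmul]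
      · refine act_mem_degen X _ ⟨i, by omega⟩ ?_ x
        apply Fin.ext
        rw [comp_val, comp_val, σ_val, σ_val, seg_val, seg_val]
        simp only [Fin.val_castSucc, Fin.val_succ]
        split_ifs <;> omega
    · obtain ⟨q, rfl⟩ : ∃ q', q = q' + 1 := ⟨q - 1, by omega⟩
      rw [cls_degen Y, TensorProduct.tmul_zero]
      · refine act_mem_degen Y _ ⟨i - p, by omega⟩ ?_ y
        apply Fin.ext
        rw [comp_val, comp_val, σ_val, σ_val, seg_val, seg_val]
        simp only [Fin.val_castSucc, Fin.val_succ]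
        split_ifs <;> omega

/-- The Alexander–Whitney map `A_N(X ⊠ Y) → A_N(X) ⊗ A_N(Y)`. -/
def aw (X Y : SimplicialObject (ModuleCat.{v} R)) :
    (normGr (boxMod X Y)).carrier →ₗ[R] (normGr X).carrier ⊗[R] (normGr Y).carrier :=
  normLift (boxMod X Y) (awLevel X Y) (awLevel_degen X Y)

theorem aw_cls (X Y : SimplicialObject (ModuleCat.{v} R)) (n : ℕ) (z : X _⦋n⦌ ⊗[R] Y _⦋n⦌) :
    aw X Y (cls (boxMod X Y) n z) = awLevel X Y n z :=
  normLift_cls (boxMod X Y) _ _ n z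

/-- The map of normalized chain complexes induced by a morphism of simplicial modules. -/
def normMap {X Y : SimplicialObject (ModuleCat.{v} R)} (φ : X ⟶ Y) :
    (normGr X).carrier →ₗ[R] (normGr Y).carrier :=
  normLift X (fun n => cls Y n ∘ₗ (φ.app (Opposite.op ⦋n⦌)).hom) fun n => by
    cases n with
    | zero => simp [degen]
    | succ n =>
      refine iSup_le fun i => ?_
      rintro _ ⟨z, rfl⟩
      rw [LinearMap.mem_ker, LinearMap.comp_apply, act_naturality]
      exact cls_degen Y (Submodule.mem_iSup_of_mem i ⟨_, rfl⟩)

theorem normMap_cls {X Y : SimplicialObject (ModuleCat.{v} R)} (φ : X ⟶ Y) (n : ℕ)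
    (x : X _⦋n⦌) : normMap φ (cls X n x) = cls Y n ((φ.app (Opposite.op ⦋n⦌)).hom x) :=
  normLift_cls X _ _ n x

theorem altSum_naturality {X Y : SimplicialObject (ModuleCat.{v} R)} (φ : X ⟶ Y) (n : ℕ)
    (x : X _⦋n + 1⦌) : (φ.app (Opposite.op ⦋n⦌)).hom (altSum X n x) =
      altSum Y n ((φ.app (Opposite.op ⦋n + 1⦌)).hom x) := by
  simp [altSum, LinearMap.sum_apply, act_naturality]

theorem normMap_d {X Y : SimplicialObject (ModuleCat.{v} R)} (φ : X ⟶ Y)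
    (z : (normGr X).carrier) : normMap φ (normD X z) = normD Y (normMap φ z) := by
  suffices h : normMap φ ∘ₗ normD X = normD Y ∘ₗ normMap φ from LinearMap.congr_fun h z
  refine norm_ext X fun n x => ?_
  rw [LinearMap.comp_apply, LinearMap.comp_apply, normMap_cls]
  cases n with
  | zero => rw [normD_zero, normD_zero, map_zero]
  | succ n => rw [normD_succ, normD_succ, normMap_cls, altSum_naturality]

theorem normMap_mem {X Y : SimplicialObject (ModuleCat.{v} R)} (φ : X ⟶ Y) (n : ℕ)
    (z : (normGr X).carrier) (hz : z ∈ (normGr X).deg n) : normMap φ z ∈ (normGr Y).deg n := by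
  obtain ⟨x, rfl⟩ := exists_cls X hz
  rw [normMap_cls]
  exact cls_mem Y n _

theorem aw_mem (X Y : SimplicialObject (ModuleCat.{v} R)) (n : ℕ)
    (z : (normGr (boxMod X Y)).carrier) (hz : z ∈ (normGr (boxMod X Y)).deg n) :
    aw X Y z ∈ (normGr X).tensorDeg (normGr Y) n := by
  obtain ⟨w, rfl⟩ := exists_cls _ hz
  have h : ∀ w : X _⦋n⦌ ⊗[R] Y _⦋n⦌, awLevel X Y n w ∈ (normGr X).tensorDeg (normGr Y) n := by
    intro w
    induction w using TensorProduct.induction_on with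
    | zero => simp
    | add x y hx hy => rw [map_add]; exact add_mem hx hy
    | tmul x y =>
      rw [awLevel, LinearMap.sum_apply]
      refine sum_mem fun p hp => ?_
      exact (normGr X).tmul_mem (normGr Y) (Finset.HasAntidiagonal.mem_antidiagonal.mp hp)
        (cls_mem X _ _) (cls_mem Y _ _)
  exact (congrArg (· ∈ (normGr X).tensorDeg (normGr Y) n) (aw_cls X Y n w)).mpr (h w)

end Normalized

section AlexanderWhitney

variable {R : Type u} [CommRing R]

/-- The class of the face of `x` spanned by the vertices `a, …, a + b`. -/
def piece (X : SimplicialObject (ModuleCat.{v} R)) (n a b : ℕ) :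
    X _⦋n⦌ →ₗ[R] (normGr X).carrier :=
  cls X b ∘ₗ act X (seg n a b)

theorem awLevel_eq (X Y : SimplicialObject (ModuleCat.{v} R)) (n : ℕ) :
    awLevel X Y n = ∑ p ∈ Finset.HasAntidiagonal.antidiagonal n,
      TensorProduct.map (piece X n 0 p.1) (piece Y n p.1 p.2) := rfl

theorem piece_act (X : SimplicialObject (ModuleCat.{v} R)) {m n a b c : ℕ} (h1 : c + b ≤ m)
    (h2 : a + m ≤ n) : piece X m c b ∘ₗ act X (seg n a m) = piece X n (a + c) b := by
  ext x
  simp only [piece, LinearMap.comp_apply, act_act, seg_comp h1 h2]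

theorem awLevel_act (X Y : SimplicialObject (ModuleCat.{v} R)) {m n a : ℕ} (h : a + m ≤ n) :
    awLevel X Y m ∘ₗ TensorProduct.map (act X (seg n a m)) (act Y (seg n a m)) =
      ∑ p ∈ Finset.HasAntidiagonal.antidiagonal m,
        TensorProduct.map (piece X n a p.1) (piece Y n (a + p.1) p.2) := by
  refine TensorProduct.ext' fun x y => ?_
  rw [LinearMap.comp_apply, awLevel_eq, LinearMap.sum_apply, LinearMap.sum_apply]
  refine Finset.sum_congr rfl fun p hp => ?_
  rw [Finset.HasAntidiagonal.mem_antidiagonal] at hp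
  rw [TensorProduct.map_tmul, TensorProduct.map_tmul, TensorProduct.map_tmul,
    ← LinearMap.comp_apply, ← LinearMap.comp_apply, piece_act X (by omega) h,
    piece_act Y (by omega) h, add_zero]

theorem sum_triple {A : Type*} [AddCommMonoid A] (n : ℕ) (f : ℕ → ℕ → ℕ → A) :
    ∑ p ∈ Finset.HasAntidiagonal.antidiagonal n,
      ∑ r ∈ Finset.HasAntidiagonal.antidiagonal p.1, f r.1 r.2 p.2 =
    ∑ p ∈ Finset.HasAntidiagonal.antidiagonal n,
      ∑ r ∈ Finset.HasAntidiagonal.antidiagonal p.2, f p.1 r.1 r.2 := by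
  rw [Finset.sum_sigma', Finset.sum_sigma']
  refine Finset.sum_nbij' (fun s => ⟨(s.2.1, s.2.2 + s.1.2), (s.2.2, s.1.2)⟩)
    (fun s => ⟨(s.1.1 + s.2.1, s.2.2), (s.1.1, s.2.1)⟩) ?_ ?_ ?_ ?_ ?_
  · rintro ⟨⟨p, q⟩, ⟨a, b⟩⟩ h
    rw [Finset.mem_sigma, Finset.HasAntidiagonal.mem_antidiagonal,
      Finset.HasAntidiagonal.mem_antidiagonal] at h ⊢
    obtain ⟨h1, h2⟩ := h
    simp only at h1 h2
    exact ⟨by simp only; omega, rfl⟩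
  · rintro ⟨⟨p, q⟩, ⟨a, b⟩⟩ h
    rw [Finset.mem_sigma, Finset.HasAntidiagonal.mem_antidiagonal,
      Finset.HasAntidiagonal.mem_antidiagonal] at h ⊢
    obtain ⟨h1, h2⟩ := h
    simp only at h1 h2
    exact ⟨by simp only; omega, rfl⟩
  · rintro ⟨⟨p, q⟩, ⟨a, b⟩⟩ h
    simp only [Finset.mem_sigma, Finset.HasAntidiagonal.mem_antidiagonal] at h ⊢
    obtain ⟨-, rfl⟩ := h
    rfl
  · rintro ⟨⟨p, q⟩, ⟨a, b⟩⟩ h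
    simp only [Finset.mem_sigma, Finset.HasAntidiagonal.mem_antidiagonal] at h ⊢
    obtain ⟨-, rfl⟩ := h
    rfl
  · rintro ⟨⟨p, q⟩, ⟨a, b⟩⟩ h
    rfl

/-- The `i`-th coface with `i` a natural number. -/
def face (n i : ℕ) : ⦋n⦌ ⟶ ⦋n + 1⦌ :=
  SimplexCategory.Hom.mk
    { toFun := fun j => ⟨if (j : ℕ) < i then (j : ℕ) else (j : ℕ) + 1, by
        have := j.2
        simp only [SimplexCategory.len_mk] at this ⊢
        split_ifs <;> omega⟩
      monotone' := fun j k hjk => by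
        have : (j : ℕ) ≤ k := hjk
        rw [Fin.le_def]
        simp only
        split_ifs <;> omega }

theorem face_val (n i : ℕ) (j : Fin (n + 1)) :
    (((face n i).toOrderHom j : Fin (n + 2)) : ℕ) = if (j : ℕ) < i then (j : ℕ) else j + 1 := rfl

theorem altSum_eq (X : SimplicialObject (ModuleCat.{v} R)) (n : ℕ) (x : X _⦋n + 1⦌) :
    altSum X n x = ∑ i ∈ Finset.range (n + 2), (-1 : R) ^ i • act X (face n i) x := by
  rw [altSum, LinearMap.sum_apply, Finset.sum_range]
  refine Finset.sum_congr rfl fun i _ => ?_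
  have : SimplexCategory.δ i = face n i := by
    apply hom_ext_val
    intro j
    rw [δ_val, face_val]
  rw [this, LinearMap.smul_apply]

theorem aw_level_d (X Y : SimplicialObject (ModuleCat.{v} R)) (p q : ℕ)
    (x : X _⦋p + q + 1⦌) (y : Y _⦋p + q + 1⦌) :
    ∑ i ∈ Finset.range (p + q + 2), (-1 : R) ^ i •
      (piece X (p + q) 0 p (act X (face (p + q) i) x) ⊗ₜ[R]
        piece Y (p + q) p q (act Y (face (p + q) i) y)) =
    normD X (piece X (p + q + 1) 0 (p + 1) x) ⊗ₜ[R] piece Y (p + q + 1) (p + 1) q y +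
      (-1 : R) ^ p • (piece X (p + q + 1) 0 p x ⊗ₜ[R]
        normD Y (piece Y (p + q + 1) p (q + 1) y)) := by
  have hX : normD X (piece X (p + q + 1) 0 (p + 1) x) =
      ∑ i ∈ Finset.range (p + 2), (-1 : R) ^ i •
        cls X p (act X (face p i ≫ seg (p + q + 1) 0 (p + 1)) x) := by
    rw [piece, LinearMap.comp_apply, normD_succ, altSum_eq, map_sum]
    simp only [map_smul, act_act]
  have hY : normD Y (piece Y (p + q + 1) p (q + 1) y) =
      ∑ i ∈ Finset.range (q + 2), (-1 : R) ^ i •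
        cls Y q (act Y (face q i ≫ seg (p + q + 1) p (q + 1)) y) := by
    rw [piece, LinearMap.comp_apply, normD_succ, altSum_eq, map_sum]
    simp only [map_smul, act_act]
  rw [hX, hY, show p + q + 2 = (p + 1) + (q + 1) by ring, Finset.sum_range_add,
    Finset.sum_range_succ (fun i => (-1 : R) ^ i •
        cls X p (act X (face p i ≫ seg (p + q + 1) 0 (p + 1)) x)) (p + 1),
    Finset.sum_range_succ' (fun i => (-1 : R) ^ i •
        cls Y q (act Y (face q i ≫ seg (p + q + 1) p (q + 1)) y)) (q + 1)]
  have a1 : ∀ i ∈ Finset.range (p + 1), (-1 : R) ^ i •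
      (piece X (p + q) 0 p (act X (face (p + q) i) x) ⊗ₜ[R]
        piece Y (p + q) p q (act Y (face (p + q) i) y)) =
      ((-1 : R) ^ i • cls X p (act X (face p i ≫ seg (p + q + 1) 0 (p + 1)) x)) ⊗ₜ[R]
        piece Y (p + q + 1) (p + 1) q y := by
    intro i hi
    rw [Finset.mem_range] at hi
    have e1 : seg (p + q) 0 p ≫ face (p + q) i = face p i ≫ seg (p + q + 1) 0 (p + 1) := by
      apply hom_ext_val
      intro j
      have := j.2
      rw [comp_val, comp_val, face_val, seg_val, seg_val, face_val]
      split_ifs <;> omega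
    have e2 : seg (p + q) p q ≫ face (p + q) i = seg (p + q + 1) (p + 1) q := by
      apply hom_ext_val
      intro j
      have := j.2
      rw [comp_val, face_val, seg_val, seg_val]
      split_ifs <;> omega
    simp only [piece, LinearMap.comp_apply, act_act, e1, e2, TensorProduct.smul_tmul']
  have a2 : ∀ i ∈ Finset.range (q + 1), (-1 : R) ^ (p + 1 + i) •
      (piece X (p + q) 0 p (act X (face (p + q) (p + 1 + i)) x) ⊗ₜ[R]
        piece Y (p + q) p q (act Y (face (p + q) (p + 1 + i)) y)) =
      (-1 : R) ^ p • (piece X (p + q + 1) 0 p x ⊗ₜ[R] ((-1 : R) ^ (i + 1) •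
        cls Y q (act Y (face q (i + 1) ≫ seg (p + q + 1) p (q + 1)) y))) := by
    intro i hi
    rw [Finset.mem_range] at hi
    have e1 : seg (p + q) 0 p ≫ face (p + q) (p + 1 + i) = seg (p + q + 1) 0 p := by
      apply hom_ext_val
      intro j
      have := j.2
      rw [comp_val, face_val, seg_val, seg_val]
      split_ifs <;> omega
    have e2 : seg (p + q) p q ≫ face (p + q) (p + 1 + i) =
        face q (i + 1) ≫ seg (p + q + 1) p (q + 1) := by
      apply hom_ext_val
      intro j
      have := j.2
      rw [comp_val, comp_val, face_val, seg_val, seg_val, face_val]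
      split_ifs <;> omega
    simp only [piece, LinearMap.comp_apply, act_act, e1, e2, TensorProduct.tmul_smul, smul_smul,
      ← pow_add]
    rw [show p + 1 + i = p + (i + 1) by ring]
  have e3 : face p (p + 1) ≫ seg (p + q + 1) 0 (p + 1) = seg (p + q + 1) 0 p := by
    apply hom_ext_val
    intro j
    have := j.2
    rw [comp_val, seg_val, seg_val]
    simp only [face_val]
    split_ifs
    omega
  have e4 : face q 0 ≫ seg (p + q + 1) p (q + 1) = seg (p + q + 1) (p + 1) q := by
    apply hom_ext_val
    intro j
    have := j.2
    rw [comp_val, seg_val, seg_val]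
    simp only [face_val]
    split_ifs <;> omega
  rw [Finset.sum_congr rfl a1, Finset.sum_congr rfl a2, TensorProduct.add_tmul,
    TensorProduct.tmul_add, TensorProduct.sum_tmul, TensorProduct.tmul_sum, smul_add,
    Finset.smul_sum, e3, e4]
  simp only [piece, LinearMap.comp_apply, pow_zero, one_smul, pow_succ, mul_neg, mul_one,
    neg_smul, TensorProduct.neg_tmul, TensorProduct.smul_tmul']
  abel

/-- The Alexander–Whitney map is a chain map. -/
theorem aw_d (X Y : SimplicialObject (ModuleCat.{v} R)) (z : (normGr (boxMod X Y)).carrier) :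
    aw X Y (normD (boxMod X Y) z) =
      tensorD (normGr X) (normGr Y) (normD X) (normD Y) (aw X Y z) := by
  suffices h : aw X Y ∘ₗ normD (boxMod X Y) =
      tensorD (normGr X) (normGr Y) (normD X) (normD Y) ∘ₗ aw X Y from LinearMap.congr_fun h z
  refine norm_ext (boxMod X Y) fun n w => ?_
  rw [LinearMap.comp_apply, LinearMap.comp_apply]
  refine Eq.trans ?_ (congrArg _ (aw_cls X Y n w).symm)
  have hD : ∀ i j (x : X _⦋i⦌) (y : Y _⦋j⦌),
      tensorD (normGr X) (normGr Y) (normD X) (normD Y) (cls X i x ⊗ₜ cls Y j y) =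
        normD X (cls X i x) ⊗ₜ cls Y j y + (-1 : R) ^ i • (cls X i x ⊗ₜ normD Y (cls Y j y)) := by
    intro i j x y
    simp [tensorD, (normGr X).sgn_apply (cls_mem X i x), TensorProduct.smul_tmul']
  cases n with
  | zero =>
    rw [normD_zero, map_zero]
    have : tensorD (normGr X) (normGr Y) (normD X) (normD Y) ∘ₗ awLevel X Y 0 = 0 := by
      refine TensorProduct.ext' fun x y => ?_
      rw [LinearMap.comp_apply, awLevel_eq, LinearMap.sum_apply, map_sum]
      refine Finset.sum_eq_zero ?_
      rintro ⟨p, q⟩ hpq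
      rw [Finset.HasAntidiagonal.mem_antidiagonal] at hpq
      obtain ⟨rfl, rfl⟩ : p = 0 ∧ q = 0 := by simp only at hpq; omega
      rw [TensorProduct.map_tmul]
      refine (hD 0 0 _ _).trans ?_
      rw [normD_zero, normD_zero]
      simp
    exact (LinearMap.congr_fun this w).symm
  | succ n =>
    rw [normD_succ]
    refine (aw_cls X Y n _).trans ?_
    have : awLevel X Y n ∘ₗ altSum (boxMod X Y) n =
        tensorD (normGr X) (normGr Y) (normD X) (normD Y) ∘ₗ awLevel X Y (n + 1) := by
      refine TensorProduct.ext' fun x y => ?_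
      have hs : altSum (boxMod X Y) n (x ⊗ₜ[R] y) = ∑ i ∈ Finset.range (n + 2), (-1 : R) ^ i •
          (act X (face n i) x ⊗ₜ[R] act Y (face n i) y) := altSum_eq (boxMod X Y) n (x ⊗ₜ[R] y)
      have h1 : awLevel X Y n (∑ i ∈ Finset.range (n + 2), (-1 : R) ^ i •
          (act X (face n i) x ⊗ₜ[R] act Y (face n i) y)) =
          ∑ p ∈ Finset.HasAntidiagonal.antidiagonal n, ∑ i ∈ Finset.range (n + 2), (-1 : R) ^ i •
            (piece X n 0 p.1 (act X (face n i) x) ⊗ₜ[R]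
              piece Y n p.1 p.2 (act Y (face n i) y)) := by
        rw [Finset.sum_comm, map_sum]
        refine Finset.sum_congr rfl fun i _ => ?_
        rw [map_smul, awLevel_eq, LinearMap.sum_apply, Finset.smul_sum]
        rfl
      have h2 : tensorD (normGr X) (normGr Y) (normD X) (normD Y)
          (awLevel X Y (n + 1) (x ⊗ₜ y)) =
          ∑ p ∈ Finset.HasAntidiagonal.antidiagonal (n + 1),
            (normD X (piece X (n + 1) 0 p.1 x) ⊗ₜ[R] piece Y (n + 1) p.1 p.2 y +
              (-1 : R) ^ p.1 • (piece X (n + 1) 0 p.1 x ⊗ₜ[R]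
                normD Y (piece Y (n + 1) p.1 p.2 y))) := by
        rw [awLevel_eq, LinearMap.sum_apply, map_sum]
        exact Finset.sum_congr rfl fun p _ => hD _ _ _ _
      refine Eq.trans (congrArg (awLevel X Y n) hs) (h1.trans (Eq.trans ?_ h2.symm))
      rw [Finset.sum_add_distrib, Finset.Nat.sum_antidiagonal_succ,
        Finset.Nat.sum_antidiagonal_succ' (f := fun p => (-1 : R) ^ p.1 •
          (piece X (n + 1) 0 p.1 x ⊗ₜ[R] normD Y (piece Y (n + 1) p.1 p.2 y)))]
      have z1 : normD X (piece X (n + 1) 0 0 x) = 0 := normD_zero X _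
      have z2 : normD Y (piece Y (n + 1) (n + 1) 0 y) = 0 := normD_zero Y _
      simp only [z1, z2, TensorProduct.zero_tmul, TensorProduct.tmul_zero, smul_zero, zero_add]
      rw [← Finset.sum_add_distrib]
      refine Finset.sum_congr rfl ?_
      rintro ⟨p, q⟩ hpq
      rw [Finset.HasAntidiagonal.mem_antidiagonal] at hpq
      simp only at hpq
      subst hpq
      exact aw_level_d X Y p q x y
    exact LinearMap.congr_fun this w

end AlexanderWhitney

section SimplicialCoalgebra

variable {R : Type u} [CommRing R]

/-- The simplicial module underlying a simplicial coalgebra. -/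
def under (M : SimplicialObject (CoalgCat.{v} R)) : SimplicialObject (ModuleCat.{v} R) :=
  ((SimplicialObject.whiskering (CoalgCat.{v} R) (ModuleCat.{v} R)).obj
    (forget₂ (CoalgCat.{v} R) (ModuleCat.{v} R))).obj M

/-- The levelwise comultiplication `M → M ⊠ M`, a morphism of simplicial modules. -/
def levelComul (M : SimplicialObject (CoalgCat.{v} R)) :
    under M ⟶ boxMod (under M) (under M) where
  app k := ModuleCat.ofHom (Coalgebra.comul (R := R) (A := M.obj k))
  naturality k l f := by
    ext x
    exact (LinearMap.congr_fun (M.map f).toCoalgHom.map_comp_comul x).symm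

/-- The comultiplication in level `n`. -/
def lev (M : SimplicialObject (CoalgCat.{v} R)) (n : ℕ) :
    (under M) _⦋n⦌ →ₗ[R] (under M) _⦋n⦌ ⊗[R] (under M) _⦋n⦌ :=
  Coalgebra.comul (R := R) (A := M.obj (Opposite.op ⦋n⦌))

/-- The counit in level `n`. -/
def levCounit (M : SimplicialObject (CoalgCat.{v} R)) (n : ℕ) : (under M) _⦋n⦌ →ₗ[R] R :=
  Coalgebra.counit (R := R) (A := M.obj (Opposite.op ⦋n⦌))

theorem lev_act (M : SimplicialObject (CoalgCat.{v} R)) {m n : ℕ} (θ : ⦋m⦌ ⟶ ⦋n⦌) :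
    lev M m ∘ₗ act (under M) θ =
      TensorProduct.map (act (under M) θ) (act (under M) θ) ∘ₗ lev M n :=
  (M.map θ.op).toCoalgHom.map_comp_comul.symm

theorem levCounit_act (M : SimplicialObject (CoalgCat.{v} R)) {m n : ℕ} (θ : ⦋m⦌ ⟶ ⦋n⦌) :
    levCounit M m ∘ₗ act (under M) θ = levCounit M n :=
  (M.map θ.op).toCoalgHom.counit_comp

/-- The comultiplication `A_N(M) → A_N(M ⊠ M) → A_N(M) ⊗ A_N(M)` of the normalized chain complex
of a simplicial coalgebra. -/
def normComul (M : SimplicialObject (CoalgCat.{v} R)) :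
    (normGr (under M)).carrier →ₗ[R] (normGr (under M)).carrier ⊗[R] (normGr (under M)).carrier :=
  aw (under M) (under M) ∘ₗ normMap (levelComul M)

theorem normComul_cls (M : SimplicialObject (CoalgCat.{v} R)) (n : ℕ) (x : (under M) _⦋n⦌) :
    normComul M (cls (under M) n x) = awLevel (under M) (under M) n (lev M n x) := by
  rw [normComul, LinearMap.comp_apply, normMap_cls]
  exact aw_cls _ _ n _

theorem normComul_piece (M : SimplicialObject (CoalgCat.{v} R)) {n a m : ℕ} (h : a + m ≤ n) :
    normComul M ∘ₗ piece (under M) n a m =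
      (∑ p ∈ Finset.HasAntidiagonal.antidiagonal m, TensorProduct.map
        (piece (under M) n a p.1) (piece (under M) n (a + p.1) p.2)) ∘ₗ lev M n := by
  rw [← awLevel_act _ _ h, LinearMap.comp_assoc, ← lev_act]
  ext x
  exact normComul_cls M m _

/-- The counit of the normalized chain complex of a simplicial coalgebra: the counit of `M_0` in
degree `0`, and zero in positive degrees. -/
def normCounit (M : SimplicialObject (CoalgCat.{v} R)) : (normGr (under M)).carrier →ₗ[R] R :=
  normLift (under M)
    (fun n => match n with
      | 0 => levCounit M 0
      | _ + 1 => 0)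
    (fun n => match n with
      | 0 => bot_le
      | _ + 1 => fun _ _ => rfl)

theorem normCounit_zero (M : SimplicialObject (CoalgCat.{v} R)) (x : (under M) _⦋0⦌) :
    normCounit M (cls (under M) 0 x) = levCounit M 0 x := normLift_cls _ _ _ 0 x

theorem normCounit_succ (M : SimplicialObject (CoalgCat.{v} R)) (n : ℕ) (x : (under M) _⦋n + 1⦌) :
    normCounit M (cls (under M) (n + 1) x) = 0 := normLift_cls _ _ _ (n + 1) x

theorem normCounit_piece (M : SimplicialObject (CoalgCat.{v} R)) (n a b : ℕ) :
    normCounit M ∘ₗ piece (under M) n a b = if b = 0 then levCounit M n else 0 := by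
  cases b with
  | zero =>
    rw [if_pos rfl, ← levCounit_act M (seg n a 0)]
    ext x
    exact normCounit_zero M _
  | succ b =>
    rw [if_neg (Nat.succ_ne_zero b)]
    ext x
    exact normCounit_succ M b _

theorem norm_coassoc (M : SimplicialObject (CoalgCat.{v} R)) (z : (normGr (under M)).carrier) :
    TensorProduct.assoc R _ _ _
      (TensorProduct.map (normComul M) LinearMap.id (normComul M z)) =
      TensorProduct.map LinearMap.id (normComul M) (normComul M z) := by
  suffices h : (TensorProduct.assoc R _ _ _).toLinearMap ∘ₗ
      TensorProduct.map (normComul M) LinearMap.id ∘ₗ normComul M =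
      TensorProduct.map LinearMap.id (normComul M) ∘ₗ normComul M from LinearMap.congr_fun h z
  refine norm_ext _ fun n x => ?_
  simp only [LinearMap.comp_apply, LinearEquiv.coe_coe]
  rw [normComul_cls]
  have hL : (TensorProduct.assoc R _ _ _).toLinearMap ∘ₗ
      TensorProduct.map (normComul M) LinearMap.id ∘ₗ awLevel (under M) (under M) n =
      (∑ p ∈ Finset.HasAntidiagonal.antidiagonal n,
        ∑ r ∈ Finset.HasAntidiagonal.antidiagonal p.1,
        TensorProduct.map (piece (under M) n 0 r.1)
          (TensorProduct.map (piece (under M) n r.1 r.2) (piece (under M) n (r.1 + r.2) p.2))) ∘ₗ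
        (TensorProduct.assoc R _ _ _).toLinearMap ∘ₗ
        TensorProduct.map (lev M n) LinearMap.id := by
    refine TensorProduct.ext' fun x y => ?_
    simp only [LinearMap.comp_apply, awLevel_eq, LinearMap.sum_apply, map_sum,
      TensorProduct.map_tmul, LinearMap.id_apply]
    refine Finset.sum_congr rfl fun p hp => ?_
    rw [Finset.HasAntidiagonal.mem_antidiagonal] at hp
    rw [← LinearMap.comp_apply (normComul M), normComul_piece M (by omega), LinearMap.comp_apply,
      LinearMap.sum_apply, TensorProduct.sum_tmul, map_sum]
    refine Finset.sum_congr rfl fun r hr => ?_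
    rw [Finset.HasAntidiagonal.mem_antidiagonal] at hr
    rw [← hr, zero_add]
    exact (LinearMap.congr_fun (TensorProduct.map_map_comp_assoc_eq (piece (under M) n 0 r.1)
      (piece (under M) n r.1 r.2) (piece (under M) n (r.1 + r.2) p.2)) (lev M n x ⊗ₜ[R] y)).symm
  have hR : TensorProduct.map LinearMap.id (normComul M) ∘ₗ awLevel (under M) (under M) n =
      (∑ p ∈ Finset.HasAntidiagonal.antidiagonal n,
        ∑ r ∈ Finset.HasAntidiagonal.antidiagonal p.2,
        TensorProduct.map (piece (under M) n 0 p.1)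
          (TensorProduct.map (piece (under M) n p.1 r.1) (piece (under M) n (p.1 + r.1) r.2))) ∘ₗ
        TensorProduct.map LinearMap.id (lev M n) := by
    refine TensorProduct.ext' fun x y => ?_
    simp only [LinearMap.comp_apply, awLevel_eq, LinearMap.sum_apply, map_sum,
      TensorProduct.map_tmul, LinearMap.id_apply]
    refine Finset.sum_congr rfl fun p hp => ?_
    rw [Finset.HasAntidiagonal.mem_antidiagonal] at hp
    rw [← LinearMap.comp_apply (normComul M), normComul_piece M (by omega), LinearMap.comp_apply,
      LinearMap.sum_apply, TensorProduct.tmul_sum]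
  have hco : TensorProduct.assoc R _ _ _ (TensorProduct.map (lev M n) LinearMap.id (lev M n x)) =
      TensorProduct.map LinearMap.id (lev M n) (lev M n x) :=
    Coalgebra.coassoc_apply (R := R) (A := M.obj (Opposite.op ⦋n⦌)) x
  refine (LinearMap.congr_fun hL (lev M n x)).trans
    (Eq.trans ?_ (LinearMap.congr_fun hR (lev M n x)).symm)
  rw [LinearMap.comp_apply, LinearMap.comp_apply, LinearMap.comp_apply, LinearEquiv.coe_coe, hco]
  congr 1
  exact sum_triple n fun a b c => TensorProduct.map (piece (under M) n 0 a)
    (TensorProduct.map (piece (under M) n a b) (piece (under M) n (a + b) c))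

theorem piece_self (X : SimplicialObject (ModuleCat.{v} R)) (n : ℕ) (x : X _⦋n⦌) :
    piece X n 0 n x = cls X n x := by
  rw [piece, LinearMap.comp_apply, seg_id, act_id]

theorem norm_counit_left (M : SimplicialObject (CoalgCat.{v} R))
    (z : (normGr (under M)).carrier) : TensorProduct.lid R _
      (TensorProduct.map (normCounit M) LinearMap.id (normComul M z)) = z := by
  suffices h : (TensorProduct.lid R _).toLinearMap ∘ₗ
      TensorProduct.map (normCounit M) LinearMap.id ∘ₗ normComul M = LinearMap.id from
    LinearMap.congr_fun h z
  refine norm_ext _ fun n x => ?_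
  simp only [LinearMap.comp_apply, LinearEquiv.coe_coe, LinearMap.id_apply]
  rw [normComul_cls]
  have h : TensorProduct.map (normCounit M) LinearMap.id ∘ₗ awLevel (under M) (under M) n =
      TensorProduct.map LinearMap.id (cls (under M) n) ∘ₗ
        TensorProduct.map (levCounit M n) LinearMap.id := by
    refine TensorProduct.ext' fun x y => ?_
    simp only [LinearMap.comp_apply, awLevel_eq, LinearMap.sum_apply, map_sum,
      TensorProduct.map_tmul, LinearMap.id_apply]
    rw [Finset.sum_eq_single (0, n)]
    · rw [← LinearMap.comp_apply (normCounit M), normCounit_piece, if_pos rfl, piece_self]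
    · rintro ⟨p, q⟩ hpq hne
      rw [Finset.HasAntidiagonal.mem_antidiagonal] at hpq
      have hp : p ≠ 0 := by
        rintro rfl
        apply hne
        simp only [zero_add] at hpq
        rw [hpq]
      rw [← LinearMap.comp_apply (normCounit M), normCounit_piece, if_neg hp,
        LinearMap.zero_apply, TensorProduct.zero_tmul]
    · intro h
      exact absurd (Finset.HasAntidiagonal.mem_antidiagonal.mpr (zero_add n)) h
  have hc : TensorProduct.map (levCounit M n) LinearMap.id (lev M n x) = 1 ⊗ₜ[R] x :=
    Coalgebra.rTensor_counit_comul (R := R) (A := M.obj (Opposite.op ⦋n⦌)) x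
  refine (congrArg _ (LinearMap.congr_fun h (lev M n x))).trans ?_
  rw [LinearMap.comp_apply, hc]
  simp

theorem norm_counit_right (M : SimplicialObject (CoalgCat.{v} R))
    (z : (normGr (under M)).carrier) : TensorProduct.rid R _
      (TensorProduct.map LinearMap.id (normCounit M) (normComul M z)) = z := by
  suffices h : (TensorProduct.rid R _).toLinearMap ∘ₗ
      TensorProduct.map LinearMap.id (normCounit M) ∘ₗ normComul M = LinearMap.id from
    LinearMap.congr_fun h z
  refine norm_ext _ fun n x => ?_
  simp only [LinearMap.comp_apply, LinearEquiv.coe_coe, LinearMap.id_apply]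
  rw [normComul_cls]
  have h : TensorProduct.map LinearMap.id (normCounit M) ∘ₗ awLevel (under M) (under M) n =
      TensorProduct.map (cls (under M) n) LinearMap.id ∘ₗ
        TensorProduct.map LinearMap.id (levCounit M n) := by
    refine TensorProduct.ext' fun x y => ?_
    simp only [LinearMap.comp_apply, awLevel_eq, LinearMap.sum_apply, map_sum,
      TensorProduct.map_tmul, LinearMap.id_apply]
    rw [Finset.sum_eq_single (n, 0)]
    · rw [← LinearMap.comp_apply (normCounit M), normCounit_piece, if_pos rfl, piece_self]
    · rintro ⟨p, q⟩ hpq hne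
      rw [Finset.HasAntidiagonal.mem_antidiagonal] at hpq
      have hq : q ≠ 0 := by
        rintro rfl
        apply hne
        simp only [add_zero] at hpq
        rw [hpq]
      rw [← LinearMap.comp_apply (normCounit M), normCounit_piece, if_neg hq,
        LinearMap.zero_apply, TensorProduct.tmul_zero]
    · intro h
      exact absurd (Finset.HasAntidiagonal.mem_antidiagonal.mpr (add_zero n)) h
  have hc : TensorProduct.map LinearMap.id (levCounit M n) (lev M n x) = x ⊗ₜ[R] 1 :=
    Coalgebra.lTensor_counit_comul (R := R) (A := M.obj (Opposite.op ⦋n⦌)) x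
  refine (congrArg _ (LinearMap.congr_fun h (lev M n x))).trans ?_
  rw [LinearMap.comp_apply, hc]
  simp

theorem norm_counit_d (M : SimplicialObject (CoalgCat.{v} R)) (z : (normGr (under M)).carrier) :
    normCounit M (normD (under M) z) = 0 := by
  suffices h : normCounit M ∘ₗ normD (under M) = 0 from LinearMap.congr_fun h z
  refine norm_ext _ fun n x => ?_
  rw [LinearMap.comp_apply, LinearMap.zero_apply]
  match n with
  | 0 => rw [normD_zero, map_zero]
  | 1 =>
    rw [normD_succ, normCounit_zero, altSum, LinearMap.sum_apply, map_sum, Fin.sum_univ_two]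
    simp only [LinearMap.smul_apply, map_smul]
    rw [← LinearMap.comp_apply (levCounit M 0), ← LinearMap.comp_apply (levCounit M 0),
      levCounit_act, levCounit_act]
    simp
  | n + 2 => rw [normD_succ, normCounit_succ]

/-- A simplicial coalgebra `M` is reduced if `M_0` is isomorphic to the trivial coalgebra `R`. -/
def IsReduced (M : SimplicialObject (CoalgCat.{v} R)) : Prop :=
  Nonempty (M _⦋0⦌ ≃ₗc[R] R)

theorem IsReduced.bijective {M : SimplicialObject (CoalgCat.{v} R)} (h : IsReduced M) :
    Function.Bijective (levCounit M 0) := by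
  obtain ⟨e⟩ := h
  have he : ∀ x : M _⦋0⦌, levCounit M 0 x = e x := fun x =>
    (CoalgHomClass.counit_comp_apply e x).symm
  have : (levCounit M 0 : (under M) _⦋0⦌ → R) = e := funext he
  rw [this]
  exact e.bijective

theorem norm_connected {M : SimplicialObject (CoalgCat.{v} R)} (h : IsReduced M) :
    Function.Bijective ((normCounit M).domRestrict ((normGr (under M)).deg 0)) := by
  obtain ⟨g, hg⟩ := h.bijective.2 1
  refine ChainCoalg.bijective_of_unit _ _ (cls (under M) 0 g) (cls_mem _ 0 g)
    ((normCounit_zero M g).trans hg) fun z hz => ?_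
  obtain ⟨x, rfl⟩ := exists_cls _ hz
  rw [normCounit_zero, ← map_smul]
  congr 1
  apply h.bijective.1
  rw [map_smul, hg, smul_eq_mul, mul_one]

/-- The normalized chain complex of a reduced simplicial coalgebra, as a connected chain
coalgebra. -/
def normCoalg (M : SimplicialObject (CoalgCat.{v} R)) (hM : IsReduced M) :
    ChainCoalg.{u, v} R where
  toGrMod := normGr (under M)
  d := normD (under M)
  d_mem n z hz := by
    obtain ⟨x, rfl⟩ := exists_cls _ hz
    rw [normD_succ]
    exact cls_mem _ _ _
  d_zero z hz := by
    obtain ⟨x, rfl⟩ := exists_cls _ hz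
    exact normD_zero _ x
  d_d z := by
    suffices h : normD (under M) ∘ₗ normD (under M) = 0 from LinearMap.congr_fun h z
    refine norm_ext _ fun n x => ?_
    rw [LinearMap.comp_apply, LinearMap.zero_apply]
    match n with
    | 0 => rw [normD_zero, map_zero]
    | 1 => rw [normD_succ, normD_zero]
    | n + 2 => rw [normD_succ, normD_succ, altSum_altSum, map_zero]
  comul := normComul M
  comul_mem n z hz := aw_mem _ _ n _ (normMap_mem (levelComul M) n z hz)
  comul_d z := by
    rw [normComul, LinearMap.comp_apply, normMap_d, aw_d]
    rfl
  coassoc := norm_coassoc M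
  counit := normCounit M
  counit_pos n z hz := by
    obtain ⟨x, rfl⟩ := exists_cls _ hz
    exact normCounit_succ M n x
  counit_d := norm_counit_d M
  counit_left := norm_counit_left M
  counit_right := norm_counit_right M
  connected := norm_connected hM

/-- The levelwise tensor product `M ⊠ M'` of simplicial coalgebras. -/
def box (M M' : SimplicialObject (CoalgCat.{v} R)) : SimplicialObject (CoalgCat.{v} R) where
  obj k := CoalgCat.of R (M.obj k ⊗[R] M'.obj k)
  map f := CoalgCat.ofHom
    (Coalgebra.TensorProduct.map (M.map f).toCoalgHom (M'.map f).toCoalgHom)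
  map_id k := by
    apply CoalgCat.hom_ext
    apply CoalgHom.coe_linearMap_injective
    refine TensorProduct.ext' fun x y => ?_
    simp
  map_comp f g := by
    apply CoalgCat.hom_ext
    apply CoalgHom.coe_linearMap_injective
    refine TensorProduct.ext' fun x y => ?_
    simp

theorem under_box (M M' : SimplicialObject (CoalgCat.{v} R)) :
    under (box M M') = boxMod (under M) (under M') := rfl

theorem IsReduced.box {M M' : SimplicialObject (CoalgCat.{v} R)} (h : IsReduced M)
    (h' : IsReduced M') : IsReduced (box M M') := by
  obtain ⟨e⟩ := h
  obtain ⟨e'⟩ := h'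
  have c : (M _⦋0⦌ ⊗[R] M' _⦋0⦌) ≃ₗc[R] (R ⊗[R] R) :=
    { Coalgebra.TensorProduct.map (e : M _⦋0⦌ →ₗc[R] R) (e' : M' _⦋0⦌ →ₗc[R] R),
      TensorProduct.congr (e : M _⦋0⦌ ≃ₗ[R] R) (e' : M' _⦋0⦌ ≃ₗ[R] R) with }
  exact ⟨c.trans (Coalgebra.TensorProduct.lid R R)⟩

end SimplicialCoalgebra

namespace ChainCoalg

section Cobar

variable {R : Type u} [CommRing R]

/-- The coaugmentation coideal `C̄`, the cokernel of the coaugmentation. The image of the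
coaugmentation is `C_0` because `C` is connected. -/
abbrev bar (C : ChainCoalg.{u, v} R) : Type v := C.carrier ⧸ C.deg 0

/-- The algebra underlying the cobar construction `Ω C`: the tensor algebra on `s⁻¹ C̄`. As the
desuspension only shifts degrees, `s⁻¹ C̄` is `C̄` as a module; the grading is `cobarDeg`. -/
abbrev Cobar (C : ChainCoalg.{u, v} R) : Type (max u v) := TensorAlgebra R C.bar

/-- `c ↦ s⁻¹ c`, which vanishes on elements of degree `0`. -/
def sInv (C : ChainCoalg.{u, v} R) : C.carrier →ₗ[R] C.Cobar :=
  TensorAlgebra.ι R ∘ₗ (C.deg 0).mkQ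

theorem sInv_zero (C : ChainCoalg.{u, v} R) {x : C.carrier} (hx : x ∈ C.deg 0) :
    C.sInv x = 0 := by
  have : (C.deg 0).mkQ x = 0 := by simpa using hx
  rw [sInv, LinearMap.comp_apply, this, map_zero]

/-- The cobar differential on generators:
`c ↦ - s⁻¹ (d c) + ∑ (-1) ^ |c₁| s⁻¹ c₁ | s⁻¹ c₂`, where `Δ c = ∑ c₁ ⊗ c₂`. -/
def cobarGen (C : ChainCoalg.{u, v} R) : C.carrier →ₗ[R] C.Cobar :=
  - (C.sInv ∘ₗ C.d) +
    LinearMap.mul' R C.Cobar ∘ₗ TensorProduct.map (C.sInv ∘ₗ C.sgn) C.sInv ∘ₗ C.comul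

theorem cobarGen_zero (C : ChainCoalg.{u, v} R) {x : C.carrier} (hx : x ∈ C.deg 0) :
    C.cobarGen x = 0 := by
  have h : TensorProduct.map (C.sInv ∘ₗ C.sgn) C.sInv (C.comul x) = 0 := by
    refine C.tensor_induction C.toGrMod
      (p := fun z => TensorProduct.map (C.sInv ∘ₗ C.sgn) C.sInv z = 0) (C.comul_mem 0 x hx)
      (fun i j hij y _ z hz => ?_) (map_zero _)
      (fun y z hy hz => by rw [map_add, hy, hz, add_zero])
    obtain ⟨rfl, rfl⟩ : i = 0 ∧ j = 0 := by omega
    rw [TensorProduct.map_tmul, C.sInv_zero hz, TensorProduct.tmul_zero]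
  simp [cobarGen, h, C.d_zero x hx]

/-- The sign automorphism of `Ω C`, `z ↦ (-1) ^ |z| z`: it is the algebra map with
`s⁻¹ c ↦ - (-1) ^ |c| s⁻¹ c`. -/
def cobarSgn (C : ChainCoalg.{u, v} R) : C.Cobar →ₐ[R] C.Cobar :=
  TensorAlgebra.lift R ((C.deg 0).liftQ (- (C.sInv ∘ₗ C.sgn)) fun x hx => by
    simp [C.sInv_zero (sgn_mem C.toGrMod 0 x hx)])

theorem cobarSgn_sInv (C : ChainCoalg.{u, v} R) (x : C.carrier) :
    C.cobarSgn (C.sInv x) = - C.sInv (C.sgn x) := by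
  simp [cobarSgn, sInv]

/-- The algebra map `z ↦ !![σ z, d z; 0, z]`, where `σ` is the sign automorphism. Its upper right
entry is therefore a `σ`-derivation, and it is given by `cobarGen` on generators. -/
def cobarMatrix (C : ChainCoalg.{u, v} R) :
    C.Cobar →ₐ[R] Matrix (Fin 2) (Fin 2) C.Cobar :=
  TensorAlgebra.lift R ((C.deg 0).liftQ
    { toFun := fun x => !![C.cobarSgn (C.sInv x), C.cobarGen x; 0, C.sInv x]
      map_add' := fun x y => by ext i j; fin_cases i <;> fin_cases j <;> simp
      map_smul' := fun r x => by ext i j; fin_cases i <;> fin_cases j <;> simp }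
    fun x hx => by
      ext i j
      fin_cases i <;> fin_cases j <;> simp [C.sInv_zero hx, C.cobarGen_zero hx])

/-- The differential of the cobar construction `Ω C`: the unique derivation (with Koszul sign)
which is given by `cobarGen` on generators. -/
def cobarD (C : ChainCoalg.{u, v} R) : C.Cobar →ₗ[R] C.Cobar where
  toFun z := C.cobarMatrix z 0 1
  map_add' x y := by simp
  map_smul' r x := by simp

theorem cobarMatrix_sInv (C : ChainCoalg.{u, v} R) (x : C.carrier) :
    C.cobarMatrix (C.sInv x) = !![C.cobarSgn (C.sInv x), C.cobarGen x; 0, C.sInv x] := by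
  change C.cobarMatrix (TensorAlgebra.ι R ((C.deg 0).mkQ x)) = _
  rw [cobarMatrix, TensorAlgebra.lift_ι_apply]
  rfl

theorem cobarD_sInv (C : ChainCoalg.{u, v} R) (x : C.carrier) :
    C.cobarD (C.sInv x) = - C.sInv (C.d x) + LinearMap.mul' R C.Cobar
      (TensorProduct.map (C.sInv ∘ₗ C.sgn) C.sInv (C.comul x)) := by
  change C.cobarMatrix (C.sInv x) 0 1 = _
  rw [cobarMatrix_sInv]
  rfl

theorem cobar_induction (C : ChainCoalg.{u, v} R) {p : C.Cobar → Prop} (z : C.Cobar)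
    (h1 : ∀ r : R, p (algebraMap R C.Cobar r)) (hs : ∀ x, p (C.sInv x))
    (hmul : ∀ a b, p a → p b → p (a * b)) (hadd : ∀ a b, p a → p b → p (a + b)) : p z := by
  refine TensorAlgebra.induction (C := p) h1 (fun y => ?_) hmul hadd z
  obtain ⟨x, rfl⟩ := (C.deg 0).mkQ_surjective y
  exact hs x

theorem cobarMatrix_apply (C : ChainCoalg.{u, v} R) (z : C.Cobar) :
    C.cobarMatrix z = !![C.cobarSgn z, C.cobarD z; 0, z] := by
  have h : C.cobarMatrix z 0 0 = C.cobarSgn z ∧ C.cobarMatrix z 1 0 = 0 ∧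
      C.cobarMatrix z 1 1 = z := by
    refine C.cobar_induction (p := fun z => C.cobarMatrix z 0 0 = C.cobarSgn z ∧
      C.cobarMatrix z 1 0 = 0 ∧ C.cobarMatrix z 1 1 = z) z (fun r => ?_) (fun x => ?_)
      (fun a b ha hb => ?_) (fun a b ha hb => ?_)
    · simp [Matrix.algebraMap_matrix_apply]
    · simp [cobarMatrix_sInv]
    · simp [Matrix.mul_apply, ha, hb]
    · simp [ha, hb]
  ext i j
  fin_cases i <;> fin_cases j
  · exact h.1
  · rfl
  · exact h.2.1
  · exact h.2.2

theorem cobarD_mul (C : ChainCoalg.{u, v} R) (a b : C.Cobar) :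
    C.cobarD (a * b) = C.cobarD a * b + C.cobarSgn a * C.cobarD b := by
  change C.cobarMatrix (a * b) 0 1 = _
  rw [map_mul, cobarMatrix_apply, cobarMatrix_apply]
  simp [Matrix.mul_apply, add_comm]

/-- The part of degree `n` of `Ω C`: it is spanned by the words `s⁻¹ c₁ | ⋯ | s⁻¹ c_k` with
`c_i` homogeneous of positive degree and `∑ (|c_i| - 1) = n`. A word is given by the list of the
pairs `(|c_i| - 1, c_i)`. -/
def cobarDeg (C : ChainCoalg.{u, v} R) (n : ℕ) : Submodule R C.Cobar :=
  Submodule.span R {z | ∃ l : List (ℕ × C.carrier), (∀ p ∈ l, p.2 ∈ C.deg (p.1 + 1)) ∧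
    (l.map Prod.fst).sum = n ∧ z = (l.map fun p => C.sInv p.2).prod}

/-- The higher-order part `⨁_{k ≥ 2} (s⁻¹ C̄)^{⊗ k}` of `Ω C`. -/
def higher (C : ChainCoalg.{u, v} R) : Submodule R C.Cobar :=
  ⨆ k : ℕ, LinearMap.range (TensorAlgebra.ι R (M := C.bar)) ^ (k + 2)

/-- A degree-preserving map that commutes with the differentials. -/
def IsChainMap (C D : ChainCoalg.{u, v} R) (f : C.carrier →ₗ[R] D.carrier) : Prop :=
  (∀ n, ∀ x ∈ C.deg n, f x ∈ D.deg n) ∧ ∀ x, f (C.d x) = D.d (f x)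

/-- A chain algebra map `Ω C → Ω D`. -/
def IsChainAlgMap (C D : ChainCoalg.{u, v} R) (ω : C.Cobar →ₐ[R] D.Cobar) : Prop :=
  (∀ n, ∀ z ∈ C.cobarDeg n, ω z ∈ D.cobarDeg n) ∧ ∀ z, ω (C.cobarD z) = D.cobarD (ω z)

/-- A chain map `f : C → D` is a DCSH map (a morphism of chain coalgebras up to strong homotopy)
if there is a chain algebra map `ω : Ω C → Ω D` with
`ω (s⁻¹ c) = s⁻¹ (f c) + higher-order terms`. -/
def IsDCSH (C D : ChainCoalg.{u, v} R) (f : C.carrier →ₗ[R] D.carrier) : Prop :=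
  IsChainMap C D f ∧ ∃ ω : C.Cobar →ₐ[R] D.Cobar, IsChainAlgMap C D ω ∧
    ∀ c, ω (C.sInv c) - D.sInv (f c) ∈ D.higher

end Cobar

end ChainCoalg

/-- The Alexander–Whitney map `f : A_N(M ⊠ M') → A_N(M) ⊗ A_N(M')` of simplicial coalgebras. -/
def awCoalg {R : Type u} [CommRing R] (M M' : SimplicialObject (CoalgCat.{v} R))
    (hM : IsReduced M) (hM' : IsReduced M') :
    (normCoalg (box M M') (hM.box hM')).carrier →ₗ[R]
      ((normCoalg M hM).tensor (normCoalg M' hM')).carrier :=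
  aw (under M) (under M')
end DCSH

end

/-! An algebra map out of a cobar construction that commutes with the differentials amounts to a
twisting cochain. It is therefore enough to find a map `t` from A_N(M ⊠ M') to Ω(A_N(M) ⊗ A_N(M'))
with d t(z) = - t(d z) + ∑ (-1)^|z₁| t(z₁) t(z₂) whose component of word length one is s⁻¹ f
(`ChainCoalg.isDCSH_of_twisting`). Such a `t` is written down explicitly.

For simplices x and y of dimension n, the letters are s⁻¹(x_f ⊗ y_g), where f and g list the
vertices of a face of x and of y. The simplex y is read in blocks of consecutive vertices. Each time
a block ends, its last vertex is appended to a chain that is pending on the side of x. A letter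
consists of an initial piece of the pending chain and of the next block of y; once y is exhausted,
what is still pending makes the last letter. `Letters.E r s v` is the signed sum of these words when
v 0, …, v r are already pending and s steps of y remain. The cochain is `E 0 n` without its constant
term, called `Letters.T`.

Two devices make the verification manageable. First, the unit is added to every letter of total
dimension one. The products with these units cancel the outer faces, so that the differential of a
letter consists only of inner faces and of cuts into two letters (`augment`). The units also produce
the linear part: if the first l letters contribute 1, the pending chain has grown to 0, …, l, and
the next letter is x_{0…l} ⊗ y_{l…n}, a term of the Alexander–Whitney map (`Letters.E_linear`).
Secondly, the letters live in the convolution algebra of linear maps from M_n ⊗ M'_n to the cobar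
construction. A product there comultiplies x and y by itself, so the coalgebras disappear from the
computation, which then takes place in an abstract system `Letters`.

The core is `Letters.d_E`, by induction on s. Expanding the differential of first letter times
remaining word, most terms reassemble into faces and splittings of `E`. The rest cancel in pairs: a
cut of the first letter after the whole block cancels a cut of the chain pending afterwards, and a
cut inside the block cancels the term in which the end of the pending chain is deleted. For r = 0
only inner faces and splittings are left, and removing the constant term turns this into the
twisting equation (`Letters.d_T`).

Finally `E` reduces to its constant term when two consecutive vertices coincide
(`Letters.E_of_degenerate`), so `t` is defined on normalized chains, and it is natural in simplicial
operators (`T_boxAct`), which identifies faces of `T` with values of `t` on faces. -/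

namespace DCSH

/-! ### Reindexing of finite double sums. -/

section Sums

open Finset

variable {B : Type*} [AddCommMonoid B]

theorem sum_range_triangle (n : ℕ) (C : ℕ → ℕ → B) :
    ∑ j ∈ range (n + 1), ∑ i ∈ range (j + 1), C j i =
      ∑ i ∈ range (n + 1), ∑ a ∈ range (n - i + 1), C (i + a) i := by
  rw [sum_sigma', sum_sigma']
  refine sum_nbij' (fun x => ⟨x.2, x.1 - x.2⟩) (fun x => ⟨x.1 + x.2, x.1⟩) ?_ ?_ ?_ ?_ ?_
  · rintro ⟨j, i⟩ h
    simp only [mem_sigma, mem_range] at h ⊢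
    omega
  · rintro ⟨j, i⟩ h
    simp only [mem_sigma, mem_range] at h ⊢
    omega
  · rintro ⟨j, i⟩ h
    simp only [mem_sigma, mem_range] at h
    simp only [Sigma.mk.injEq, heq_eq_eq, and_true]
    omega
  · rintro ⟨j, i⟩ h
    simp
  · rintro ⟨j, i⟩ h
    simp only [mem_sigma, mem_range] at h
    simp only
    rw [show i + (j - i) = j by omega]

theorem sum_range_triangle_lt (n : ℕ) (C : ℕ → ℕ → B) :
    ∑ j ∈ range (n + 1), ∑ i ∈ range j, C j i =
      ∑ i ∈ range (n + 1), ∑ a ∈ range (n - i), C (i + a + 1) i := by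
  rw [sum_sigma', sum_sigma']
  refine sum_nbij' (fun x => ⟨x.2, x.1 - x.2 - 1⟩) (fun x => ⟨x.1 + x.2 + 1, x.1⟩) ?_ ?_ ?_ ?_ ?_
  · rintro ⟨j, i⟩ h
    simp only [mem_sigma, mem_range] at h ⊢
    omega
  · rintro ⟨j, i⟩ h
    simp only [mem_sigma, mem_range] at h ⊢
    omega
  · rintro ⟨j, i⟩ h
    simp only [mem_sigma, mem_range] at h
    simp only [Sigma.mk.injEq, heq_eq_eq, and_true]
    omega
  · rintro ⟨j, i⟩ h
    simp only [Sigma.mk.injEq, heq_eq_eq, true_and]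
    omega
  · rintro ⟨j, i⟩ h
    simp only [mem_sigma, mem_range] at h
    simp only
    rw [show i + (j - i - 1) + 1 = j by omega]

theorem sum_range_diagonal (n : ℕ) (G : ℕ → ℕ → B) :
    ∑ c ∈ range (n + 1), ∑ k ∈ range (n - c), G c k =
      ∑ k ∈ range n, ∑ c ∈ range (k + 1), G c (k - c) := by
  rw [sum_sigma', sum_sigma']
  refine sum_nbij' (fun x => ⟨x.1 + x.2, x.1⟩) (fun x => ⟨x.2, x.1 - x.2⟩) ?_ ?_ ?_ ?_ ?_
  · rintro ⟨j, i⟩ h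
    simp only [mem_sigma, mem_range] at h ⊢
    omega
  · rintro ⟨j, i⟩ h
    simp only [mem_sigma, mem_range] at h ⊢
    omega
  · rintro ⟨j, i⟩ h
    simp
  · rintro ⟨j, i⟩ h
    simp only [mem_sigma, mem_range] at h
    simp only [Sigma.mk.injEq, heq_eq_eq, and_true]
    omega
  · rintro ⟨j, i⟩ h
    simp

/-- Splitting the square `i < n`, `j < n + 1` along the diagonal. -/
theorem sum_range_square (n : ℕ) (A D F : ℕ → ℕ → B)
    (hA : ∀ j i, i < j → j < n + 1 → A (j + 1) i = F i j)
    (hD : ∀ j i, j + i < n → D j i = F (j + i) j) :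
    ∑ j ∈ range (n + 2), ∑ i ∈ range (j - 1), A j i +
      ∑ j ∈ range (n + 1), ∑ i ∈ range (n - j), D j i =
    ∑ i ∈ range n, ∑ j ∈ range (n + 1), F i j := by
  have h1 : ∑ i ∈ range n, ∑ j ∈ range (n + 1), F i j =
      ∑ j ∈ range (n + 1), (∑ i ∈ range j, F i j + ∑ i ∈ range (n - j), F (j + i) j) := by
    rw [sum_comm]
    refine sum_congr rfl fun j hj => ?_
    rw [mem_range] at hj
    rw [← sum_range_add, show j + (n - j) = n by omega]
  rw [h1, sum_add_distrib, sum_range_succ']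
  simp only [zero_le, Nat.sub_eq_zero_of_le, range_zero, sum_empty, add_zero,
    Nat.add_sub_cancel]
  congr 1
  · refine sum_congr rfl fun j hj => sum_congr rfl fun i hi => ?_
    rw [mem_range] at hi hj
    exact hA j i hi hj
  · refine sum_congr rfl fun j hj => sum_congr rfl fun i hi => ?_
    rw [mem_range] at hi hj
    exact hD j i (by omega)

/-- Splitting the square `x < n`, `c < n` along the diagonal, which belongs to the upper part. -/
theorem sum_range_square' (n : ℕ) (A D F : ℕ → ℕ → B)
    (hA : ∀ c x, x ≤ c → c < n → A (c + 1) x = F x c)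
    (hD : ∀ c x, c + x + 1 < n → D c x = F (c + x + 1) c) :
    ∑ c ∈ range (n + 1), ∑ x ∈ range c, A c x +
      ∑ c ∈ range (n + 1), ∑ x ∈ range (n - c - 1), D c x =
    ∑ x ∈ range n, ∑ c ∈ range n, F x c := by
  have h1 : ∑ x ∈ range n, ∑ c ∈ range n, F x c =
      ∑ c ∈ range n, (∑ x ∈ range (c + 1), F x c +
        ∑ x ∈ range (n - c - 1), F (c + x + 1) c) := by
    rw [sum_comm]
    refine sum_congr rfl fun j hj => ?_
    rw [mem_range] at hj
    simp only [add_right_comm j _ 1]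
    rw [← sum_range_add (fun x => F x j), show j + 1 + (n - j - 1) = n by omega]
  rw [h1, sum_add_distrib, sum_range_succ', sum_range_succ _ n]
  simp only [zero_le, Nat.sub_eq_zero_of_le, range_zero, sum_empty, add_zero, Nat.sub_self]
  congr 1
  · refine sum_congr rfl fun j hj => sum_congr rfl fun i hi => ?_
    rw [mem_range] at hi hj
    exact hA j i (by omega) hj
  · refine sum_congr rfl fun j hj => sum_congr rfl fun i hi => ?_
    rw [mem_range] at hi hj
    exact hD j i (by omega)

end Sums

/-! ### Abstract letters and the sum over words. -/

/-- `j ↦ j` for `j < i` and `j ↦ j + 1` for `i ≤ j`. -/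
def skip (i : ℕ) : ℕ →o ℕ where
  toFun j := if j < i then j else j + 1
  monotone' a b hab := by
    simp only
    split_ifs <;> omega

/-- Translation by `a`. -/
def shift (a : ℕ) : ℕ →o ℕ where
  toFun j := j + a
  monotone' i j hij := by simpa using hij

/-- `i ↦ i` for `i ≤ m` and `i ↦ i + c` for `m < i`. -/
def jump (m c : ℕ) : ℕ →o ℕ where
  toFun i := if i ≤ m then i else i + c
  monotone' a b hab := by
    simp only
    split_ifs <;> omega

@[simp] theorem skip_apply (i j : ℕ) : skip i j = if j < i then j else j + 1 := rfl

@[simp] theorem shift_apply (a j : ℕ) : shift a j = j + a := rfl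

@[simp] theorem jump_apply (m c i : ℕ) : jump m c i = if i ≤ m then i else i + c := rfl

/-- A system of letters `L p q f g`, where `f` is read on `[0, p]` and `g` on `[0, q]`, in an
algebra with a derivation. The differential of a letter consists of its inner faces and of its
decompositions into two letters. -/
structure Letters (R : Type*) (A : Type*) [CommRing R] [Ring A] [Algebra R A] where
  d : A →ₗ[R] A
  sg : A →ₗ[R] A
  d_mul : ∀ a b, d (a * b) = d a * b + sg a * d b
  sg_mul : ∀ a b, sg (a * b) = sg a * sg b
  L : ℕ → ℕ → (ℕ →o ℕ) → (ℕ →o ℕ) → A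
  L_congr : ∀ p q f f' g g', (∀ i ≤ p, f i = f' i) → (∀ i ≤ q, g i = g' i) →
    L p q f g = L p q f' g'
  L_zero : ∀ f g, L 0 0 f g = 0
  sg_L : ∀ p q f g, sg (L p q f g) = (-1 : R) ^ (p + q + 1) • L p q f g
  d_L : ∀ p q f g, d (L p q f g) =
    ∑ i ∈ Finset.range (p - 1), (-1 : R) ^ i • L (p - 1) q (f.comp (skip (i + 1))) g +
    ∑ i ∈ Finset.range (q - 1), (-1 : R) ^ (p + i) • L p (q - 1) f (g.comp (skip (i + 1))) +
    ∑ a ∈ Finset.range (p + 1), ∑ b ∈ Finset.range (q + 1),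
      (-1 : R) ^ (a + b + (p - a) * b) •
        (L a b f g * L (p - a) (q - b) (f.comp (shift a)) (g.comp (shift b)))

namespace Letters

open Finset

variable {R A : Type*} [CommRing R] [Ring A] [Algebra R A] (W : Letters R A)

/-- The sum over the words which start from the pending chain `v 0, …, v r` in the first
direction, the second direction being at `v r`, and which run to `v (r + s)` in both directions. -/
def E (r s : ℕ) (v : ℕ →o ℕ) : A :=
  match s with
  | 0 => W.L r 0 v (v.comp (shift r))
  -- The letter reads v 0, …, v j in the first direction and the block v r, …, v (r + c + 1) in the
  -- second. The new sequence is v j, …, v r, v (r + c + 1), v (r + c + 2), …: its first r - j + 2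
  -- vertices are pending, and the inner vertices of the block are lost to the first direction.
  | s + 1 => ∑ c : Fin (s + 1), ∑ j ∈ range (r + 1), (-1 : R) ^ ((c : ℕ) * (r - j)) •
      (W.L j (c + 1) v (v.comp (shift r)) *
        E (r - j + 1) (s - c) (v.comp ((shift j).comp (jump (r - j) c))))
termination_by s

theorem E_zero (r : ℕ) (v : ℕ →o ℕ) : W.E r 0 v = W.L r 0 v (v.comp (shift r)) := by
  rw [E]

theorem E_succ (r s : ℕ) (v : ℕ →o ℕ) : W.E r (s + 1) v =
    ∑ c ∈ range (s + 1), ∑ j ∈ range (r + 1), (-1 : R) ^ (c * (r - j)) •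
      (W.L j (c + 1) v (v.comp (shift r)) *
        W.E (r - j + 1) (s - c) (v.comp ((shift j).comp (jump (r - j) c)))) := by
  rw [E, Finset.sum_range]

theorem E_zero_zero (v : ℕ →o ℕ) : W.E 0 0 v = 0 := by
  rw [E_zero, W.L_zero]

theorem E_congr (r s : ℕ) (v w : ℕ →o ℕ) (h : ∀ i ≤ r + s, v i = w i) :
    W.E r s v = W.E r s w := by
  induction s using Nat.strong_induction_on generalizing r v w with
  | _ s ih =>
  cases s with
  | zero =>
    rw [E_zero, E_zero]
    exact W.L_congr _ _ _ _ _ _ (fun i hi => h i (by omega)) fun i hi => h _ (by simp; omega)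
  | succ s =>
    rw [E_succ, E_succ]
    refine sum_congr rfl fun c hc => sum_congr rfl fun j hj => ?_
    rw [mem_range] at hc hj
    rw [W.L_congr j (c + 1) v w (v.comp (shift r)) (w.comp (shift r))
      (fun i hi => h i (by omega)) fun i hi => h _ (by simp; omega)]
    congr 2
    refine ih _ (by omega) _ _ _ fun i hi => h _ ?_
    simp only [OrderHom.comp_coe, Function.comp_apply, shift_apply, jump_apply]
    split_ifs <;> omega

/-- The part of the boundary of `E r s v` in which the end `v r` of the pending chain has been
deleted. -/
def corr (r s : ℕ) (v : ℕ →o ℕ) : A :=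
  ∑ c ∈ range s, ∑ j ∈ range r, (-1 : R) ^ (r + c + 1 + c * (r - j)) •
    (W.L j (c + 1) v (v.comp (shift r)) * W.E (r - j) (s - 1 - c)
      (v.comp ((shift j).comp ((jump (r - j) c).comp (skip (r - j))))))

end Letters

end DCSH

namespace DCSH

/-- The witnesses `k` and `l` express the parity condition as an equation of natural numbers, which
`ring` or `omega` can settle. -/
theorem neg_one_pow_eq {R : Type*} [Ring R] {m n : ℕ} (k l : ℕ) (h : m + 2 * k = n + 2 * l) :
    (-1 : R) ^ m = (-1) ^ n := by
  have : (-1 : R) ^ (m + 2 * k) = (-1) ^ (n + 2 * l) := by rw [h]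
  simpa [pow_add, pow_mul] using this

theorem neg_one_pow_add_eq_zero {R : Type*} [Ring R] {m n : ℕ} (k l : ℕ)
    (h : m + 2 * k + 1 = n + 2 * l) : (-1 : R) ^ m + (-1) ^ n = 0 := by
  rw [← neg_one_pow_eq (R := R) (m := m + 1) (n := n) k l (by omega), pow_succ]
  simp

namespace Letters

open Finset

variable {R A : Type*} [CommRing R] [Ring A] [Algebra R A] (W : Letters R A)

theorem sg_E (r s : ℕ) (v : ℕ →o ℕ) :
    W.sg (W.E r s v) = (-1 : R) ^ (r + s + 1) • W.E r s v := by
  induction s using Nat.strong_induction_on generalizing r v with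
  | _ s ih =>
  cases s with
  | zero => rw [E_zero, W.sg_L]
  | succ s =>
    rw [E_succ, map_sum, smul_sum]
    refine sum_congr rfl fun c hc => ?_
    rw [map_sum, smul_sum]
    refine sum_congr rfl fun j hj => ?_
    rw [mem_range] at hc hj
    rw [map_smul, W.sg_mul, W.sg_L, ih _ (by omega), smul_mul_smul_comm, smul_smul, smul_smul,
      ← pow_add, ← pow_add, ← pow_add]
    congr 1
    exact neg_one_pow_eq 0 1 (by omega)

/-! ### The boundary of the sum over words. -/

section boundary

variable (r s : ℕ) (v : ℕ →o ℕ)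

/-- The chain which is pending after the block of length `c + 1` has been read, together with
`v 0, …, v j`. -/
def next (r : ℕ) (v : ℕ →o ℕ) (j c : ℕ) : ℕ →o ℕ := v.comp ((shift j).comp (jump (r - j) c))

/-- A summand of `E r (s + 1) v` is `head` times `rest`, and the definitions that follow name the
terms of its differential; X and Y stand for the two directions. `faceX` and `faceY` are the inner
faces of the head. The cuts of the head are `cutX`, `cutY` and `cutXY`, according to whether the
left piece takes nothing, everything or a proper part of the block. The terms prefixed `rest` come
from applying `d_E` to the remaining word. -/
def rest (j c : ℕ) : A := W.E (r - j + 1) (s - c) (next r v j c)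

def head (j c : ℕ) : A := W.L j (c + 1) v (v.comp (shift r))

def faceX (c j i : ℕ) : A := (-1 : R) ^ (c * (r - j) + i) •
  (W.L (j - 1) (c + 1) (v.comp (skip (i + 1))) (v.comp (shift r)) * W.rest r s v j c)

def faceY (c j x : ℕ) : A := (-1 : R) ^ (c * (r - j) + (j + x)) •
  (W.L j c v ((v.comp (shift r)).comp (skip (x + 1))) * W.rest r s v j c)

def cutX (c j i : ℕ) : A := (-1 : R) ^ (c * (r - j) + i) •
  (W.L i 0 v (v.comp (shift r)) * W.L (j - i) (c + 1) (v.comp (shift i)) (v.comp (shift r)) *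
    W.rest r s v j c)

def cutY (c j i : ℕ) : A := (-1 : R) ^ (c * (r - j) + (i + (c + 1) + (j - i) * (c + 1))) •
  (W.L i (c + 1) v (v.comp (shift r)) *
    W.L (j - i) 0 (v.comp (shift i)) (v.comp (shift (r + c + 1))) * W.rest r s v j c)

def cutXY (c j i x : ℕ) : A := (-1 : R) ^ (c * (r - j) + (i + (x + 1) + (j - i) * (x + 1))) •
  (W.L i (x + 1) v (v.comp (shift r)) *
    W.L (j - i) (c - x) (v.comp (shift i)) (v.comp (shift (r + x + 1))) * W.rest r s v j c)

def restFaceX (c j i : ℕ) : A := (-1 : R) ^ (c * (r - j) + (j + c) + i) •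
  (W.head r v j c * W.E (r - j) (s - c) ((next r v j c).comp (skip (i + 1))))

def restFaceY (c j x : ℕ) : A := (-1 : R) ^ (c * (r - j) + (j + c) + (r - j + 1 + x)) •
  (W.head r v j c *
    W.E (r - j + 1) (s - c - 1) ((next r v j c).comp (skip (r - j + 1 + x + 1))))

def restCutX (c j a : ℕ) : A := (-1 : R) ^ (c * (r - j) + (j + c) + a) •
  (W.head r v j c *
    (W.L a 0 (next r v j c) ((next r v j c).comp (shift (r - j + 1))) *
      W.E (r - j + 1 - a) (s - c) ((next r v j c).comp (shift a))))

def restCut (c j k : ℕ) : A := (-1 : R) ^ (c * (r - j) + (j + c) + (r - j + 1 + k)) •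
  (W.head r v j c * (W.E (r - j + 1) k (next r v j c) *
    W.E 0 (s - c - k) ((next r v j c).comp (shift (r - j + 1 + k)))))

def restCorr (c j c' j' : ℕ) : A :=
  (-1 : R) ^ (c * (r - j) + (j + c) + (r - j + 1 + c' + 1 + c' * (r - j + 1 - j'))) •
  (W.head r v j c *
    (W.L j' (c' + 1) (next r v j c) ((next r v j c).comp (shift (r - j + 1))) *
      W.E (r - j + 1 - j') (s - c - 1 - c') ((next r v j c).comp
        ((shift j').comp ((jump (r - j + 1 - j') c').comp (skip (r - j + 1 - j')))))))

/-- An inner pending vertex other than the division point v j is deleted either in the head or in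
the remaining word, and the two possibilities fill the square of pairs (deleted vertex, division
point of the shortened chain). One deletion is left over: v r is the end of the original pending
chain, but it becomes an inner vertex of the next one, to which v (r + c + 1) has been appended.
These deletions form `corr`. -/
theorem sum_faceX_add_sum_restFaceX :
    ∑ c ∈ range (s + 1), ∑ j ∈ range (r + 1), ∑ i ∈ range (j - 1), W.faceX r s v c j i +
      ∑ c ∈ range (s + 1), ∑ j ∈ range (r + 1), ∑ i ∈ range (r - j), W.restFaceX r s v c j i =
    ∑ i ∈ range (r - 1), (-1 : R) ^ i • W.E (r - 1) (s + 1) (v.comp (skip (i + 1))) +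
      W.corr r (s + 1) v := by
  cases r with
  | zero => simp [corr]
  | succ r =>
    -- The last inner face of the pending chain of the rest, the one that deletes v r, is split off.
    -- For j = r + 1 the rest has no inner pending vertex.
    have h1 : ∀ c ∈ range (s + 1),
        ∑ j ∈ range (r + 1 + 1), ∑ i ∈ range (r + 1 - j), W.restFaceX (r + 1) s v c j i =
        ∑ j ∈ range (r + 1), ∑ i ∈ range (r - j), W.restFaceX (r + 1) s v c j i +
        ∑ j ∈ range (r + 1), W.restFaceX (r + 1) s v c j (r - j) := by
      intro c _
      rw [sum_range_succ, Nat.sub_self, range_zero, sum_empty, add_zero, ← sum_add_distrib]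
      refine sum_congr rfl fun j hj => ?_
      rw [mem_range] at hj
      rw [show r + 1 - j = r - j + 1 by omega, sum_range_succ]
    rw [sum_congr rfl h1, sum_add_distrib, ← add_assoc, ← sum_add_distrib]
    congr 1
    · simp only [Nat.add_sub_cancel, E_succ, smul_sum]
      rw [sum_comm]
      refine sum_congr rfl fun c hc => ?_
      refine sum_range_square r _ _ _ ?_ ?_
      · intro j i hi hj
        rw [faceX, smul_smul, ← pow_add]
        congr 1
        · exact neg_one_pow_eq 0 0 (by rw [show r + 1 - (j + 1) = r - j by omega]; ring)
        congr 1
        · refine W.L_congr _ _ _ _ _ _ (fun _ _ => rfl) fun k _ => congrArg v ?_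
          simp only [shift_apply, skip_apply]
          split_ifs <;> omega
        · rw [rest, next]
          congr 1
          · omega
          refine OrderHom.ext _ _ (funext fun k => congrArg v ?_)
          simp only [OrderHom.comp_coe, Function.comp_apply, shift_apply, jump_apply, skip_apply]
          split_ifs <;> omega
      · intro j i hi
        rw [restFaceX, smul_smul, ← pow_add]
        congr 1
        · exact neg_one_pow_eq 0 c (by rw [show r + 1 - j = r - j + 1 by omega]; ring)
        congr 1
        · refine W.L_congr _ _ _ _ _ _ (fun k hk => congrArg v ?_) fun k _ => congrArg v ?_
          · simp
            omega
          · simp only [shift_apply, skip_apply]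
            split_ifs <;> omega
        · rw [next]
          congr 1
          · omega
          refine OrderHom.ext _ _ (funext fun k => congrArg v ?_)
          simp only [OrderHom.comp_coe, Function.comp_apply, shift_apply, jump_apply, skip_apply]
          split_ifs <;> omega
    · rw [corr]
      refine sum_congr rfl fun c _ => sum_congr rfl fun j hj => ?_
      rw [mem_range] at hj
      obtain ⟨m, rfl⟩ : ∃ m, r = j + m := ⟨r - j, by omega⟩
      rw [restFaceX, show j + m + 1 - j = m + 1 by omega, show j + m - j = m by omega,
        Nat.add_sub_cancel]
      congr 1
      · exact neg_one_pow_eq 1 0 (by ring)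
      · rw [next, show j + m + 1 - j = m + 1 by omega]
        rfl

/-- A vertex beyond v r is deleted either inside the block of the head or after it. The vertex v (r
+ c + 1) at which the block ends occurs in neither sum, being the last vertex of the block and the
end of the next pending chain; its deletion is the business of `restCorr`. -/
theorem sum_faceY_add_sum_restFaceY :
    ∑ c ∈ range (s + 1), ∑ j ∈ range (r + 1), ∑ x ∈ range c, W.faceY r s v c j x +
      ∑ c ∈ range (s + 1), ∑ j ∈ range (r + 1), ∑ x ∈ range (s - c - 1),
        W.restFaceY r s v c j x =
    ∑ x ∈ range s, (-1 : R) ^ (r + x) • W.E r s (v.comp (skip (r + x + 1))) := by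
  simp only [sum_comm (s := range (r + 1))]
  rw [sum_range_square' s (fun c x => ∑ j ∈ range (r + 1), W.faceY r s v c j x)
    (fun c x => ∑ j ∈ range (r + 1), W.restFaceY r s v c j x)
    (fun x c => ∑ j ∈ range (r + 1), (-1 : R) ^ (r + x) • (-1 : R) ^ (c * (r - j)) •
      (W.L j (c + 1) (v.comp (skip (r + x + 1))) ((v.comp (skip (r + x + 1))).comp (shift r)) *
        W.E (r - j + 1) (s - 1 - c)
          ((v.comp (skip (r + x + 1))).comp ((shift j).comp (jump (r - j) c)))))]
  · refine sum_congr rfl fun x hx => ?_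
    rw [mem_range] at hx
    obtain ⟨s, rfl⟩ : ∃ s', s = s' + 1 := ⟨s - 1, by omega⟩
    simp only [E_succ, smul_sum, Nat.add_sub_cancel]
  · intro c x hx hc
    refine sum_congr rfl fun j hj => ?_
    rw [mem_range] at hj
    obtain ⟨m, rfl⟩ : ∃ m, r = j + m := ⟨r - j, by omega⟩
    rw [faceY, smul_smul, ← pow_add, show j + m - j = m by omega]
    congr 1
    · exact neg_one_pow_eq 0 0 (by ring)
    congr 1
    · refine W.L_congr _ _ _ _ _ _ (fun k hk => congrArg v ?_) fun k _ => congrArg v ?_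
      · simp
        omega
      · simp only [shift_apply, skip_apply]
        split_ifs <;> omega
    · rw [rest, next, show j + m - j = m by omega, show s - (c + 1) = s - 1 - c by omega]
      congr 1
      refine OrderHom.ext _ _ (funext fun k => congrArg v ?_)
      simp only [OrderHom.comp_coe, Function.comp_apply, shift_apply, jump_apply, skip_apply]
      split_ifs <;> omega
  · intro c x hx
    refine sum_congr rfl fun j hj => ?_
    rw [mem_range] at hj
    obtain ⟨m, rfl⟩ : ∃ m, r = j + m := ⟨r - j, by omega⟩
    rw [restFaceY, smul_smul, ← pow_add, show j + m - j = m by omega]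
    congr 1
    · exact neg_one_pow_eq 0 0 (by ring)
    congr 1
    · refine W.L_congr _ _ _ _ _ _ (fun k hk => congrArg v ?_) fun k _ => congrArg v ?_
      · simp
        omega
      · simp only [shift_apply, skip_apply]
        split_ifs <;> omega
    · rw [next, show j + m - j = m by omega, show s - c - 1 = s - 1 - c by omega]
      congr 1
      refine OrderHom.ext _ _ (funext fun k => congrArg v ?_)
      simp only [OrderHom.comp_coe, Function.comp_apply, shift_apply, jump_apply, skip_apply]
      split_ifs <;> omega

/-- A cut before the block detaches a letter that involves only pending vertices. What remains is a
word on the shorter pending chain that starts at v i. For i = r the detached letter is all of `E r 0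
v`, which is the splitting at v r. -/
theorem sum_cutX :
    ∑ c ∈ range (s + 1), ∑ j ∈ range (r + 1), ∑ i ∈ range (j + 1), W.cutX r s v c j i =
    ∑ i ∈ range r, (-1 : R) ^ i • (W.L i 0 v (v.comp (shift r)) *
      W.E (r - i) (s + 1) (v.comp (shift i))) +
    (-1 : R) ^ r • (W.E r 0 v * W.E 0 (s + 1) (v.comp (shift r))) := by
  have h : (-1 : R) ^ r • (W.E r 0 v * W.E 0 (s + 1) (v.comp (shift r))) =
      (-1 : R) ^ r • (W.L r 0 v (v.comp (shift r)) *
      W.E (r - r) (s + 1) (v.comp (shift r))) := by rw [E_zero, Nat.sub_self]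
  rw [h, ← sum_range_succ (fun i => (-1 : R) ^ i • (W.L i 0 v (v.comp (shift r)) *
      W.E (r - i) (s + 1) (v.comp (shift i)))) r]
  simp only [E_succ, smul_sum, mul_sum]
  rw [sum_comm (s := range (r + 1))]
  refine sum_congr rfl fun c hc => ?_
  rw [sum_range_triangle]
  refine sum_congr rfl fun i hi => sum_congr rfl fun a ha => ?_
  rw [mem_range] at hi ha
  obtain ⟨m, rfl⟩ : ∃ m, r = i + a + m := ⟨r - (i + a), by omega⟩
  rw [cutX, mul_smul_comm, smul_smul, ← pow_add, mul_assoc]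
  rw [show i + a + m - (i + a) = m by omega, show i + a + m - i = a + m by omega,
    show a + m - a = m by omega, show i + a - i = a by omega]
  congr 1
  · exact neg_one_pow_eq 0 0 (by ring)
  congr 1
  congr 1
  · congr 1
    refine OrderHom.ext _ _ (funext fun k => congrArg v ?_)
    simp only [shift_apply]
    omega
  · rw [rest, next, show i + a + m - (i + a) = m by omega]
    congr 1
    refine OrderHom.ext _ _ (funext fun k => congrArg v ?_)
    simp only [OrderHom.comp_coe, Function.comp_apply, shift_apply, jump_apply]
    split_ifs <;> omega

/-- The word with first letter on v 0, …, v i and the whole block, followed by a letter on v i, …, v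
(i + a) alone, arises twice: by cutting a longer head after its block, and by detaching the start of
the chain pending in the rest. The signs are opposite. -/
theorem sum_cutY_add_sum_restCutX :
    ∑ c ∈ range (s + 1), ∑ j ∈ range (r + 1), ∑ i ∈ range (j + 1), W.cutY r s v c j i +
    ∑ c ∈ range (s + 1), ∑ j ∈ range (r + 1), ∑ a ∈ range (r - j + 1), W.restCutX r s v c j a =
    0 := by
  rw [← sum_add_distrib]
  refine sum_eq_zero fun c hc => ?_
  rw [sum_range_triangle, ← sum_add_distrib]
  refine sum_eq_zero fun i hi => ?_
  rw [← sum_add_distrib]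
  refine sum_eq_zero fun a ha => ?_
  rw [mem_range] at hi ha
  obtain ⟨m, rfl⟩ : ∃ m, r = i + a + m := ⟨r - (i + a), by omega⟩
  rw [cutY, restCutX, mul_assoc, head, rest]
  have h1 : next (i + a + m) v (i + a) c = (next (i + a + m) v i c).comp (shift a) := by
    refine OrderHom.ext _ _ (funext fun k => congrArg v ?_)
    simp only [OrderHom.comp_coe, Function.comp_apply, shift_apply, jump_apply]
    split_ifs <;> omega
  have h2 : W.L (i + a - i) 0 (v.comp (shift i)) (v.comp (shift (i + a + m + c + 1))) =
      W.L a 0 (next (i + a + m) v i c)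
        ((next (i + a + m) v i c).comp (shift (i + a + m - i + 1))) := by
    rw [show i + a - i = a by omega]
    refine W.L_congr _ _ _ _ _ _ (fun k hk => congrArg v ?_) fun k _ => congrArg v ?_
    · simp only [OrderHom.comp_coe, Function.comp_apply, shift_apply, jump_apply]
      split_ifs <;> omega
    · simp only [OrderHom.comp_coe, Function.comp_apply, shift_apply, jump_apply]
      split_ifs <;> omega
  rw [h1, h2, show i + a + m - i + 1 - a = i + a + m - (i + a) + 1 by omega, ← add_smul,
    show i + a + m - (i + a) = m by omega, show i + a + m - i = a + m by omega,
    show i + a - i = a by omega, neg_one_pow_add_eq_zero 0 1 (by ring),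
    zero_smul]

/-- Cutting the block at an inner vertex yields two consecutive letters whose common vertex v (r + x
+ 1) never joins the pending chain. The same word arises by reading the two blocks separately, which
appends that vertex, and then deleting it by the term `corr` of the rest. The signs are opposite. -/
theorem sum_cutXY_add_sum_restCorr :
    ∑ c ∈ range (s + 1), ∑ j ∈ range (r + 1), ∑ i ∈ range (j + 1), ∑ x ∈ range c,
      W.cutXY r s v c j i x +
    ∑ c ∈ range (s + 1), ∑ j ∈ range (r + 1), ∑ c' ∈ range (s - c), ∑ j' ∈ range (r - j + 1),
      W.restCorr r s v c j c' j' = 0 := by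
  have h : ∑ c ∈ range (s + 1), ∑ j ∈ range (r + 1), ∑ i ∈ range (j + 1), ∑ x ∈ range c,
      W.cutXY r s v c j i x = ∑ x ∈ range (s + 1), ∑ c' ∈ range (s - x), ∑ i ∈ range (r + 1),
        ∑ a ∈ range (r - i + 1), W.cutXY r s v (x + c' + 1) (i + a) i x := by
    rw [← sum_range_triangle_lt s fun c x => ∑ i ∈ range (r + 1),
      ∑ a ∈ range (r - i + 1), W.cutXY r s v c (i + a) i x]
    refine sum_congr rfl fun c _ => ?_
    rw [sum_range_triangle r fun j i => ∑ x ∈ range c, W.cutXY r s v c j i x,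
      sum_comm (s := range c)]
    exact sum_congr rfl fun i _ => sum_comm
  rw [h, ← sum_add_distrib]
  refine sum_eq_zero fun x hx => ?_
  rw [sum_comm (s := range (r + 1)), ← sum_add_distrib]
  refine sum_eq_zero fun c hc => ?_
  rw [← sum_add_distrib]
  refine sum_eq_zero fun i hi => ?_
  rw [← sum_add_distrib]
  refine sum_eq_zero fun a ha => ?_
  rw [mem_range] at hx hc hi ha
  obtain ⟨m, rfl⟩ : ∃ m, r = i + a + m := ⟨r - (i + a), by omega⟩
  rw [cutXY, restCorr, mul_assoc, head, rest]
  have h1 : next (i + a + m) v (i + a) (x + c + 1) = (next (i + a + m) v i x).comp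
      ((shift a).comp ((jump (m + 1) c).comp (skip (m + 1)))) := by
    refine OrderHom.ext _ _ (funext fun k => congrArg v ?_)
    simp only [OrderHom.comp_coe, Function.comp_apply, shift_apply, jump_apply, skip_apply]
    split_ifs <;> omega
  have h2 : W.L (i + a - i) (x + c + 1 - x) (v.comp (shift i))
      (v.comp (shift (i + a + m + x + 1))) =
      W.L a (c + 1) (next (i + a + m) v i x)
        ((next (i + a + m) v i x).comp (shift (i + a + m - i + 1))) := by
    rw [show i + a - i = a by omega, show x + c + 1 - x = c + 1 by omega]
    refine W.L_congr _ _ _ _ _ _ (fun k hk => congrArg v ?_) fun k _ => congrArg v ?_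
    · simp only [OrderHom.comp_coe, Function.comp_apply, shift_apply, jump_apply]
      split_ifs <;> omega
    · simp only [OrderHom.comp_coe, Function.comp_apply, shift_apply, jump_apply]
      split_ifs <;> omega
  rw [h1, h2, show i + a + m - i + 1 - a = m + 1 by omega,
    show i + a + m - (i + a) = m by omega, show i + a + m - i = a + m by omega,
    show i + a - i = a by omega, show s - (x + c + 1) = s - x - 1 - c by omega, ← add_smul,
    neg_one_pow_add_eq_zero c 0 (by ring), zero_smul]

/-- When the rest is split in two, the head joins the left piece. Over all heads, these products are
the recursive expansion of `E r (k + 1) v`. -/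
theorem sum_restCut :
    ∑ c ∈ range (s + 1), ∑ j ∈ range (r + 1), ∑ k ∈ range (s - c), W.restCut r s v c j k =
    ∑ k ∈ range s, (-1 : R) ^ (r + (k + 1)) •
      (W.E r (k + 1) v * W.E 0 (s - k) (v.comp (shift (r + (k + 1))))) := by
  simp only [sum_comm (s := range (r + 1))]
  rw [sum_range_diagonal s (fun c k => ∑ j ∈ range (r + 1), W.restCut r s v c j k)]
  refine sum_congr rfl fun k hk => ?_
  simp only [E_succ, smul_sum, sum_mul]
  refine sum_congr rfl fun c hc => sum_congr rfl fun j hj => ?_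
  rw [mem_range] at hc hj
  obtain ⟨m, rfl⟩ : ∃ m, r = j + m := ⟨r - j, by omega⟩
  obtain ⟨l, rfl⟩ : ∃ l, k = c + l := ⟨k - c, by omega⟩
  rw [restCut, smul_mul_assoc, smul_smul, ← pow_add, mul_assoc, head, next]
  rw [show j + m - j = m by omega, show c + l - c = l by omega,
    show s - c - l = s - (c + l) by omega]
  congr 1
  · exact neg_one_pow_eq 0 0 (by ring)
  congr 3
  refine OrderHom.ext _ _ (funext fun k => congrArg v ?_)
  simp only [OrderHom.comp_coe, Function.comp_apply, shift_apply, jump_apply]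
  split_ifs <;> omega

end boundary

/-- The boundary of `L r 0`. -/
theorem d_E_zero (r : ℕ) (v : ℕ →o ℕ) : W.d (W.E r 0 v) =
    ∑ i ∈ range (r - 1), (-1 : R) ^ i • W.E (r - 1) 0 (v.comp (skip (i + 1))) +
    ∑ i ∈ range r, (-1 : R) ^ i • (W.L i 0 v (v.comp (shift r)) *
      W.E (r - i) 0 (v.comp (shift i))) := by
  rw [E_zero, W.d_L, range_eq_empty_iff.mpr (by omega : 0 - 1 = 0), sum_empty, add_zero,
    sum_range_succ _ r]
  simp only [zero_add, range_one, sum_singleton, add_zero, Nat.sub_self, W.L_zero, mul_zero,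
    smul_zero, E_zero]
  congr 1
  · refine sum_congr rfl fun i hi => ?_
    rw [mem_range] at hi
    congr 1
    refine W.L_congr _ _ _ _ _ _ (fun _ _ => rfl) fun k _ => congrArg v ?_
    simp only [shift_apply, skip_apply]
    split_ifs <;> omega
  · refine sum_congr rfl fun i hi => ?_
    rw [mem_range] at hi
    congr 2
    refine W.L_congr _ _ _ _ _ _ (fun _ _ => rfl) fun k _ => congrArg v ?_
    simp only [shift_apply]
    omega

theorem d_head (r : ℕ) (v : ℕ →o ℕ) (j c : ℕ) : W.d (W.head r v j c) =
    ∑ i ∈ range (j - 1), (-1 : R) ^ i •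
      W.L (j - 1) (c + 1) (v.comp (skip (i + 1))) (v.comp (shift r)) +
    ∑ x ∈ range c, (-1 : R) ^ (j + x) • W.L j c v ((v.comp (shift r)).comp (skip (x + 1))) +
    (∑ i ∈ range (j + 1), (-1 : R) ^ i • (W.L i 0 v (v.comp (shift r)) *
        W.L (j - i) (c + 1) (v.comp (shift i)) (v.comp (shift r))) +
      ∑ i ∈ range (j + 1), (-1 : R) ^ (i + (c + 1) + (j - i) * (c + 1)) •
        (W.L i (c + 1) v (v.comp (shift r)) *
          W.L (j - i) 0 (v.comp (shift i)) (v.comp (shift (r + c + 1)))) +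
      ∑ i ∈ range (j + 1), ∑ x ∈ range c, (-1 : R) ^ (i + (x + 1) + (j - i) * (x + 1)) •
        (W.L i (x + 1) v (v.comp (shift r)) *
          W.L (j - i) (c - x) (v.comp (shift i)) (v.comp (shift (r + x + 1))))) := by
  have hs : ∀ b, (v.comp (shift r)).comp (shift b) = v.comp (shift (r + b)) := fun b =>
    OrderHom.ext _ _ (funext fun k => congrArg v (by simp; omega))
  rw [head, W.d_L, Nat.add_sub_cancel, ← sum_add_distrib, ← sum_add_distrib]
  congr 1
  refine sum_congr rfl fun i _ => ?_
  -- The values b = c + 1 and b = 0 are taken out of the sum over the cuts of the block; they give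
  -- the cuts after and before the whole block.
  rw [sum_range_succ, sum_range_succ']
  simp only [hs, add_zero, mul_zero, Nat.sub_zero, Nat.add_sub_add_right, Nat.sub_self]
  simp only [← add_assoc]
  abel

/-- The terms are: deletion of an inner pending vertex, deletion of an inner vertex still to be
read, detachment of an initial piece of the pending chain, splitting at v (r + k), and `corr`. Even
for r = 0 the induction passes through words with a longer pending chain, so the formula has to
include the detachments and `corr`; both vanish when nothing beyond v 0 is pending. -/
theorem d_E (r s : ℕ) (v : ℕ →o ℕ) : W.d (W.E r s v) =
    ∑ i ∈ range (r - 1), (-1 : R) ^ i • W.E (r - 1) s (v.comp (skip (i + 1))) +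
    ∑ x ∈ range (s - 1), (-1 : R) ^ (r + x) • W.E r (s - 1) (v.comp (skip (r + x + 1))) +
    ∑ i ∈ range r, (-1 : R) ^ i • (W.L i 0 v (v.comp (shift r)) *
      W.E (r - i) s (v.comp (shift i))) +
    ∑ k ∈ range s, (-1 : R) ^ (r + k) • (W.E r k v * W.E 0 (s - k) (v.comp (shift (r + k)))) +
    W.corr r s v := by
  induction s using Nat.strong_induction_on generalizing r v with
  | _ s ih =>
  cases s with
  | zero =>
    rw [d_E_zero]
    simp [corr]
  | succ s =>
    have key : ∀ c ∈ range (s + 1), ∀ j ∈ range (r + 1),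
        W.d ((-1 : R) ^ (c * (r - j)) • (W.head r v j c * W.rest r s v j c)) =
        (∑ i ∈ range (j - 1), W.faceX r s v c j i + ∑ x ∈ range c, W.faceY r s v c j x +
          (∑ i ∈ range (j + 1), W.cutX r s v c j i + ∑ i ∈ range (j + 1), W.cutY r s v c j i +
          ∑ i ∈ range (j + 1), ∑ x ∈ range c, W.cutXY r s v c j i x)) +
        (∑ i ∈ range (r - j), W.restFaceX r s v c j i +
          ∑ x ∈ range (s - c - 1), W.restFaceY r s v c j x +
          ∑ a ∈ range (r - j + 1), W.restCutX r s v c j a +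
          ∑ k ∈ range (s - c), W.restCut r s v c j k +
          ∑ c' ∈ range (s - c), ∑ j' ∈ range (r - j + 1), W.restCorr r s v c j c' j') := by
      intro c hc j hj
      rw [mem_range] at hc hj
      rw [map_smul, W.d_mul, smul_add, d_head]
      congr 1
      · simp only [add_mul, sum_mul, smul_add, smul_sum, smul_mul_assoc, smul_smul, ← pow_add]
        rfl
      · have hsg : W.sg (W.head r v j c) = (-1 : R) ^ (j + c) • W.head r v j c := by
          rw [head, W.sg_L, neg_one_pow_eq (R := R) (m := j + (c + 1) + 1) (n := j + c) 0 1
            (by ring)]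
        rw [hsg, rest, ih _ (by omega), smul_mul_assoc, smul_smul, ← pow_add, corr]
        simp only [mul_add, mul_sum, smul_add, smul_sum, mul_smul_comm, smul_smul, ← pow_add,
          Nat.add_sub_cancel]
        rfl
    rw [E_succ, map_sum]
    refine (sum_congr rfl fun c hc => (map_sum W.d _ _).trans (sum_congr rfl (key c hc))).trans ?_
    have e1 := W.sum_faceX_add_sum_restFaceX r s v
    have e2 := W.sum_faceY_add_sum_restFaceY r s v
    have e3 := W.sum_cutX r s v
    have e4 := W.sum_cutY_add_sum_restCutX r s v
    have e5 := W.sum_cutXY_add_sum_restCorr r s v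
    have e6 := W.sum_restCut r s v
    -- The splitting with k = 0 comes from `sum_cutX`, those with k > 0 from `sum_restCut`.
    have e7 := sum_range_succ' (fun k => (-1 : R) ^ (r + k) •
      (W.E r k v * W.E 0 (s + 1 - k) (v.comp (shift (r + k))))) s
    simp only [Nat.add_sub_add_right, Nat.sub_zero, add_zero] at e7
    rw [e7, ← e6, Nat.add_sub_cancel, ← e2]
    simp only [sum_add_distrib] at e1 e3 e4 e5 ⊢
    linear_combination (norm := abel) e1 + e3 + e4 + e5

/-- The boundary of the sum over all words from `v 0` to `v n`. -/
theorem d_E_zero_left (n : ℕ) (v : ℕ →o ℕ) : W.d (W.E 0 n v) =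
    ∑ i ∈ range (n - 1), (-1 : R) ^ i • W.E 0 (n - 1) (v.comp (skip (i + 1))) +
    ∑ k ∈ range (n + 1), (-1 : R) ^ k • (W.E 0 k v * W.E 0 (n - k) (v.comp (shift k))) := by
  rw [d_E, sum_range_succ, Nat.sub_self, E_zero_zero, mul_zero, smul_zero, add_zero]
  simp [corr]

end Letters

end DCSH

/-! ### Adding and removing the unit in dimension one. -/

namespace DCSH

/-- `1` if `n = 1`, and `0` otherwise. -/
def aug (A : Type*) [Ring A] (n : ℕ) : A := if n = 1 then 1 else 0

section Augment

open Finset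

variable {R A : Type*} [CommRing R] [Ring A] [Algebra R A]

theorem aug_eq_zero {n : ℕ} (h : n ≠ 1) : aug A n = 0 := if_neg h

theorem aug_one : aug A 1 = 1 := if_pos rfl

theorem sum_aug_mul (p q : ℕ) (F : ℕ → ℕ → A) :
    ∑ a ∈ range (p + 1), ∑ b ∈ range (q + 1), aug A (a + b) * F a b =
      (if p = 0 then 0 else F 1 0) + (if q = 0 then 0 else F 0 1) := by
  have h0 : ∀ a, ∑ b ∈ range (q + 1), aug A (a + 1 + b) * F (a + 1) b =
      if a = 0 then F 1 0 else 0 := by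
    intro a
    rw [sum_range_succ', sum_eq_zero fun b _ => by rw [aug_eq_zero (by omega), zero_mul]]
    split_ifs with h
    · subst h
      rw [aug_one, zero_add, one_mul]
    · rw [aug_eq_zero (by omega), zero_mul, zero_add]
  rw [sum_range_succ', sum_congr rfl fun a _ => h0 a]
  congr 1
  · cases p <;> simp
  · rw [sum_range_succ', aug_eq_zero (by omega), zero_mul, add_zero]
    cases q with
    | zero => simp
    | succ q =>
      rw [sum_range_succ', sum_eq_zero fun b _ => by rw [aug_eq_zero (by omega), zero_mul]]
      simp [aug_one]

theorem sum_mul_aug (p q : ℕ) (F : ℕ → ℕ → A) :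
    ∑ a ∈ range (p + 1), ∑ b ∈ range (q + 1), F a b * aug A (p - a + (q - b)) =
      (if p = 0 then 0 else F (p - 1) q) + (if q = 0 then 0 else F p (q - 1)) := by
  rw [← sum_range_reflect]
  simp only [← sum_range_reflect (fun b => F _ b * _)]
  -- The opposite algebra and the reflection of both summation ranges exchange the two factors, so
  -- the unit on the right is reduced to the unit on the left.
  have h := sum_aug_mul (A := Aᵐᵒᵖ) p q fun a b => MulOpposite.op (F (p - a) (q - b))
  apply_fun MulOpposite.unop at h
  simp only [Finset.unop_sum, MulOpposite.unop_mul, MulOpposite.unop_op, MulOpposite.unop_add] at h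
  have hu : ∀ n, (aug Aᵐᵒᵖ n).unop = aug A n := by
    intro n
    rw [aug, aug]
    split_ifs <;> rfl
  refine Eq.trans ?_ (h.trans ?_)
  · refine sum_congr rfl fun a ha => sum_congr rfl fun b hb => ?_
    rw [mem_range] at ha hb
    rw [hu, show p + 1 - 1 - a = p - a by omega, show q + 1 - 1 - b = q - b by omega,
      show p - (p - a) = a by omega, show q - (q - b) = b by omega]
  · congr 1
    · split_ifs <;> rfl
    · split_ifs <;> rfl

/-- Adding the unit in total degree `1` makes the outer faces cancel. -/
theorem augment (S : ℕ → ℕ → (ℕ →o ℕ) → (ℕ →o ℕ) → A)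
    (hS : ∀ p q f f' g g', (∀ i ≤ p, f i = f' i) → (∀ i ≤ q, g i = g' i) →
      S p q f g = S p q f' g') (p q : ℕ) (f g : ℕ →o ℕ) :
    ∑ i ∈ range (p - 1), (-1 : R) ^ i •
      (S (p - 1) q (f.comp (skip (i + 1))) g + aug A (p - 1 + q)) +
    ∑ i ∈ range (q - 1), (-1 : R) ^ (p + i) •
      (S p (q - 1) f (g.comp (skip (i + 1))) + aug A (p + (q - 1))) +
    ∑ a ∈ range (p + 1), ∑ b ∈ range (q + 1), (-1 : R) ^ (a + b + (p - a) * b) •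
      ((S a b f g + aug A (a + b)) *
        (S (p - a) (q - b) (f.comp (shift a)) (g.comp (shift b)) + aug A (p - a + (q - b)))) =
    - (if p = 0 then 0 else
        ∑ i ∈ range (p + 1), (-1 : R) ^ i • S (p - 1) q (f.comp (skip i)) g) -
      (if q = 0 then 0 else
        ∑ i ∈ range (q + 1), (-1 : R) ^ (p + i) • S p (q - 1) f (g.comp (skip i))) +
    ∑ a ∈ range (p + 1), ∑ b ∈ range (q + 1), (-1 : R) ^ (a + b + (p - a) * b) •
      (S a b f g * S (p - a) (q - b) (f.comp (shift a)) (g.comp (shift b))) := by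
  -- The unit on the left replaces an initial edge in one direction. Since `shift 1` agrees with
  -- `skip 0`, what remains is the face opposite to the first vertex.
  have h1 : ∑ a ∈ range (p + 1), ∑ b ∈ range (q + 1), (-1 : R) ^ (a + b + (p - a) * b) •
      (aug A (a + b) * S (p - a) (q - b) (f.comp (shift a)) (g.comp (shift b))) =
      (if p = 0 then 0 else - S (p - 1) q (f.comp (skip 0)) g) -
        (if q = 0 then 0 else (-1 : R) ^ p • S p (q - 1) f (g.comp (skip 0))) := by
    simp only [← mul_smul_comm]
    rw [sum_aug_mul, sub_eq_add_neg]
    congr 1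
    · split_ifs
      · rfl
      · rw [add_zero, mul_zero, add_zero, pow_one, neg_one_smul]
        rfl
    · split_ifs
      · rw [neg_zero]
      · rw [Nat.sub_zero, mul_one, zero_add, pow_add, pow_one, neg_one_mul, neg_smul]
        rfl
  -- The unit on the right replaces a final edge, which leaves the face opposite to the last vertex.
  have h2 : ∑ a ∈ range (p + 1), ∑ b ∈ range (q + 1), (-1 : R) ^ (a + b + (p - a) * b) •
      (S a b f g * aug A (p - a + (q - b))) =
      - (if p = 0 then 0 else (-1 : R) ^ p • S (p - 1) q (f.comp (skip p)) g) -
        (if q = 0 then 0 else (-1 : R) ^ (p + q) • S p (q - 1) f (g.comp (skip q))) := by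
    simp only [← smul_mul_assoc]
    rw [sum_mul_aug, sub_eq_add_neg]
    congr 1
    · split_ifs with hp
      · rw [neg_zero]
      · obtain ⟨p, rfl⟩ : ∃ p', p = p' + 1 := ⟨p - 1, by omega⟩
        rw [Nat.add_sub_cancel, ← neg_smul,
          neg_one_pow_eq (R := R) (m := p + q + (p + 1 - p) * q) (n := p) 0 q
            (by rw [Nat.add_sub_cancel_left]; ring), pow_succ, mul_neg_one, neg_neg]
        congr 1
        exact hS _ _ _ _ _ _ (fun i hi => congrArg f (by simp; omega)) fun i _ => rfl
    · split_ifs with hq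
      · rw [neg_zero]
      · obtain ⟨q, rfl⟩ : ∃ q', q = q' + 1 := ⟨q - 1, by omega⟩
        rw [Nat.add_sub_cancel, ← neg_smul, Nat.sub_self, zero_mul, add_zero, ← add_assoc,
          pow_succ, mul_neg_one, neg_neg]
        congr 1
        exact hS _ _ _ _ _ _ (fun i hi => rfl) fun i hi => congrArg g (by simp; omega)
  -- The purely scalar terms can be nonzero only for p + q = 2. There the inner face cancels the
  -- product of two units, or, when p = q = 1, the two products of units cancel each other.
  have h3 : ∑ i ∈ range (p - 1), (-1 : R) ^ i • aug A (p - 1 + q) +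
      ∑ i ∈ range (q - 1), (-1 : R) ^ (p + i) • aug A (p + (q - 1)) +
      ∑ a ∈ range (p + 1), ∑ b ∈ range (q + 1), (-1 : R) ^ (a + b + (p - a) * b) •
        (aug A (a + b) * aug A (p - a + (q - b))) = 0 := by
    simp only [← mul_smul_comm]
    rw [sum_aug_mul]
    by_cases h : p + q = 2
    · obtain ⟨rfl, rfl⟩ | ⟨rfl, rfl⟩ | ⟨rfl, rfl⟩ :
          p = 0 ∧ q = 2 ∨ p = 1 ∧ q = 1 ∨ p = 2 ∧ q = 0 := by omega
      · simp [aug_one]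
      · simp [aug_one]
      · simp [aug_one]
    · have e1 : ∑ i ∈ range (p - 1), (-1 : R) ^ i • aug A (p - 1 + q) = 0 :=
        sum_eq_zero fun i hi => by
          rw [mem_range] at hi
          rw [aug_eq_zero (by omega), smul_zero]
      have e2 : ∑ i ∈ range (q - 1), (-1 : R) ^ (p + i) • aug A (p + (q - 1)) = 0 :=
        sum_eq_zero fun i hi => by
          rw [mem_range] at hi
          rw [aug_eq_zero (by omega), smul_zero]
      rw [e1, e2]
      split_ifs
      · simp
      · rw [aug_eq_zero (by omega)]; simp
      · rw [aug_eq_zero (by omega)]; simp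
      · rw [aug_eq_zero (by omega), aug_eq_zero (by omega)]; simp
  -- The first and the last face are separated from the inner ones, whose sign changes because the
  -- inner faces are indexed from 0 on the other side.
  have h4 : (if p = 0 then 0 else
        ∑ i ∈ range (p + 1), (-1 : R) ^ i • S (p - 1) q (f.comp (skip i)) g) =
      - ∑ i ∈ range (p - 1), (-1 : R) ^ i • S (p - 1) q (f.comp (skip (i + 1))) g +
      (if p = 0 then 0 else (-1 : R) ^ p • S (p - 1) q (f.comp (skip p)) g) -
      (if p = 0 then 0 else - S (p - 1) q (f.comp (skip 0)) g) := by
    cases p with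
    | zero => simp
    | succ p =>
      rw [if_neg (by omega), if_neg (by omega), if_neg (by omega), sum_range_succ, sum_range_succ',
        Nat.add_sub_cancel]
      simp only [pow_succ, mul_neg_one, neg_smul, sum_neg_distrib, pow_zero, one_smul]
      abel
  have h5 : (if q = 0 then 0 else
        ∑ i ∈ range (q + 1), (-1 : R) ^ (p + i) • S p (q - 1) f (g.comp (skip i))) =
      - ∑ i ∈ range (q - 1), (-1 : R) ^ (p + i) • S p (q - 1) f (g.comp (skip (i + 1))) +
      (if q = 0 then 0 else (-1 : R) ^ (p + q) • S p (q - 1) f (g.comp (skip q))) +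
      (if q = 0 then 0 else (-1 : R) ^ p • S p (q - 1) f (g.comp (skip 0))) := by
    cases q with
    | zero => simp
    | succ q =>
      rw [if_neg (by omega), if_neg (by omega), if_neg (by omega), sum_range_succ, sum_range_succ',
        Nat.add_sub_cancel]
      simp only [← add_assoc, pow_succ, mul_neg_one, neg_smul, sum_neg_distrib, add_zero]
      abel
  rw [h4, h5]
  simp only [add_mul, mul_add, smul_add, sum_add_distrib]
  linear_combination (norm := abel) h1 + h2 + h3

end Augment

/-! ### Degenerate words, the linear part and degrees. -/

namespace Letters

open Finset

variable {R A : Type*} [CommRing R] [Ring A] [Algebra R A]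

/-- The system of letters obtained by adding the unit in total degree `1` to a family whose
differential consists of all faces and of all decompositions. -/
def ofAugment (d sg : A →ₗ[R] A) (d_mul : ∀ a b, d (a * b) = d a * b + sg a * d b)
    (sg_mul : ∀ a b, sg (a * b) = sg a * sg b) (sg_one : sg 1 = 1)
    (S : ℕ → ℕ → (ℕ →o ℕ) → (ℕ →o ℕ) → A)
    (S_congr : ∀ p q f f' g g', (∀ i ≤ p, f i = f' i) → (∀ i ≤ q, g i = g' i) →
      S p q f g = S p q f' g') (S_zero : ∀ f g, S 0 0 f g = 0)
    (sg_S : ∀ p q f g, sg (S p q f g) = (-1 : R) ^ (p + q + 1) • S p q f g)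
    (d_S : ∀ p q f g, d (S p q f g) = - (if p = 0 then 0 else
        ∑ i ∈ range (p + 1), (-1 : R) ^ i • S (p - 1) q (f.comp (skip i)) g) -
      (if q = 0 then 0 else
        ∑ i ∈ range (q + 1), (-1 : R) ^ (p + i) • S p (q - 1) f (g.comp (skip i))) +
    ∑ a ∈ range (p + 1), ∑ b ∈ range (q + 1), (-1 : R) ^ (a + b + (p - a) * b) •
      (S a b f g * S (p - a) (q - b) (f.comp (shift a)) (g.comp (shift b)))) :
    Letters R A where
  d := d
  sg := sg
  d_mul := d_mul
  sg_mul := sg_mul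
  L p q f g := S p q f g + aug A (p + q)
  L_congr p q f f' g g' hf hg := by rw [S_congr p q f f' g g' hf hg]
  L_zero f g := by rw [S_zero, aug_eq_zero (by omega), add_zero]
  sg_L p q f g := by
    rw [map_add, sg_S, smul_add]
    congr 1
    by_cases h : p + q = 1
    · rw [h, aug_one, sg_one]
      simp
    · rw [aug_eq_zero h, map_zero, smul_zero]
  d_L p q f g := by
    have d_one : d 1 = 0 := by simpa [sg_one] using d_mul 1 1
    rw [augment S S_congr, map_add, d_S]
    by_cases h : p + q = 1
    · rw [h, aug_one, d_one, add_zero]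
    · rw [aug_eq_zero h, map_zero, add_zero]

variable (W : Letters R A)

/-- The equal vertices v i and v (i + 1) lie together in the head or in the rest, and the factor
that contains them collapses to a scalar, which is zero unless its total dimension is one. If they
are pending or lie beyond the first block, that dimension is at least two. If they lie in the block,
only c = j = 0 survives; the letter is then 1, and the rest is a word on the unchanged sequence with
one more vertex pending, where induction applies. -/
theorem E_of_degenerate
    (hX : ∀ p q f g i, i < p → f i = f (i + 1) → W.L p q f g = aug A (p + q))
    (hY : ∀ p q f g i, i < q → g i = g (i + 1) → W.L p q f g = aug A (p + q))
    (r s : ℕ) (v : ℕ →o ℕ) (i : ℕ) (hi : i < r + s) (hv : v i = v (i + 1)) :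
    W.E r s v = aug A (r + s) := by
  induction s using Nat.strong_induction_on generalizing r v i with
  | _ s ih =>
  cases s with
  | zero => exact (W.E_zero r v).trans (hX r 0 _ _ i hi hv)
  | succ s =>
    have hterm : ∀ c ∈ range (s + 1), ∀ j ∈ range (r + 1), (-1 : R) ^ (c * (r - j)) •
        (W.L j (c + 1) v (v.comp (shift r)) *
          W.E (r - j + 1) (s - c) (v.comp ((shift j).comp (jump (r - j) c)))) =
        if c = 0 ∧ j = 0 then aug A (r + (s + 1)) else 0 := by
      intro c hc j hj
      rw [mem_range] at hc hj
      by_cases hir : i < r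
      · rw [aug_eq_zero (n := r + (s + 1)) (by omega), ite_self]
        by_cases hij : i < j
        · rw [hX j (c + 1) _ _ i hij hv, aug_eq_zero (by omega), zero_mul, smul_zero]
        · rw [ih (s - c) (by omega) (r - j + 1) _ (i - j) (by omega),
            aug_eq_zero (by omega), mul_zero, smul_zero]
          simp only [OrderHom.comp_coe, Function.comp_apply, shift_apply, jump_apply]
          rw [if_pos (by omega), if_pos (by omega), show i - j + j = i by omega,
            show i - j + 1 + j = i + 1 by omega]
          exact hv
      · by_cases hic : i < r + c + 1
        · rw [hY j (c + 1) _ _ (i - r) (by omega)]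
          · by_cases h0 : c = 0 ∧ j = 0
            · obtain ⟨rfl, rfl⟩ := h0
              rw [if_pos ⟨rfl, rfl⟩, zero_mul, pow_zero, one_smul, aug_one, one_mul,
                ih (s - 0) (by omega) (r - 0 + 1) _ i (by omega)]
              · congr 1
                omega
              · simp only [OrderHom.comp_coe, Function.comp_apply, shift_apply, jump_apply,
                  add_zero, ite_self]
                exact hv
            · rw [if_neg h0, aug_eq_zero (by omega), zero_mul, smul_zero]
          · simp only [OrderHom.comp_coe, Function.comp_apply, shift_apply]
            rw [show i - r + r = i by omega, show i - r + 1 + r = i + 1 by omega]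
            exact hv
        · rw [aug_eq_zero (n := r + (s + 1)) (by omega), ite_self,
            ih (s - c) (by omega) (r - j + 1) _ (i - j - c) (by omega),
            aug_eq_zero (by omega), mul_zero, smul_zero]
          simp only [OrderHom.comp_coe, Function.comp_apply, shift_apply, jump_apply]
          rw [if_neg (by omega), if_neg (by omega), show i - j - c + c + j = i by omega,
            show i - j - c + 1 + c + j = i + 1 by omega]
          exact hv
    rw [E_succ, sum_congr rfl fun c hc => sum_congr rfl (hterm c hc),
      sum_eq_single_of_mem 0 (by simp), sum_eq_single_of_mem 0 (by simp), if_pos ⟨rfl, rfl⟩]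
    · intro j _ hj
      rw [if_neg (by tauto)]
    · intro c _ hc
      exact sum_eq_zero fun j _ => if_neg (by tauto)

/-- The part of `E r s v` of word length at most `1`. -/
theorem E_linear (S : ℕ → ℕ → (ℕ →o ℕ) → (ℕ →o ℕ) → A)
    (hS : ∀ p q f g, W.L p q f g = S p q f g + aug A (p + q)) (H K : Submodule R A)
    (hHK : H ≤ K) (hKK : ∀ a ∈ K, ∀ b ∈ K, a * b ∈ H) (hSK : ∀ p q f g, S p q f g ∈ K)
    (r s : ℕ) (v : ℕ →o ℕ) :
    W.E r s v - (aug A (r + s) + ∑ l ∈ range (s + 1), S (r + l) (s - l) v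
      (v.comp (shift (r + l)))) ∈ H := by
  induction s using Nat.strong_induction_on generalizing r v with
  | _ s ih =>
  cases s with
  | zero =>
    rw [E_zero, hS]
    simp [add_comm]
  | succ s =>
    set lin : ℕ → ℕ → (ℕ →o ℕ) → A := fun r s v =>
      ∑ l ∈ range (s + 1), S (r + l) (s - l) v (v.comp (shift (r + l))) with hlin
    have hlinK : ∀ r s v, lin r s v ∈ K := fun r s v => sum_mem fun l _ => hSK _ _ _ _
    -- Modulo products of two nonscalar factors, a summand contributes only if one of its factors
    -- has total dimension one. For c = j = 0 the letter is replaced by 1, and the linear part of `E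
    -- (r + 1) s v` remains. For c = s and j = r the rest is replaced by 1, and the letter itself
    -- remains.
    have hterm : ∀ c ∈ range (s + 1), ∀ j ∈ range (r + 1), (-1 : R) ^ (c * (r - j)) •
        (W.L j (c + 1) v (v.comp (shift r)) *
          W.E (r - j + 1) (s - c) (v.comp ((shift j).comp (jump (r - j) c)))) -
        ((if c = 0 ∧ j = 0 then aug A (r + 1 + s) + lin (r + 1) s v else 0) +
          if c = s ∧ j = r then S r (s + 1) v (v.comp (shift r)) else 0) ∈ H := by
      intro c hc j hj
      rw [mem_range] at hc hj
      have hE := ih (s - c) (by omega) (r - j + 1) (v.comp ((shift j).comp (jump (r - j) c)))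
      set e := W.E (r - j + 1) (s - c) (v.comp ((shift j).comp (jump (r - j) c))) with he
      set l := lin (r - j + 1) (s - c) (v.comp ((shift j).comp (jump (r - j) c))) with hl
      set x := S j (c + 1) v (v.comp (shift r)) with hx
      change e - (aug A (r - j + 1 + (s - c)) + l) ∈ H at hE
      have h1 : (-1 : R) ^ (c * (r - j)) • (aug A (j + (c + 1)) * e) -
          (if c = 0 ∧ j = 0 then aug A (r + 1 + s) + lin (r + 1) s v else 0) ∈ H := by
        by_cases h0 : c = 0 ∧ j = 0
        · obtain ⟨rfl, rfl⟩ := h0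
          have hv : v.comp ((shift 0).comp (jump (r - 0) 0)) = v :=
            OrderHom.ext _ _ (funext fun k => congrArg v (by simp))
          rw [if_pos ⟨rfl, rfl⟩, zero_add, aug_one, one_mul, zero_mul, pow_zero, one_smul]
          rw [hl, hv] at hE
          exact hE
        · rw [if_neg h0, aug_eq_zero (by omega)]
          simp
      have h2 : (-1 : R) ^ (c * (r - j)) • (x * aug A (r - j + 1 + (s - c))) -
          (if c = s ∧ j = r then S r (s + 1) v (v.comp (shift r)) else 0) = 0 := by
        by_cases h0 : c = s ∧ j = r
        · obtain ⟨rfl, rfl⟩ := h0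
          rw [if_pos ⟨rfl, rfl⟩, Nat.sub_self, Nat.sub_self, mul_zero, zero_add, add_zero, aug_one,
            pow_zero, one_smul, mul_one, sub_self]
        · rw [if_neg h0, aug_eq_zero (by omega)]
          simp
      have h3 : x * (l + (e - (aug A (r - j + 1 + (s - c)) + l))) ∈ H :=
        hKK _ (hSK _ _ _ _) _ (add_mem (hlinK _ _ _) (hHK hE))
      rw [hS, ← hx]
      convert add_mem h1 (H.smul_mem ((-1 : R) ^ (c * (r - j))) h3) using 1
      refine sub_eq_zero.mp (Eq.trans ?_ h2)
      simp only [add_mul, mul_add, mul_sub, smul_add, smul_sub]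
      abel
    have hsum := sum_mem fun c hc => sum_mem (hterm c hc)
    simp only [sum_sub_distrib, sum_add_distrib] at hsum
    rw [← E_succ] at hsum
    have h1 : ∑ c ∈ range (s + 1), ∑ j ∈ range (r + 1),
        (if c = 0 ∧ j = 0 then aug A (r + 1 + s) + lin (r + 1) s v else 0) =
        aug A (r + 1 + s) + lin (r + 1) s v := by
      rw [sum_eq_single_of_mem 0 (by simp), sum_eq_single_of_mem 0 (by simp), if_pos ⟨rfl, rfl⟩]
      · exact fun j _ hj => if_neg (by tauto)
      · exact fun c _ hc => sum_eq_zero fun j _ => if_neg (by tauto)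
    have h2 : ∑ c ∈ range (s + 1), ∑ j ∈ range (r + 1),
        (if c = s ∧ j = r then S r (s + 1) v (v.comp (shift r)) else 0) =
        S r (s + 1) v (v.comp (shift r)) := by
      rw [sum_eq_single_of_mem s (by simp), sum_eq_single_of_mem r (by simp), if_pos ⟨rfl, rfl⟩]
      · exact fun j _ hj => if_neg (by tauto)
      · exact fun c _ hc => sum_eq_zero fun j _ => if_neg (by tauto)
    rw [h1, h2] at hsum
    rw [sum_range_succ' _ (s + 1), ← add_assoc, show r + (s + 1) = r + 1 + s by omega]
    simpa only [hlin, Nat.add_sub_add_right, ← add_assoc, add_right_comm r _ 1, add_zero,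
      Nat.sub_zero] using hsum

/-- A letter of total dimension p + q has degree p + q - 1. Each non-final letter removes j + c + 1
steps from r + s but adds the step to the newly appended vertex, so every word has degree r + s - 1.
-/
theorem E_mem (G : ℕ → Submodule R A) (hmul : ∀ m n, ∀ a ∈ G m, ∀ b ∈ G n, a * b ∈ G (m + n))
    (hL : ∀ p q f g, W.L p q f g ∈ G (p + q - 1)) (r s : ℕ) (v : ℕ →o ℕ) :
    W.E r s v ∈ G (r + s - 1) := by
  induction s using Nat.strong_induction_on generalizing r v with
  | _ s ih =>
  cases s with
  | zero =>
    rw [E_zero]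
    exact hL _ _ _ _
  | succ s =>
    rw [E_succ]
    refine sum_mem fun c hc => sum_mem fun j hj => Submodule.smul_mem _ _ ?_
    rw [mem_range] at hc hj
    have h := hmul _ _ _ (hL j (c + 1) v (v.comp (shift r))) _ (ih (s - c) (by omega) (r - j + 1)
      (v.comp ((shift j).comp (jump (r - j) c))))
    -- The truncated subtractions are exact here, since the letter and the rest both have total
    -- dimension at least one.
    rwa [show j + (c + 1) - 1 + (r - j + 1 + (s - c) - 1) = r + (s + 1) - 1 by omega] at h

theorem map_E {A' : Type*} [Ring A'] [Algebra R A'] (W' : Letters R A') (φ : A →ₐ[R] A')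
    (α : ℕ →o ℕ) (hφ : ∀ p q f g, φ (W.L p q f g) = W'.L p q (α.comp f) (α.comp g))
    (r s : ℕ) (v : ℕ →o ℕ) : φ (W.E r s v) = W'.E r s (α.comp v) := by
  induction s using Nat.strong_induction_on generalizing r v with
  | _ s ih =>
  cases s with
  | zero =>
    rw [E_zero, E_zero, hφ]
    rfl
  | succ s =>
    rw [E_succ, E_succ, map_sum]
    refine sum_congr rfl fun c hc => ?_
    rw [map_sum]
    refine sum_congr rfl fun j hj => ?_
    rw [map_smul, map_mul, hφ, ih _ (by omega)]
    rfl

/-- The sum over all words from `v 0` to `v n`, without its constant term. -/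
def T (n : ℕ) (v : ℕ →o ℕ) : A := W.E 0 n v - aug A n

/-- This is `augment` in the opposite direction. `E 0 n` has only inner faces, and removing the unit
in dimension one brings back the outer faces with the signs of the twisting equation. -/
theorem d_T (d_one : W.d 1 = 0) (n : ℕ) (v : ℕ →o ℕ) : W.d (W.T n v) =
    - (if n = 0 then 0 else
        ∑ i ∈ range (n + 1), (-1 : R) ^ i • W.T (n - 1) (v.comp (skip i))) +
    ∑ k ∈ range (n + 1), (-1 : R) ^ k • (W.T k v * W.T (n - k) (v.comp (shift k))) := by
  -- A family with one direction is regarded as a family with two by taking q = 0; its value for q >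
  -- 0 plays no role.
  have h := augment (R := R) (fun p q f _ => if q = 0 then W.T p f else 0)
    (fun p q f f' g g' hf _ => by
      split_ifs
      · rw [T, T, W.E_congr 0 p f f' (by simpa using hf)]
      · rfl) n 0 v v
  have hT : ∀ k w, W.T k w + aug A k = W.E 0 k w := fun k w => sub_add_cancel _ _
  simp only [if_true, add_zero, mul_zero, range_one, sum_singleton, hT,
    show 0 - 1 = 0 by omega, range_zero, sum_empty, zero_add, sub_zero] at h
  rw [← h, T, map_sub, d_E_zero_left]
  have h0 : W.d (aug A n) = 0 := by
    rw [aug]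
    split_ifs <;> simp [d_one]
  rw [h0, sub_zero]

end Letters

end DCSH

noncomputable section

namespace DCSH

open Finset WithConv

namespace Letters

variable {R A : Type*} [CommRing R] [Ring A] [Algebra R A] (W : Letters R A)

theorem T_congr (n : ℕ) (v w : ℕ →o ℕ) (h : ∀ i ≤ n, v i = w i) : W.T n v = W.T n w := by
  rw [T, T, W.E_congr 0 n v w (by simpa using h)]

theorem T_zero (v : ℕ →o ℕ) : W.T 0 v = 0 := by
  rw [T, E_zero_zero, aug_eq_zero (by omega), sub_zero]

theorem map_T {A' : Type*} [Ring A'] [Algebra R A'] (W' : Letters R A') (φ : A →ₐ[R] A')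
    (α : ℕ →o ℕ) (hφ : ∀ p q f g, φ (W.L p q f g) = W'.L p q (α.comp f) (α.comp g))
    (n : ℕ) (v : ℕ →o ℕ) : φ (W.T n v) = W'.T n (α.comp v) := by
  rw [T, T, map_sub, W.map_E W' φ α hφ]
  congr 1
  rw [aug, aug]
  split_ifs <;> simp

theorem sg_T (sg_one : W.sg 1 = 1) (n : ℕ) (v : ℕ →o ℕ) :
    W.sg (W.T n v) = (-1 : R) ^ (n + 1) • W.T n v := by
  rw [T, map_sub, sg_E, smul_sub, zero_add]
  congr 1
  by_cases h : n = 1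
  · subst h
    rw [aug_one, sg_one]
    simp
  · rw [aug_eq_zero h, map_zero, smul_zero]

theorem T_of_degenerate
    (hX : ∀ p q f g i, i < p → f i = f (i + 1) → W.L p q f g = aug A (p + q))
    (hY : ∀ p q f g i, i < q → g i = g (i + 1) → W.L p q f g = aug A (p + q))
    (n : ℕ) (v : ℕ →o ℕ) (i : ℕ) (hi : i < n) (hv : v i = v (i + 1)) : W.T n v = 0 := by
  rw [T, W.E_of_degenerate hX hY 0 n v i (by omega) hv, zero_add, sub_self]

end Letters

/-! ### Twisting cochains with values in the cobar construction. -/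

namespace ChainCoalg

variable {R : Type u} [CommRing R] (D : ChainCoalg.{u, v} R)

theorem mul_mem_cobarDeg (m n : ℕ) (a : D.Cobar) (ha : a ∈ D.cobarDeg m) (b : D.Cobar)
    (hb : b ∈ D.cobarDeg n) : a * b ∈ D.cobarDeg (m + n) := by
  have h : D.cobarDeg m * D.cobarDeg n ≤ D.cobarDeg (m + n) := by
    rw [cobarDeg, cobarDeg, Submodule.span_mul_span, Submodule.span_le]
    rintro _ ⟨_, ⟨l, hl, rfl, rfl⟩, _, ⟨l', hl', rfl, rfl⟩, rfl⟩
    refine Submodule.subset_span ⟨l ++ l', fun p hp => ?_, by simp, by simp⟩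
    rcases List.mem_append.mp hp with hp | hp
    · exact hl p hp
    · exact hl' p hp
  exact h (Submodule.mul_mem_mul ha hb)

theorem one_mem_cobarDeg : (1 : D.Cobar) ∈ D.cobarDeg 0 :=
  Submodule.subset_span ⟨[], by simp, rfl, rfl⟩

theorem sInv_mem_cobarDeg (n : ℕ) (x : D.carrier) (hx : x ∈ D.deg n) :
    D.sInv x ∈ D.cobarDeg (n - 1) := by
  cases n with
  | zero =>
    rw [D.sInv_zero hx]
    exact zero_mem _
  | succ n => exact Submodule.subset_span ⟨[(n, x)], by simpa using hx, by simp, by simp⟩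

/-- The words of length at least `1`. -/
def positive : Submodule R D.Cobar := LinearMap.range (TensorAlgebra.ι R (M := D.bar)) ⊔ D.higher

theorem sInv_mem_positive (x : D.carrier) : D.sInv x ∈ D.positive :=
  Submodule.mem_sup_left ⟨_, rfl⟩

theorem mul_mem_higher (a : D.Cobar) (ha : a ∈ D.positive) (b : D.Cobar) (hb : b ∈ D.positive) :
    a * b ∈ D.higher := by
  have hp : D.positive ≤ ⨆ k : ℕ, LinearMap.range (TensorAlgebra.ι R (M := D.bar)) ^ (k + 1) := by
    refine sup_le ?_ (iSup_le fun k => ?_)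
    · exact (pow_one (LinearMap.range (TensorAlgebra.ι R (M := D.bar)))).ge.trans
        (le_iSup (fun k : ℕ => LinearMap.range (TensorAlgebra.ι R (M := D.bar)) ^ (k + 1)) 0)
    · exact le_iSup (fun k : ℕ => LinearMap.range (TensorAlgebra.ι R (M := D.bar)) ^ (k + 1))
        (k + 1)
  have h : (⨆ k : ℕ, LinearMap.range (TensorAlgebra.ι R (M := D.bar)) ^ (k + 1)) *
      (⨆ k : ℕ, LinearMap.range (TensorAlgebra.ι R (M := D.bar)) ^ (k + 1)) ≤ D.higher := by
    rw [Submodule.iSup_mul]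
    refine iSup_le fun k => ?_
    rw [Submodule.mul_iSup]
    refine iSup_le fun l => ?_
    rw [← pow_add, show k + 1 + (l + 1) = k + l + 2 by ring]
    exact le_iSup (fun k : ℕ => LinearMap.range (TensorAlgebra.ι R (M := D.bar)) ^ (k + 2)) (k + l)
  exact h (Submodule.mul_mem_mul (hp ha) (hp hb))

variable {D} (C : ChainCoalg.{u, v} R)

/-- A twisting cochain `t : C → Ω D` whose part of word length `1` is `s⁻¹ f` exhibits `f` as a
DCSH map. -/
theorem isDCSH_of_twisting {f : C.carrier →ₗ[R] D.carrier} (hf : IsChainMap C D f)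
    (t : C.carrier →ₗ[R] D.Cobar) (t_zero : ∀ x ∈ C.deg 0, t x = 0)
    (t_mem : ∀ n, ∀ x ∈ C.deg (n + 1), t x ∈ D.cobarDeg n)
    (t_sgn : ∀ x, D.cobarSgn (t x) = - t (C.sgn x))
    (t_d : ∀ x, D.cobarD (t x) = - t (C.d x) +
      LinearMap.mul' R D.Cobar (TensorProduct.map (t ∘ₗ C.sgn) t (C.comul x)))
    (t_linear : ∀ x, t x - D.sInv (f x) ∈ D.higher) : IsDCSH C D f := by
  set ω : C.Cobar →ₐ[R] D.Cobar := TensorAlgebra.lift R ((C.deg 0).liftQ t t_zero) with hω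
  have ω_sInv : ∀ x, ω (C.sInv x) = t x := fun x => by
    rw [hω, sInv, LinearMap.comp_apply, TensorAlgebra.lift_ι_apply]
    rfl
  -- The differential is a derivation relative to the sign automorphism. Once ω commutes with the
  -- sign automorphisms, compatibility with the differentials passes to products and needs to be
  -- checked only on scalars and generators.
  have ω_sgn : ∀ z, ω (C.cobarSgn z) = D.cobarSgn (ω z) := by
    intro z
    refine C.cobar_induction (p := fun z => ω (C.cobarSgn z) = D.cobarSgn (ω z)) z
      (fun r => by simp) (fun x => ?_) (fun a b ha hb => by simp [ha, hb])
      (fun a b ha hb => by simp [ha, hb])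
    rw [cobarSgn_sInv, map_neg, ω_sInv, ω_sInv, t_sgn]
  have word : ∀ l : List (ℕ × C.carrier), (∀ p ∈ l, p.2 ∈ C.deg (p.1 + 1)) →
      ω (l.map fun p => C.sInv p.2).prod ∈ D.cobarDeg (l.map Prod.fst).sum := by
    intro l hl
    induction l with
    | nil => simpa using D.one_mem_cobarDeg
    | cons p l ih =>
      have hl' := List.forall_mem_cons.mp hl
      simp only [List.map_cons, List.prod_cons, List.sum_cons, map_mul, ω_sInv]
      exact D.mul_mem_cobarDeg _ _ _ (t_mem _ _ hl'.1) _ (ih hl'.2)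
  refine ⟨hf, ω, ⟨fun n z hz => ?_, fun z => ?_⟩, fun x => by rw [ω_sInv]; exact t_linear x⟩
  · refine Submodule.span_induction (p := fun z _ => ω z ∈ D.cobarDeg n) ?_ (by simp)
      (fun x y _ _ hx hy => by rw [map_add]; exact add_mem hx hy)
      (fun r x _ hx => by rw [map_smul]; exact Submodule.smul_mem _ _ hx) hz
    rintro _ ⟨l, hl, rfl, rfl⟩
    exact word l hl
  · refine C.cobar_induction (p := fun z => ω (C.cobarD z) = D.cobarD (ω z)) z
      (fun r => ?_) (fun x => ?_) (fun a b ha hb => by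
        simp only [cobarD_mul, map_add, map_mul, ha, hb, ω_sgn])
      (fun a b ha hb => by simp only [map_add, ha, hb])
    · have h1 : ∀ B : ChainCoalg.{u, v} R, B.cobarD (algebraMap R B.Cobar r) = 0 := by
        intro B
        change B.cobarMatrix (algebraMap R B.Cobar r) 0 1 = 0
        rw [AlgHom.commutes]
        simp [Matrix.algebraMap_matrix_apply]
      rw [AlgHom.commutes, h1, h1, map_zero]
    · rw [cobarD_sInv, ω_sInv, t_d, map_add, map_neg, ω_sInv]
      congr 1
      have h : ω.toLinearMap ∘ₗ LinearMap.mul' R C.Cobar ∘ₗ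
          TensorProduct.map (C.sInv ∘ₗ C.sgn) C.sInv =
          LinearMap.mul' R D.Cobar ∘ₗ TensorProduct.map (t ∘ₗ C.sgn) t := by
        refine TensorProduct.ext' fun x y => ?_
        simp [ω_sInv]
      exact LinearMap.congr_fun h (C.comul x)

end ChainCoalg

/-! ### The convolution algebra. -/

section Convolution

variable {R : Type u} [CommRing R] (D : ChainCoalg.{u, v} R)
  (P : Type*) [AddCommGroup P] [Module R P] [Coalgebra R P]

/-- The convolution algebra of a coalgebra with values in the cobar construction. -/
abbrev Conv : Type _ := WithConv (P →ₗ[R] D.Cobar)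

variable {D P}

/-- Postcomposition with a linear endomorphism of the cobar construction. -/
def convPost (h : D.Cobar →ₗ[R] D.Cobar) : Conv D P →ₗ[R] Conv D P where
  toFun f := toConv (h ∘ₗ f.ofConv)
  map_add' f g := by ext x; simp
  map_smul' r f := by ext x; simp

/-- The coalgebra `P` is regarded as concentrated in degree zero with zero differential, so a
convolution product is a finite sum of products of values and the derivation rule carries over
without further signs. -/
theorem convPost_cobarD_mul (f g : Conv D P) : convPost D.cobarD (f * g) =
    convPost D.cobarD f * g + convPost D.cobarSgn.toLinearMap f * convPost D.cobarD g := by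
  ext x
  have e := Coalgebra.Repr.arbitrary R x
  rw [WithConv.ofConv_add, LinearMap.add_apply, e.convMul_apply, e.convMul_apply]
  change D.cobarD ((f * g) x) = _
  rw [e.convMul_apply, map_sum, ← sum_add_distrib]
  exact sum_congr rfl fun i _ => D.cobarD_mul _ _

theorem convPost_cobarSgn_mul (f g : Conv D P) : convPost D.cobarSgn.toLinearMap (f * g) =
    convPost D.cobarSgn.toLinearMap f * convPost D.cobarSgn.toLinearMap g :=
  congrArg toConv (LinearMap.algHom_comp_convMul_distrib D.cobarSgn f g)

theorem convPost_cobarSgn_one :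
    convPost D.cobarSgn.toLinearMap (1 : Conv D P) = 1 := by
  ext x
  simp [convPost]

/-- Precomposition with a morphism of coalgebras. -/
def convPre {P' : Type*} [AddCommGroup P'] [Module R P'] [Coalgebra R P'] (h : P' →ₗc[R] P) :
    Conv D P →ₐ[R] Conv D P' :=
  AlgHom.ofLinearMap
    { toFun := fun f => toConv (f.ofConv ∘ₗ h.toLinearMap)
      map_add' := fun f g => by ext x; simp
      map_smul' := fun r f => by ext x; simp }
    (by ext x; simp)
    (fun f g => congrArg toConv (LinearMap.convMul_comp_coalgHom_distrib f g h))

/-- The elements of the convolution algebra with values in a given submodule. -/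
def Conv.valued (H : Submodule R D.Cobar) : Submodule R (Conv D P) where
  carrier := {f | ∀ z, f z ∈ H}
  add_mem' hf hg z := add_mem (hf z) (hg z)
  zero_mem' _ := zero_mem _
  smul_mem' r _ hf z := H.smul_mem r (hf z)

theorem Conv.mul_mem_valued (H K L : Submodule R D.Cobar)
    (h : ∀ a ∈ H, ∀ b ∈ K, a * b ∈ L) (f g : Conv D P) (hf : f ∈ Conv.valued H)
    (hg : g ∈ Conv.valued K) : f * g ∈ Conv.valued L := by
  intro z
  rw [(Coalgebra.Repr.arbitrary R z).convMul_apply]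
  exact sum_mem fun i _ => h _ (hf _) _ (hg _)

end Convolution

/-! ### Letters formed from faces of two simplices. -/

namespace ChainCoalg

variable {R : Type u} [CommRing R] (C D : ChainCoalg.{u, v} R)

/-- `z ↦ s⁻¹ z` for a tensor product of coalgebras. -/
def tensorSInv : C.carrier ⊗[R] D.carrier →ₗ[R] (C.tensor D).Cobar := (C.tensor D).sInv

theorem cobarD_tensorSInv (z : C.carrier ⊗[R] D.carrier) :
    (C.tensor D).cobarD (tensorSInv C D z) =
      - tensorSInv C D (tensorD C.toGrMod D.toGrMod C.d D.d z) +
      LinearMap.mul' R (C.tensor D).Cobar (TensorProduct.map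
        (tensorSInv C D ∘ₗ TensorProduct.map C.sgn D.sgn) (tensorSInv C D)
          (tensorComul C D z)) := by
  rw [← GrMod.tensor_sgn]
  exact (C.tensor D).cobarD_sInv z

theorem cobarSgn_tensorSInv (z : C.carrier ⊗[R] D.carrier) :
    (C.tensor D).cobarSgn (tensorSInv C D z) =
      - tensorSInv C D (TensorProduct.map C.sgn D.sgn z) := by
  rw [← GrMod.tensor_sgn]
  exact (C.tensor D).cobarSgn_sInv z

end ChainCoalg

/-- The faces of a simplex of a simplicial coalgebra, in the normalized chain complex `C`; `P` is
the coalgebra of simplices. The face with the vertices `f 0, …, f p` is `κ p f`. -/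
structure Probe {R : Type u} [CommRing R] (C : ChainCoalg.{u, v} R) (P : Type v)
    [AddCommGroup P] [Module R P] [Coalgebra R P] where
  κ : ℕ → (ℕ →o ℕ) → P →ₗ[R] C.carrier
  mem : ∀ p f x, κ p f x ∈ C.deg p
  congr : ∀ p f f', (∀ i ≤ p, f i = f' i) → κ p f = κ p f'
  d_succ : ∀ p f, C.d ∘ₗ κ (p + 1) f =
    ∑ i ∈ range (p + 2), (-1 : R) ^ i • κ p (f.comp (skip i))
  comul : ∀ p f, C.comul ∘ₗ κ p f = (∑ a ∈ range (p + 1),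
    TensorProduct.map (κ a f) (κ (p - a) (f.comp (shift a)))) ∘ₗ Coalgebra.comul
  degenerate : ∀ p f i, i < p → f i = f (i + 1) → κ p f = 0

namespace Probe

variable {R : Type u} [CommRing R] {C D : ChainCoalg.{u, v} R} {P Q : Type v}
  [AddCommGroup P] [Module R P] [Coalgebra R P] [AddCommGroup Q] [Module R Q] [Coalgebra R Q]
  (κ : Probe C P) (μ : Probe D Q)

theorem d_eq (p : ℕ) (f : ℕ →o ℕ) (x : P) : C.d (κ.κ p f x) = if p = 0 then 0 else
    ∑ i ∈ range (p + 1), (-1 : R) ^ i • κ.κ (p - 1) (f.comp (skip i)) x := by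
  cases p with
  | zero => exact C.d_zero _ (κ.mem 0 f x)
  | succ p =>
    rw [if_neg (by omega)]
    simpa using LinearMap.congr_fun (κ.d_succ p f) x

/-- The letter `s⁻¹ (x_f ⊗ y_g)`. -/
def letter (p q : ℕ) (f g : ℕ →o ℕ) : Conv (C.tensor D) (P ⊗[R] Q) :=
  toConv (ChainCoalg.tensorSInv C D ∘ₗ TensorProduct.map (κ.κ p f) (μ.κ q g))

theorem letter_tmul (p q : ℕ) (f g : ℕ →o ℕ) (x : P) (y : Q) :
    κ.letter μ p q f g (x ⊗ₜ y) = ChainCoalg.tensorSInv C D (κ.κ p f x ⊗ₜ[R] μ.κ q g y) := rfl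

/-- The convolution product uses the comultiplication of `P ⊗ Q`, which exchanges the middle factors
without a sign. The exponent collects a + b from the sign operator on the first letter and a' * b
from the Koszul exchange of the face of x in the second letter with the face of y in the first. -/
theorem letter_mul_letter (a b a' b' : ℕ) (f g f' g' : ℕ →o ℕ) (x : P) (y : Q) :
    LinearMap.mul' R (C.tensor D).Cobar
      (TensorProduct.map (ChainCoalg.tensorSInv C D ∘ₗ TensorProduct.map C.sgn D.sgn)
        (ChainCoalg.tensorSInv C D)
        (C.midSwap D.toGrMod C.carrier D.carrier
          (TensorProduct.map (κ.κ a f) (κ.κ a' f') (Coalgebra.comul (R := R) x) ⊗ₜ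
            TensorProduct.map (μ.κ b g) (μ.κ b' g') (Coalgebra.comul (R := R) y)))) =
    (-1 : R) ^ (a + b + a' * b) • (κ.letter μ a b f g * κ.letter μ a' b' f' g') (x ⊗ₜ y) := by
  have key : LinearMap.mul' R (C.tensor D).Cobar ∘ₗ
      TensorProduct.map (ChainCoalg.tensorSInv C D ∘ₗ TensorProduct.map C.sgn D.sgn)
        (ChainCoalg.tensorSInv C D) ∘ₗ C.midSwap D.toGrMod C.carrier D.carrier ∘ₗ
          TensorProduct.map (TensorProduct.map (κ.κ a f) (κ.κ a' f'))
            (TensorProduct.map (μ.κ b g) (μ.κ b' g')) =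
      (-1 : R) ^ (a + b + a' * b) • (LinearMap.mul' R (C.tensor D).Cobar ∘ₗ
        TensorProduct.map (κ.letter μ a b f g).ofConv (κ.letter μ a' b' f' g').ofConv ∘ₗ
          (TensorProduct.tensorTensorTensorComm R P P Q Q).toLinearMap) := by
    ext x x' y y'
    simp only [TensorProduct.AlgebraTensorModule.curry_apply, LinearMap.restrictScalars_self,
      TensorProduct.curry_apply, LinearMap.comp_apply, TensorProduct.map_tmul,
      C.midSwap_tmul D.toGrMod _ (κ.mem a' f' x') (μ.mem b g y), LinearMap.smul_apply,
      LinearEquiv.coe_coe, TensorProduct.tensorTensorTensorComm_tmul, letter_tmul, map_smul,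
      C.sgn_apply (κ.mem a f x), D.sgn_apply (μ.mem b g y), LinearMap.mul'_apply,
      TensorProduct.smul_tmul_smul, smul_mul_assoc, smul_smul]
    congr 1
    ring
  exact LinearMap.congr_fun key (Coalgebra.comul x ⊗ₜ Coalgebra.comul y)

/-- The differential of the tensor product gives all faces of the two simplices, the second family
with the sign (-1)^p. The quadratic part of the cobar differential gives the simultaneous
decompositions of both faces, with the signs of `letter_mul_letter`. -/
theorem d_letter (p q : ℕ) (f g : ℕ →o ℕ) :
    convPost (C.tensor D).cobarD (κ.letter μ p q f g) = - (if p = 0 then 0 else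
        ∑ i ∈ range (p + 1), (-1 : R) ^ i • κ.letter μ (p - 1) q (f.comp (skip i)) g) -
      (if q = 0 then 0 else
        ∑ i ∈ range (q + 1), (-1 : R) ^ (p + i) • κ.letter μ p (q - 1) f (g.comp (skip i))) +
    ∑ a ∈ range (p + 1), ∑ b ∈ range (q + 1), (-1 : R) ^ (a + b + (p - a) * b) •
      (κ.letter μ a b f g *
        κ.letter μ (p - a) (q - b) (f.comp (shift a)) (g.comp (shift b))) := by
  refine WithConv.ofConv_injective (TensorProduct.ext' fun x y => ?_)
  change (C.tensor D).cobarD (ChainCoalg.tensorSInv C D (κ.κ p f x ⊗ₜ[R] μ.κ q g y)) = _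
  rw [ChainCoalg.cobarD_tensorSInv, ChainCoalg.tensorD_tmul, d_eq, d_eq, map_add, neg_add,
    ChainCoalg.tensorComul, LinearMap.comp_apply, TensorProduct.map_tmul,
    ← LinearMap.comp_apply C.comul, ← LinearMap.comp_apply D.comul, κ.comul, μ.comul]
  simp only [WithConv.ofConv_add, WithConv.ofConv_sub, WithConv.ofConv_neg,
    LinearMap.add_apply, LinearMap.sub_apply, LinearMap.neg_apply, ← sub_eq_add_neg]
  congr 1
  · congr 1
    · congr 1
      split_ifs
      · simp
      · simp [TensorProduct.sum_tmul, ← TensorProduct.smul_tmul', letter_tmul]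
    · rw [C.sgn_apply (κ.mem p f x)]
      split_ifs
      · simp
      · simp only [TensorProduct.tmul_sum, TensorProduct.tmul_smul, ← TensorProduct.smul_tmul',
          map_sum, map_smul, smul_smul, WithConv.ofConv_sum, WithConv.ofConv_smul,
          LinearMap.sum_apply, LinearMap.smul_apply, letter_tmul, pow_add, mul_comm]
  · simp only [LinearMap.comp_apply, LinearMap.sum_apply, TensorProduct.sum_tmul,
      TensorProduct.tmul_sum, map_sum, letter_mul_letter]
    rw [sum_comm]
    simp

/-- The system of letters in the convolution algebra given by two simplices. -/
def letters : Letters R (Conv (C.tensor D) (P ⊗[R] Q)) :=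
  Letters.ofAugment (convPost (C.tensor D).cobarD) (convPost (C.tensor D).cobarSgn.toLinearMap)
    convPost_cobarD_mul convPost_cobarSgn_mul convPost_cobarSgn_one (κ.letter μ)
    (fun p q f f' g g' hf hg => by rw [letter, letter, κ.congr p f f' hf, μ.congr q g g' hg])
    (fun f g => by
      refine WithConv.ofConv_injective (TensorProduct.ext' fun x y => ?_)
      exact (C.tensor D).sInv_zero (C.tmul_mem D.toGrMod (add_zero 0) (κ.mem 0 f x)
        (μ.mem 0 g y)))
    (fun p q f g => by
      refine WithConv.ofConv_injective (TensorProduct.ext' fun x y => ?_)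
      change (C.tensor D).cobarSgn (ChainCoalg.tensorSInv C D (κ.κ p f x ⊗ₜ[R] μ.κ q g y)) = _
      rw [ChainCoalg.cobarSgn_tensorSInv, TensorProduct.map_tmul, C.sgn_apply (κ.mem p f x),
        D.sgn_apply (μ.mem q g y), TensorProduct.smul_tmul_smul, map_smul, ← neg_smul, ← pow_add,
        pow_succ, mul_neg_one]
      rfl)
    (κ.d_letter μ)

theorem letters_L (p q : ℕ) (f g : ℕ →o ℕ) :
    (κ.letters μ).L p q f g = κ.letter μ p q f g + aug _ (p + q) := rfl

theorem letters_degenerate_left (p q : ℕ) (f g : ℕ →o ℕ) (i : ℕ) (hi : i < p)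
    (hf : f i = f (i + 1)) : (κ.letters μ).L p q f g = aug _ (p + q) := by
  rw [letters_L, letter, κ.degenerate p f i hi hf, TensorProduct.map_zero_left,
    LinearMap.comp_zero, WithConv.toConv_zero, zero_add]

theorem letters_degenerate_right (p q : ℕ) (f g : ℕ →o ℕ) (i : ℕ) (hi : i < q)
    (hg : g i = g (i + 1)) : (κ.letters μ).L p q f g = aug _ (p + q) := by
  rw [letters_L, letter, μ.degenerate q g i hi hg, TensorProduct.map_zero_right,
    LinearMap.comp_zero, WithConv.toConv_zero, zero_add]

theorem letters_sg_one : (κ.letters μ).sg 1 = 1 := convPost_cobarSgn_one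

theorem letters_d_one : (κ.letters μ).d 1 = 0 := by
  have h := (κ.letters μ).d_mul 1 1
  rw [mul_one, mul_one, letters_sg_one, one_mul] at h
  simpa using h

theorem cobarSgn_T (n : ℕ) (v : ℕ →o ℕ) (z : P ⊗[R] Q) :
    (C.tensor D).cobarSgn ((κ.letters μ).T n v z) =
      (-1 : R) ^ (n + 1) • (κ.letters μ).T n v z :=
  congrArg (fun f : Conv (C.tensor D) (P ⊗[R] Q) => f z)
    ((κ.letters μ).sg_T (κ.letters_sg_one μ) n v)

/-- This is `d_T` evaluated at an element, with the convolution product unfolded so that the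
quadratic term has the form required of a twisting cochain. -/
theorem cobarD_T (n : ℕ) (v : ℕ →o ℕ) (z : P ⊗[R] Q) :
    (C.tensor D).cobarD ((κ.letters μ).T n v z) =
    - (if n = 0 then 0 else
        ∑ i ∈ range (n + 1), (-1 : R) ^ i • (κ.letters μ).T (n - 1) (v.comp (skip i)) z) +
    LinearMap.mul' R (C.tensor D).Cobar ((∑ k ∈ range (n + 1), (-1 : R) ^ k • TensorProduct.map
      ((κ.letters μ).T k v).ofConv ((κ.letters μ).T (n - k) (v.comp (shift k))).ofConv)
        (Coalgebra.comul z)) := by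
  refine (congrArg (fun f : Conv (C.tensor D) (P ⊗[R] Q) => f z)
    ((κ.letters μ).d_T (κ.letters_d_one μ) n v)).trans ?_
  rw [WithConv.ofConv_add, LinearMap.add_apply, WithConv.ofConv_neg, LinearMap.neg_apply,
    LinearMap.sum_apply, map_sum, WithConv.ofConv_sum, LinearMap.sum_apply]
  congr 1
  · split_ifs
    · simp
    · simp only [WithConv.ofConv_sum, LinearMap.sum_apply, WithConv.ofConv_smul,
        LinearMap.smul_apply]
  · refine sum_congr rfl fun k _ => ?_
    rw [LinearMap.smul_apply, map_smul]
    rfl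

theorem T_degenerate (n : ℕ) (v : ℕ →o ℕ) (i : ℕ) (hi : i < n) (hv : v i = v (i + 1))
    (z : P ⊗[R] Q) : (κ.letters μ).T n v z = 0 := by
  rw [Letters.T_of_degenerate _ (κ.letters_degenerate_left μ) (κ.letters_degenerate_right μ) n v
    i hi hv]
  rfl

theorem letter_mem (p q : ℕ) (f g : ℕ →o ℕ) (z : P ⊗[R] Q) :
    κ.letter μ p q f g z ∈ (C.tensor D).cobarDeg (p + q - 1) := by
  induction z using TensorProduct.induction_on with
  | zero => rw [map_zero]; exact zero_mem _
  | add x y hx hy => rw [map_add]; exact add_mem hx hy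
  | tmul x y =>
    exact (C.tensor D).sInv_mem_cobarDeg (p + q) _
      (C.tmul_mem D.toGrMod rfl (κ.mem p f x) (μ.mem q g y))

theorem T_mem (n : ℕ) (v : ℕ →o ℕ) (z : P ⊗[R] Q) :
    (κ.letters μ).T (n + 1) v z ∈ (C.tensor D).cobarDeg n := by
  have haug : ∀ m, aug (Conv (C.tensor D) (P ⊗[R] Q)) m ∈
      Conv.valued ((C.tensor D).cobarDeg (m - 1)) := by
    intro m
    by_cases hm : m = 1
    · subst hm
      intro z
      rw [aug_one]
      -- The unit of the convolution algebra is the counit followed by the inclusion of the scalars,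
      -- which have degree zero.
      change algebraMap R (C.tensor D).Cobar (Coalgebra.counit z) ∈ _
      rw [Algebra.algebraMap_eq_smul_one]
      exact Submodule.smul_mem _ _ (C.tensor D).one_mem_cobarDeg
    · rw [aug_eq_zero hm]
      exact zero_mem _
  have h := (κ.letters μ).E_mem (fun m => Conv.valued ((C.tensor D).cobarDeg m))
    (fun m k a ha b hb => Conv.mul_mem_valued _ _ _ ((C.tensor D).mul_mem_cobarDeg m k) a b ha hb)
    (fun p q f g => by
      rw [letters_L]
      exact add_mem (κ.letter_mem μ p q f g) (haug (p + q))) 0 (n + 1) v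
  rw [zero_add] at h
  exact sub_mem h (haug (n + 1)) z

theorem T_linear (n : ℕ) (v : ℕ →o ℕ) (z : P ⊗[R] Q) :
    (κ.letters μ).T n v z - ChainCoalg.tensorSInv C D ((∑ l ∈ range (n + 1), TensorProduct.map
      (κ.κ l v) (μ.κ (n - l) (v.comp (shift l)))) z) ∈ (C.tensor D).higher := by
  have h := (κ.letters μ).E_linear (κ.letter μ) (κ.letters_L μ)
    (Conv.valued (C.tensor D).higher) (Conv.valued (C.tensor D).positive)
    (fun f hf z => Submodule.mem_sup_right (hf z))
    (fun a ha b hb => Conv.mul_mem_valued _ _ _ (C.tensor D).mul_mem_higher a b ha hb)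
    (fun p q f g z => (C.tensor D).sInv_mem_positive _) 0 n v z
  convert h using 1
  rw [Letters.T, zero_add]
  simp only [zero_add, LinearMap.sum_apply, map_sum, WithConv.ofConv_sub, LinearMap.sub_apply,
    WithConv.ofConv_add, LinearMap.add_apply, WithConv.ofConv_sum, sub_sub]
  rfl

end Probe

end DCSH

end

noncomputable section

namespace DCSH

open Finset WithConv

/-! ### The twisting cochain of M ⊠ M'. -/

section Simplices

variable {R : Type u} [CommRing R]

/-- The operator `[p] → [N]`, `i ↦ min (f i) N`. -/
def op (N p : ℕ) (f : ℕ →o ℕ) : ⦋p⦌ ⟶ ⦋N⦌ :=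
  SimplexCategory.Hom.mk
    { toFun := fun i => ⟨min (f i) N, by have := min_le_right (f i) N; simp⟩
      monotone' := fun i j hij => by
        have : f i ≤ f j := f.monotone hij
        rw [Fin.le_def]
        simp only
        omega }

theorem op_val (N p : ℕ) (f : ℕ →o ℕ) (i : Fin (p + 1)) :
    (((op N p f).toOrderHom i : Fin (N + 1)) : ℕ) = min (f i) N := rfl

/-- The monotone map `i ↦ α (min i m)` on the natural numbers which extends the operator `α`. -/
def extend {m N : ℕ} (α : ⦋m⦌ ⟶ ⦋N⦌) : ℕ →o ℕ where
  toFun i := (α.toOrderHom ⟨min i m, by have := min_le_right i m; simp⟩ : Fin (N + 1))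
  monotone' i j hij := α.toOrderHom.monotone (by
    rw [Fin.le_def]
    simp only
    omega)

theorem extend_apply {m N : ℕ} (α : ⦋m⦌ ⟶ ⦋N⦌) (i : ℕ) (hi : i < m + 1) :
    extend α i = (α.toOrderHom ⟨i, hi⟩ : Fin (N + 1)) := by
  have : min i m = i := by omega
  change ((α.toOrderHom ⟨min i m, _⟩ : Fin (N + 1)) : ℕ) = _
  simp only [this]

/-- `extend α` truncates its argument at m just as `op m p f` truncates its values, so the identity
holds for every f, without a bound on its values. -/
theorem op_comp {m N : ℕ} (p : ℕ) (f : ℕ →o ℕ) (α : ⦋m⦌ ⟶ ⦋N⦌) :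
    op m p f ≫ α = op N p ((extend α).comp f) := by
  apply hom_ext_val
  intro i
  rw [comp_val, op_val]
  have h : (extend α).comp f i ≤ N := by
    have := (α.toOrderHom ⟨min (f i) m, by have := min_le_right (f i) m; simp⟩ : Fin (N + 1)).2
    exact Nat.le_of_lt_succ this
  rw [min_eq_left h]
  rfl

theorem comp_op {l p N : ℕ} (θ : ⦋l⦌ ⟶ ⦋p⦌) (f g : ℕ →o ℕ)
    (h : ∀ i : Fin (l + 1), f (θ.toOrderHom i : Fin (p + 1)) = g i) :
    θ ≫ op N p f = op N l g := by
  apply hom_ext_val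
  intro i
  rw [comp_val, op_val, op_val, h]

/-- Simplicial operators are morphisms of coalgebras, so the comultiplication may be applied in
level N first. The Alexander–Whitney formula then takes front and back faces of the face given by f,
which are the faces given by f and by its translates. -/
theorem act_comul (M : SimplicialObject (CoalgCat.{v} R)) {N p : ℕ} (f : ℕ →o ℕ) :
    normComul M ∘ₗ cls (under M) p ∘ₗ act (under M) (op N p f) =
    (∑ a ∈ range (p + 1), TensorProduct.map (cls (under M) a ∘ₗ act (under M) (op N a f))
      (cls (under M) (p - a) ∘ₗ act (under M) (op N (p - a) (f.comp (shift a))))) ∘ₗ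
        lev M N := by
  have h : awLevel (under M) (under M) p ∘ₗ
      TensorProduct.map (act (under M) (op N p f)) (act (under M) (op N p f)) =
      ∑ a ∈ range (p + 1), TensorProduct.map (cls (under M) a ∘ₗ act (under M) (op N a f))
        (cls (under M) (p - a) ∘ₗ act (under M) (op N (p - a) (f.comp (shift a)))) := by
    refine TensorProduct.ext' fun x y => ?_
    rw [LinearMap.comp_apply, TensorProduct.map_tmul, awLevel, LinearMap.sum_apply,
      LinearMap.sum_apply, Finset.Nat.sum_antidiagonal_eq_sum_range_succ_mk]
    refine sum_congr rfl fun a ha => ?_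
    rw [mem_range] at ha
    simp only [TensorProduct.map_tmul, LinearMap.comp_apply, act_act]
    rw [comp_op (seg p 0 a) f f, comp_op (seg p a (p - a)) f (f.comp (shift a))]
    · intro i
      have := i.2
      rw [seg_val]
      exact congrArg f (by simp; omega)
    · intro i
      have := i.2
      rw [seg_val]
      exact congrArg f (by omega)
  rw [← h, LinearMap.comp_assoc, ← lev_act]
  ext x
  exact normComul_cls M p _

theorem act_normD (X : SimplicialObject (ModuleCat.{v} R)) {N p : ℕ} (f : ℕ →o ℕ) :
    normD X ∘ₗ cls X (p + 1) ∘ₗ act X (op N (p + 1) f) =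
    ∑ i ∈ range (p + 2), (-1 : R) ^ i • (cls X p ∘ₗ act X (op N p (f.comp (skip i)))) := by
  refine LinearMap.ext fun x => ?_
  rw [LinearMap.comp_apply, LinearMap.comp_apply, normD_succ, altSum_eq, map_sum,
    LinearMap.sum_apply]
  refine sum_congr rfl fun i _ => ?_
  rw [map_smul, act_act, comp_op (face p i) f (f.comp (skip i))]
  · rfl
  · intro j
    rw [face_val]
    rfl

theorem norm_mem (X : SimplicialObject (ModuleCat.{v} R)) {B : Type*} [AddCommGroup B]
    [Module R B] (φ : (normGr X).carrier →ₗ[R] B) (H : Submodule R B)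
    (h : ∀ n z, φ (cls X n z) ∈ H) (x : (normGr X).carrier) : φ x ∈ H := by
  refine GrMod.hom_induction _ (p := fun x => φ x ∈ H) x (fun n x hx => ?_) ?_ fun x y hx hy => ?_
  · obtain ⟨z, rfl⟩ := exists_cls X hx
    exact h n z
  · rw [map_zero]
    exact zero_mem _
  · rw [map_add]
    exact add_mem hx hy

theorem map_normD_cls (X : SimplicialObject (ModuleCat.{v} R)) {B : Type*} [AddCommGroup B]
    [Module R B] (φ : (normGr X).carrier →ₗ[R] B) (n : ℕ) (x : X _⦋n + 1⦌) :
    φ (normD X (cls X (n + 1) x)) =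
      ∑ i ∈ range (n + 2), (-1 : R) ^ i • φ (cls X n (act X (face n i) x)) := by
  rw [normD_succ, altSum_eq, map_sum, map_sum]
  refine sum_congr rfl fun i _ => ?_
  rw [map_smul, map_smul]

/-- This evaluates the quadratic term of the twisting equation on a simplex. The sign operator acts
on the front face, whose degree is k. -/
theorem map_awLevel (X : SimplicialObject (ModuleCat.{v} R)) {B : Type*} [AddCommGroup B]
    [Module R B] (t : (normGr X).carrier →ₗ[R] B) (n : ℕ) (F G : ℕ → X _⦋n⦌ →ₗ[R] B)
    (hF : ∀ k ≤ n, t ∘ₗ piece X n 0 k = F k) (hG : ∀ k ≤ n, t ∘ₗ piece X n k (n - k) = G k) :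
    TensorProduct.map (t ∘ₗ (normGr X).sgn) t ∘ₗ awLevel X X n =
    ∑ k ∈ range (n + 1), (-1 : R) ^ k • TensorProduct.map (F k) (G k) := by
  refine TensorProduct.ext' fun x y => ?_
  rw [LinearMap.comp_apply, awLevel_eq, Finset.Nat.sum_antidiagonal_eq_sum_range_succ_mk,
    LinearMap.sum_apply, LinearMap.sum_apply, map_sum]
  refine sum_congr rfl fun k hk => ?_
  have hk : k ≤ n := by rw [mem_range] at hk; omega
  have h : (normGr X).sgn (piece X n 0 k x) = (-1 : R) ^ k • piece X n 0 k x :=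
    GrMod.sgn_apply _ (cls_mem X k _)
  rw [TensorProduct.map_tmul, TensorProduct.map_tmul, LinearMap.comp_apply, h, map_smul, ← hF k hk, ← hG k hk, LinearMap.smul_apply,
    TensorProduct.map_tmul, TensorProduct.smul_tmul']
  rfl

/-- The faces of the simplices in level `N` of a simplicial coalgebra. -/
def probe (M : SimplicialObject (CoalgCat.{v} R)) (hM : IsReduced M) (N : ℕ) :
    Probe (normCoalg M hM) (M _⦋N⦌) where
  κ p f := cls (under M) p ∘ₗ act (under M) (op N p f)
  mem p f x := cls_mem _ _ _
  congr p f f' h := by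
    have : op N p f = op N p f' := by
      apply hom_ext_val
      intro i
      rw [op_val, op_val, h i (Nat.le_of_lt_succ i.2)]
    rw [this]
  d_succ p f := act_normD (under M) f
  comul p f := act_comul M f
  degenerate p f i hi hf := by
    obtain ⟨p, rfl⟩ : ∃ p', p = p' + 1 := ⟨p - 1, by omega⟩
    refine LinearMap.ext fun x => ?_
    refine cls_degen (under M) (act_mem_degen (under M) (op N (p + 1) f) ⟨i, hi⟩ ?_ x)
    apply Fin.ext
    rw [op_val, op_val]
    simp [hf]

variable (M M' : SimplicialObject (CoalgCat.{v} R)) (hM : IsReduced M) (hM' : IsReduced M')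

/-- The letters on the simplices in level `N` of `M ⊠ M'`. -/
def boxLetters (N : ℕ) : Letters R (Conv ((normCoalg M hM).tensor (normCoalg M' hM'))
    (M _⦋N⦌ ⊗[R] M' _⦋N⦌)) :=
  (probe M hM N).letters (probe M' hM' N)

/-- A simplicial operator of `M ⊠ M'`, as a morphism of coalgebras. -/
def boxAct {m N : ℕ} (α : ⦋m⦌ ⟶ ⦋N⦌) :
    (M _⦋N⦌ ⊗[R] M' _⦋N⦌) →ₗc[R] (M _⦋m⦌ ⊗[R] M' _⦋m⦌) :=
  Coalgebra.TensorProduct.map (M.map α.op).toCoalgHom (M'.map α.op).toCoalgHom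

theorem convPre_letters {m N : ℕ} (α : ⦋m⦌ ⟶ ⦋N⦌) (p q : ℕ) (f g : ℕ →o ℕ) :
    convPre (boxAct M M' α) ((boxLetters M M' hM hM' m).L p q f g) =
      (boxLetters M M' hM hM' N).L p q ((extend α).comp f) ((extend α).comp g) := by
  rw [boxLetters, boxLetters, Probe.letters_L, Probe.letters_L, map_add]
  congr 1
  · refine WithConv.ofConv_injective (TensorProduct.ext' fun x y => ?_)
    have h1 : ∀ (M : SimplicialObject (CoalgCat.{v} R)) (hM : IsReduced M) (p : ℕ) (f : ℕ →o ℕ)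
        (x : M _⦋N⦌), (probe M hM m).κ p f ((M.map α.op).toCoalgHom x) =
          (probe M hM N).κ p ((extend α).comp f) x := by
      intro M hM p f x
      have := act_act (under M) (op m p f) α x
      rw [op_comp] at this
      exact congrArg (cls (under M) p) this
    exact congrArg (ChainCoalg.tensorSInv _ _) (congrArg₂ (fun a b => a ⊗ₜ[R] b)
      (h1 M hM p f x) (h1 M' hM' q g y))
  · rw [aug, aug]
    split_ifs <;> simp

/-- `T` of the image of a simplex under an operator is `T` of the simplex itself along the
corresponding vertices. This turns degeneracies, faces and segments alike into changes of the vertex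
sequence inside one level. -/
theorem T_boxAct {m N : ℕ} (α : ⦋m⦌ ⟶ ⦋N⦌) (n : ℕ) (v : ℕ →o ℕ) (z : M _⦋N⦌ ⊗[R] M' _⦋N⦌) :
    (boxLetters M M' hM hM' m).T n v (boxAct M M' α z) =
      (boxLetters M M' hM hM' N).T n ((extend α).comp v) z := by
  rw [← (boxLetters M M' hM hM' m).map_T (boxLetters M M' hM hM' N) (convPre (boxAct M M' α))
    (extend α) (convPre_letters M M' hM hM' α)]
  rfl

/-- The twisting cochain `A_N(M ⊠ M') → Ω (A_N(M) ⊗ A_N(M'))`. -/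
def boxTwisting : (normGr (under (box M M'))).carrier →ₗ[R]
    ((normCoalg M hM).tensor (normCoalg M' hM')).Cobar :=
  normLift (under (box M M'))
    (fun n => ((boxLetters M M' hM hM' n).T n OrderHom.id).ofConv) fun n => by
      cases n with
      | zero => exact bot_le
      | succ n =>
        refine iSup_le fun i => ?_
        rintro _ ⟨z, rfl⟩
        refine LinearMap.mem_ker.mpr ?_
        refine (T_boxAct M M' hM hM' (SimplexCategory.σ i) (n + 1) OrderHom.id z).trans ?_
        -- The degeneracy `σ i` takes the same value at i and i + 1, so the vertex sequence has two
        -- equal consecutive entries.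
        refine Probe.T_degenerate (probe M hM n) (probe M' hM' n) (n + 1) _ i i.2 ?_ z
        have hi := i.2
        simp only [OrderHom.comp_coe, Function.comp_apply, OrderHom.id_coe, id_eq]
        rw [extend_apply _ _ (by omega), extend_apply _ _ (by omega), σ_val, σ_val]
        simp

theorem boxTwisting_cls (n : ℕ) (z : M _⦋n⦌ ⊗[R] M' _⦋n⦌) :
    boxTwisting M M' hM hM' (cls (under (box M M')) n z) =
      (boxLetters M M' hM hM' n).T n OrderHom.id z :=
  normLift_cls (under (box M M')) _ _ n z

theorem boxTwisting_piece {n a b : ℕ} (z : M _⦋n⦌ ⊗[R] M' _⦋n⦌) (h : a + b ≤ n) :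
    boxTwisting M M' hM hM' (piece (under (box M M')) n a b z) =
      (boxLetters M M' hM hM' n).T b (shift a) z := by
  refine (boxTwisting_cls M M' hM hM' b _).trans
    ((T_boxAct M M' hM hM' (seg n a b) b OrderHom.id z).trans ?_)
  rw [Letters.T_congr _ b _ (shift a)]
  intro i hi
  simp only [OrderHom.comp_coe, Function.comp_apply, OrderHom.id_coe, id_eq, shift_apply]
  rw [extend_apply _ _ (by omega), seg_val]
  simp
  omega

theorem boxTwisting_zero (x) (hx : x ∈ (normGr (under (box M M'))).deg 0) :
    boxTwisting M M' hM hM' x = 0 := by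
  obtain ⟨z, rfl⟩ := exists_cls _ hx
  refine (boxTwisting_cls M M' hM hM' 0 z).trans ?_
  rw [Letters.T_zero]
  rfl

theorem boxTwisting_sgn (x : (normGr (under (box M M'))).carrier) :
    ((normCoalg M hM).tensor (normCoalg M' hM')).cobarSgn (boxTwisting M M' hM hM' x) =
      - boxTwisting M M' hM hM' ((normGr (under (box M M'))).sgn x) := by
  suffices h : ((normCoalg M hM).tensor (normCoalg M' hM')).cobarSgn.toLinearMap ∘ₗ
      boxTwisting M M' hM hM' =
      - (boxTwisting M M' hM hM' ∘ₗ (normGr (under (box M M'))).sgn) from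
    LinearMap.congr_fun h x
  refine norm_ext _ fun n z => ?_
  rw [LinearMap.neg_apply, LinearMap.comp_apply, LinearMap.comp_apply,
    GrMod.sgn_apply _ (cls_mem _ n z), map_smul]
  have h := (probe M hM n).cobarSgn_T (probe M' hM' n) n OrderHom.id z
  refine (congrArg _ (boxTwisting_cls M M' hM hM' n z)).trans (h.trans ?_)
  rw [pow_succ, mul_neg_one, neg_smul]
  exact congrArg (fun y => - ((-1 : R) ^ n • y)) (boxTwisting_cls M M' hM hM' n z).symm

theorem boxTwisting_normD (n : ℕ) (z : M _⦋n⦌ ⊗[R] M' _⦋n⦌) :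
    boxTwisting M M' hM hM' (normD (under (box M M'))
        (cls (under (box M M')) n z)) =
      if n = 0 then 0 else ∑ i ∈ range (n + 1), (-1 : R) ^ i •
        (boxLetters M M' hM hM' n).T (n - 1) (skip i) z := by
  cases n with
  | zero => exact (congrArg _ (normD_zero _ z)).trans (map_zero _)
  | succ n =>
    rw [if_neg (by omega)]
    refine (map_normD_cls _ (boxTwisting M M' hM hM') n z).trans (sum_congr rfl fun i _ => ?_)
    congr 1
    refine (boxTwisting_cls M M' hM hM' n _).trans
      ((T_boxAct M M' hM hM' (face n i) n OrderHom.id z).trans ?_)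
    rw [Nat.add_sub_cancel, Letters.T_congr _ n _ (skip i)]
    intro j hj
    exact extend_apply (face n i) j (by omega)

/-- By naturality, the faces in `cobarD_T` are the values of the cochain on the faces of the
simplex, and its two factors are the values on the front and the back face. This matches the
differential and the comultiplication of the normalized complex term by term. -/
theorem boxTwisting_d (x : (normGr (under (box M M'))).carrier) :
    ((normCoalg M hM).tensor (normCoalg M' hM')).cobarD (boxTwisting M M' hM hM' x) =
      - boxTwisting M M' hM hM' (normD (under (box M M')) x) +
      LinearMap.mul' R ((normCoalg M hM).tensor (normCoalg M' hM')).Cobar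
        (TensorProduct.map
          (boxTwisting M M' hM hM' ∘ₗ (normGr (under (box M M'))).sgn)
          (boxTwisting M M' hM hM') (normComul (box M M') x)) := by
  suffices h : ((normCoalg M hM).tensor (normCoalg M' hM')).cobarD ∘ₗ
      boxTwisting M M' hM hM' =
      - (boxTwisting M M' hM hM' ∘ₗ normD (under (box M M'))) +
      LinearMap.mul' R ((normCoalg M hM).tensor (normCoalg M' hM')).Cobar ∘ₗ
        TensorProduct.map
          (boxTwisting M M' hM hM' ∘ₗ (normGr (under (box M M'))).sgn)
          (boxTwisting M M' hM hM') ∘ₗ normComul (box M M') from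
    LinearMap.congr_fun h x
  refine norm_ext _ fun n z => ?_
  refine (congrArg _ (boxTwisting_cls M M' hM hM' n z)).trans
    (((probe M hM n).cobarD_T (probe M' hM' n) n OrderHom.id z).trans ?_)
  rw [LinearMap.add_apply, LinearMap.neg_apply, LinearMap.comp_apply]
  refine congrArg₂ (fun a b => - a + b) (boxTwisting_normD M M' hM hM' n z).symm ?_
  refine congrArg (LinearMap.mul' R _) (Eq.trans ?_ (congrArg _ (normComul_cls (box M M') n z)).symm)
  -- Front faces are read along the identity and back faces along the translation by k, by
  -- `boxTwisting_piece`.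
  refine (LinearMap.congr_fun (map_awLevel (under (box M M')) (boxTwisting M M' hM hM') n
    (fun k => ((boxLetters M M' hM hM' n).T k OrderHom.id).ofConv)
    (fun k => ((boxLetters M M' hM hM' n).T (n - k) (OrderHom.id.comp (shift k))).ofConv)
    (fun k hk => LinearMap.ext fun x => ?_) fun k hk => LinearMap.ext fun y => ?_)
      (lev (box M M') n z)).symm
  · refine (boxTwisting_piece M M' hM hM' x (by omega)).trans ?_
    rw [Letters.T_congr _ k (shift 0) OrderHom.id fun i _ => by simp]
    rfl
  · exact boxTwisting_piece M M' hM hM' y (by omega)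

theorem boxTwisting_mem (n : ℕ) (x) (hx : x ∈ (normGr (under (box M M'))).deg (n + 1)) :
    boxTwisting M M' hM hM' x ∈ ((normCoalg M hM).tensor (normCoalg M' hM')).cobarDeg n := by
  obtain ⟨z, rfl⟩ := exists_cls _ hx
  have h := (probe M hM (n + 1)).T_mem (probe M' hM' (n + 1)) n OrderHom.id z
  exact (boxTwisting_cls M M' hM hM' (n + 1) z).symm ▸ h

/-- This identifies the linear part found in `T_linear` with the Alexander–Whitney sum: the face of
x with vertices 0, …, l is paired with the face of y with vertices l, …, n. -/
theorem sum_op_eq_awLevel (n : ℕ) :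
    ∑ l ∈ range (n + 1), TensorProduct.map ((probe M hM n).κ l OrderHom.id)
      ((probe M' hM' n).κ (n - l) (OrderHom.id.comp (shift l))) =
    awLevel (under M) (under M') n := by
  rw [awLevel, Finset.Nat.sum_antidiagonal_eq_sum_range_succ_mk]
  refine sum_congr rfl fun l hl => ?_
  rw [mem_range] at hl
  have h1 : op n l OrderHom.id = seg n 0 l := hom_ext_val fun i => by
    rw [op_val, seg_val, zero_add]
    rfl
  have h2 : op n (n - l) (OrderHom.id.comp (shift l)) = seg n l (n - l) := hom_ext_val fun i => by
    rw [op_val, seg_val]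
    simp [add_comm]
  rw [probe, probe]
  simp only [h1, h2]
  rfl

/-- The Alexander–Whitney map. -/
def boxAw : (normGr (under (box M M'))).carrier →ₗ[R]
    (normCoalg M hM).carrier ⊗[R] (normCoalg M' hM').carrier :=
  aw (under M) (under M')

theorem boxTwisting_linear (x : (normGr (under (box M M'))).carrier) :
    boxTwisting M M' hM hM' x -
      ChainCoalg.tensorSInv (normCoalg M hM) (normCoalg M' hM') (boxAw M M' hM hM' x) ∈
      ((normCoalg M hM).tensor (normCoalg M' hM')).higher := by
  refine norm_mem _ (boxTwisting M M' hM hM' -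
    ChainCoalg.tensorSInv (normCoalg M hM) (normCoalg M' hM') ∘ₗ boxAw M M' hM hM') _
    (fun n z => ?_) x
  have h := (probe M hM n).T_linear (probe M' hM' n) n OrderHom.id z
  have e := congrArg₂ (fun a b => a - ChainCoalg.tensorSInv (normCoalg M hM) (normCoalg M' hM') b)
    (boxTwisting_cls M M' hM hM' n z) ((aw_cls (under M) (under M') n z).trans
      (LinearMap.congr_fun (sum_op_eq_awLevel M M' hM hM' n).symm z))
  exact (congrArg (· ∈ ((normCoalg M hM).tensor (normCoalg M' hM')).higher) e).mpr h

end Simplices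

end DCSH

end

/-! ### The Alexander–Whitney map is a DCSH map. -/

namespace DCSH

attribute [local irreducible] normD in
theorem boxAw_d {R : Type u} [CommRing R] (M M' : SimplicialObject (CoalgCat.{v} R))
    (hM : IsReduced M) (hM' : IsReduced M') (x : (normGr (under (box M M'))).carrier) :
    boxAw M M' hM hM' (normD (under (box M M')) x) =
      tensorD (normCoalg M hM).toGrMod (normCoalg M' hM').toGrMod (normCoalg M hM).d
        (normCoalg M' hM').d (boxAw M M' hM hM' x) :=
  aw_d (under M) (under M') x

end DCSH

theorem mainTheorem7 {R : Type u} [CommRing R] [IsDomain R] [IsPrincipalIdealRing R]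
    (M M' : SimplicialObject (CoalgCat.{v} R))
    (hM : DCSH.IsReduced M) (hM' : DCSH.IsReduced M')
    (hfree : ∀ n : ℕ, Module.Free R (M _⦋n⦌)) (hfree' : ∀ n : ℕ, Module.Free R (M' _⦋n⦌)) :
    DCSH.ChainCoalg.IsDCSH
      (DCSH.normCoalg (DCSH.box M M') (hM.box hM'))
      ((DCSH.normCoalg M hM).tensor (DCSH.normCoalg M' hM'))
      (DCSH.awCoalg M M' hM hM') := by
  have hf : DCSH.ChainCoalg.IsChainMap (DCSH.normCoalg (DCSH.box M M') (hM.box hM'))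
      ((DCSH.normCoalg M hM).tensor (DCSH.normCoalg M' hM')) (DCSH.awCoalg M M' hM hM') :=
    ⟨DCSH.aw_mem (DCSH.under M) (DCSH.under M'), DCSH.boxAw_d M M' hM hM'⟩
  refine DCSH.ChainCoalg.isDCSH_of_twisting (DCSH.normCoalg (DCSH.box M M') (hM.box hM')) hf
    (DCSH.boxTwisting M M' hM hM') ?_ ?_ ?_ ?_ ?_
  · exact DCSH.boxTwisting_zero M M' hM hM'
  · exact DCSH.boxTwisting_mem M M' hM hM'
  · exact DCSH.boxTwisting_sgn M M' hM hM'
  · exact DCSH.boxTwisting_d M M' hM hM'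
  · exact DCSH.boxTwisting_linear M M' hM hM'
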